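/- Let $\gamma,\delta\in\mathbb R$. For $k\in\mathbb C\setminus i[-1,1]$ let $(1+k^2)^{1/2}$ denote the branch that is analytic there and asymptotic to $k$ at infinity, and put $\omega(k)=k(1+k^2)^{1/2}$, $\nu(k)=i(1+k^2)^{1/2}$, $$\Delta_1(k)=-\gamma(k+\nu)+i(\gamma\delta-k\nu),\qquad \Delta_2(k)=-\gamma(k-\nu)+i(\gamma\delta+k\nu).$$ Call $a>1$ admissible if all zeros of $\Delta_1$ and $\Delta_2$ lie in $|k|<a$. Let $\partial D_1$ be the contour from $i\infty$ down to $ia$, along the arc $|k|=a$ to $a$, and then to $+\infty$ along the real axis. Let $\partial D_2$ be the contour from $-\infty$ to $-a$ along the real axis, along the arc $|k|=a$ to $ia$, and then up to $i\infty$. For $\sigma\in\mathbb R$, $\|f\|_{H^\sigma(\mathbb R)}=\|(1+k^2)^{\sigma/2}\mathcal F\{f\}(k)\|_{L^2(\mathbb R)}$ with $\mathcal F\{f\}(k)=\int e^{-ikx}f(x)\,dx$, and $\|f\|_{H^\sigma(0,\infty)}=\inf\{\|F\|_{H^\sigma(\mathbb R)}: F|_{(0,\infty)}=f\}$. For $T>0$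 and complex-valued distributions $\varphi,\psi$ on $\mathbb R$ with $\operatorname{supp}\varphi,\operatorname{supp}\psi\subset(0,T)$, let $v(t)=S[0,0,\varphi,\psi;0](t)$ be the distribution in $x\in(0,\infty)$ given by $$v(x,t)=-\frac1{2\pi}\int_{\partial D_2}\frac{e^{ikx+i\omega t}}{i\omega}\,\frac{k(k-\nu)}{\Delta_2(k)}\Big\{(\nu+i\gamma)\mathcal F\{\psi\}(\omega)+i\nu(\nu+i\delta)\mathcal F\{\varphi\}(\omega)\Big\}dk$$ $$\qquad-\frac1{2\pi}\int_{\partial D_1}\frac{e^{ikx-i\omega t}}{i\omega}\,\frac{k(k+\nu)}{\Delta_1(k)}\Big\{(\nu-i\gamma)\mathcal F\{\psi\}(-\omega)-i\nu(\nu-i\delta)\mathcal F\{\varphi\}(-\omega)\Big\}dk,$$ understood by pairing $e^{ikx}$ with test functions in $C_c^\infty(0,\infty)$ before integrating in $k$. **Theorem.** Admissible radii exist. There are constants $c_j(s)>0$ and $c_j(s,T)>0$ ($j\in\mathbb N_0$, $s\in\mathbb R$, $T>0$), which may depend on $\gamma,\delta$ but on nothing else, such that $c_j(s,T)$ remains bounded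 as $T\to0^+$ and the following holds for every $s\in\mathbb R$, every $T>0$, every admissible $a$ and all $\varphi\in H^{\frac{2s-1}4}(\mathbb R)$, $\psi\in H^{\frac{2s-3}4}(\mathbb R)$ with supports in $(0,T)$. 1. $v$ solves the reduced initial-boundary value problem $$v_{tt}-v_{xx}+v_{xxxx}=0\ \ (x>0,\ 0<t<T),\qquad v(x,0)=v_t(x,0)=0,$$ $$v_x(0,t)+\gamma v(0,t)=\varphi(t),\qquad v_{xx}(0,t)+\delta v_x(0,t)=\psi(t)$$ in the following sense. For each $t\in[0,T]$, $v(t)$ is the restriction to $(0,\infty)$ of a tempered distribution. For each test function $\theta\in C_c^\infty(0,\infty)$, $t\mapsto\langle v(t),\theta\rangle$ is smooth on $[0,T]$. The equation and the initial conditions hold as distributions in $x$. For every $\chi\in C_c^\infty(0,T)$ the average $\int\chi(t)\,v(\cdot,t)\,dt$ is a function $W$ that is $C^2$ on $[0,\infty)$, with $W'(0)+\gamma W(0)=\langle\varphi,\chi\rangle$ and $W''(0)+\delta W'(0)=\langle\psi,\chi\rangle$. 2. For all $t\in[0,T]$ and $j\in\mathbb N_0$, $$\|\partial_t^jv(t)\|_{H^{s-2j}(0,\infty)}\le\Big[c_j(s)+c_j(s,T)\sqrt{T+1}\,\big(1-e^{-(T+1)}\big)^{-1}\Big]\Big(\|\varphi\|_{H^{\frac{2s-1}4}(\mathbb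 R)}+\|\psi\|_{H^{\frac{2s-3}4}(\mathbb R)}\Big).$$ -/

import Mathlib

open MeasureTheory Set Filter TopologicalSpace
open scoped Topology ContDiff ENNReal SchwartzMap Distributions FourierTransform LineDeriv

noncomputable section

namespace GoodBoussinesq

/-! ### Sobolev spaces on the line and on the half-line -/

/-- The norm of `H^s(ℝ)`, `‖(1 + k²)^{s/2} ∫ e^{-ikx} f(x) dx‖_{L²(dk)}`, of a tempered distribution,
with value `∞` if `f` is not in `H^s(ℝ)`. Mathlib's Fourier transform has the kernel `e^{-2πixξ}`, so
`k = 2πξ`, and `dk = 2π dξ` is the factor `√(2π)`. -/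
def sobolevNorm (s : ℝ) (f : 𝓢'(ℝ, ℂ)) : ℝ≥0∞ :=
  ⨅ (g : Lp ℂ 2 (volume : Measure ℝ))
    (_ : TemperedDistribution.smulLeftCLM ℂ
      (fun ξ : ℝ => (((1 + (2 * Real.pi * ξ) ^ 2) ^ (s / 2) : ℝ) : ℂ)) (𝓕 f) = (g : 𝓢'(ℝ, ℂ))),
    ENNReal.ofReal (Real.sqrt (2 * Real.pi)) * ‖g‖ₑ

/-- A test function on an open set, as a Schwartz function on the line. -/
def testToSchwartz {Ω : Opens ℝ} (θ : 𝓓(Ω, ℂ)) : 𝓢(ℝ, ℂ) :=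
  θ.hasCompactSupport.toSchwartzMap θ.contDiff

/-- The open interval `(0, ∞)`. -/
def halfLine : Opens ℝ := ⟨Ioi 0, isOpen_Ioi⟩

/-- The open interval `(0, T)`. -/
def timeInterval (T : ℝ) : Opens ℝ := ⟨Ioo 0 T, isOpen_Ioo⟩

/-- The tempered distribution `F` restricts on `(0, ∞)` to the functional `u` on test functions. -/
def RestrictsTo (F : 𝓢'(ℝ, ℂ)) (u : 𝓓(halfLine, ℂ) → ℂ) : Prop :=
  ∀ θ : 𝓓(halfLine, ℂ), F (testToSchwartz θ) = u θ

/-- The norm of `H^s(0, ∞)`: the infimum of `‖F‖_{H^s(ℝ)}` over all `F` with `F|_{(0,∞)} = u`.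
It is finite exactly when `u` is the restriction of an element of `H^s(ℝ)` (so that `u` is in
particular a distribution on `(0, ∞)`), and `∞` otherwise. -/
def sobolevNormHalfLine (s : ℝ) (u : 𝓓(halfLine, ℂ) → ℂ) : ℝ≥0∞ :=
  ⨅ (F : 𝓢'(ℝ, ℂ)) (_ : RestrictsTo F u), sobolevNorm s F

/-! ### The Fourier transform of a distribution supported in `(0, T)` -/

/-- A smooth cutoff which is `1` on `[0, T]` and vanishes outside `(-1, T + 1)`. -/
def cutoff (T t : ℝ) : ℝ := Real.smoothTransition (t + 1) * Real.smoothTransition (T + 1 - t)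

/-- `t ↦ e^{-iwt}`, cut off outside `[0, T]`. -/
def cutExp (T : ℝ) (w : ℂ) (t : ℝ) : ℂ := (cutoff T t : ℂ) * Complex.exp (-Complex.I * w * t)

theorem cutExp_contDiff (T : ℝ) (w : ℂ) : ContDiff ℝ ∞ (cutExp T w) := by
  have h1 : ContDiff ℝ ∞ (cutoff T) :=
    (Real.smoothTransition.contDiff.comp (contDiff_id.add contDiff_const)).mul
      (Real.smoothTransition.contDiff.comp (contDiff_const.sub contDiff_id))
  have h2 : ContDiff ℝ ∞ (fun t : ℝ => Complex.exp (-Complex.I * w * t)) :=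
    (contDiff_const.mul Complex.ofRealCLM.contDiff).cexp
  exact (Complex.ofRealCLM.contDiff.comp h1).mul h2

theorem cutExp_hasCompactSupport (T : ℝ) (w : ℂ) : HasCompactSupport (cutExp T w) := by
  refine HasCompactSupport.intro (isCompact_Icc (a := (-1 : ℝ)) (b := T + 1)) fun t ht => ?_
  have h : cutoff T t = 0 := by
    unfold cutoff
    by_cases h1 : t < -1
    · rw [Real.smoothTransition.zero_of_nonpos (by linarith), zero_mul]
    · have h2 : T + 1 < t := by
        by_contra h3
        exact ht ⟨not_lt.mp h1, not_lt.mp h3⟩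
      rw [Real.smoothTransition.zero_of_nonpos (x := T + 1 - t) (by linarith), mul_zero]
  simp [cutExp, h]

/-- The Fourier transform `∫ e^{-iwt} φ(t) dt` at a complex `w` of a distribution `φ` whose support
is contained in `(0, T)`. As the cutoff is `1` on a neighbourhood of the support, the
value does not depend on its choice. -/
def timeFourier (T : ℝ) (φ : 𝓢'(ℝ, ℂ)) (w : ℂ) : ℂ :=
  φ ((cutExp_hasCompactSupport T w).toSchwartzMap (cutExp_contDiff T w))

/-! ### The unified transform formula -/

/-- The branch of `(1 + k²)^{1/2}` which is analytic off the segment `i[-1, 1]` and behaves like `k`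
at infinity. -/
def rootBranch (k : ℂ) : ℂ := k * (1 + (k ^ 2)⁻¹) ^ (1 / 2 : ℂ)

/-- The dispersion relation `ω(k) = k (1 + k²)^{1/2}`. -/
def disp (k : ℂ) : ℂ := k * rootBranch k

/-- `ν(k) = i (1 + k²)^{1/2}`. -/
def nu (k : ℂ) : ℂ := Complex.I * rootBranch k

/-- `Δ₁(k) = -γ (k + ν) + i (γδ - kν)`. -/
def Delta1 (γ δ : ℝ) (k : ℂ) : ℂ := -γ * (k + nu k) + Complex.I * (γ * δ - k * nu k)

/-- `Δ₂(k) = -γ (k - ν) + i (γδ + kν)`. -/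
def Delta2 (γ δ : ℝ) (k : ℂ) : ℂ := -γ * (k - nu k) + Complex.I * (γ * δ + k * nu k)

/-- The circle `|k| = a` encloses the branch cut `i[-1, 1]` and all zeros of `Δ₁` and `Δ₂`. -/
def AdmissibleRadius (γ δ a : ℝ) : Prop :=
  1 < a ∧ ∀ k : ℂ, a ≤ ‖k‖ → Delta1 γ δ k ≠ 0 ∧ Delta2 γ δ k ≠ 0

/-- Integral over `∂D₁`: from `i∞` down to `ia`, along the arc of radius `a` to `a`, then along the
real axis to `+∞`. -/
def contourD1 (a : ℝ) (f : ℂ → ℂ) : ℂ :=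
  -(∫ r in Ioi a, f (Complex.I * r) * Complex.I)
  - (∫ ϑ in (0 : ℝ)..(Real.pi / 2), f (circleMap 0 a ϑ) * (Complex.I * circleMap 0 a ϑ))
  + ∫ r in Ioi a, f r

/-- Integral over `∂D₂`: from `-∞` along the real axis to `-a`, along the arc of radius `a` to `ia`,
then up to `i∞`. -/
def contourD2 (a : ℝ) (f : ℂ → ℂ) : ℂ :=
  (∫ r in Ioi a, f (-r))
  - (∫ ϑ in (Real.pi / 2)..Real.pi, f (circleMap 0 a ϑ) * (Complex.I * circleMap 0 a ϑ))
  + ∫ r in Ioi a, f (Complex.I * r) * Complex.I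

/-- The spectral density multiplying `e^{ikx - iω(k)t}` on `∂D₁`. -/
def density1 (γ δ T : ℝ) (φ ψ : 𝓢'(ℝ, ℂ)) (k : ℂ) : ℂ :=
  1 / (Complex.I * disp k) * (k * (k + nu k) / Delta1 γ δ k) *
    ((nu k - Complex.I * γ) * timeFourier T ψ (-disp k)
      - Complex.I * nu k * (nu k - Complex.I * δ) * timeFourier T φ (-disp k))

/-- The spectral density multiplying `e^{ikx + iω(k)t}` on `∂D₂`. -/
def density2 (γ δ T : ℝ) (φ ψ : 𝓢'(ℝ, ℂ)) (k : ℂ) : ℂ :=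
  1 / (Complex.I * disp k) * (k * (k - nu k) / Delta2 γ δ k) *
    ((nu k + Complex.I * γ) * timeFourier T ψ (disp k)
      + Complex.I * nu k * (nu k + Complex.I * δ) * timeFourier T φ (disp k))

/-- The pairing `∫ e^{ikx} θ(x) dx` of an exponential with a test function. -/
def expPairing (θ : 𝓓(halfLine, ℂ)) (k : ℂ) : ℂ := ∫ x : ℝ, Complex.exp (Complex.I * k * x) * θ x

/-- The unified transform solution `v(t) = S[0, 0, φ, ψ; 0](t)` of the reduced problem,
`v(x, t) = -(1/2π) ∫_{∂D₂} e^{ikx + iωt} (density2) dk - (1/2π) ∫_{∂D₁} e^{ikx - iωt} (density1) dk`,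
as a distribution in `x ∈ (0, ∞)`: each exponential `e^{ikx}` is paired with the test function. (For
distributional data the integrals over `k` need not converge at a single point `x`; the pairing with
a test function decays faster than any power of `k` along both contours.) -/
def utmSolution (γ δ a T : ℝ) (φ ψ : 𝓢'(ℝ, ℂ)) (t : ℝ) (θ : 𝓓(halfLine, ℂ)) : ℂ :=
  -(1 / (2 * Real.pi)) * contourD2 a (fun k =>
      expPairing θ k * Complex.exp (Complex.I * disp k * t) * density2 γ δ T φ ψ k)
  - (1 / (2 * Real.pi)) * contourD1 a (fun k =>
      expPairing θ k * Complex.exp (-Complex.I * disp k * t) * density1 γ δ T φ ψ k)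

/-! ### The reduced initial-boundary value problem -/

/-- `∂_t^j v(t)`, computed in the time interval `[0, T]`, as a functional on test functions in `x`. -/
def timeDeriv (T : ℝ) (v : ℝ → 𝓓(halfLine, ℂ) → ℂ) (j : ℕ) (t : ℝ) (θ : 𝓓(halfLine, ℂ)) : ℂ :=
  iteratedDerivWithin j (fun τ => v τ θ) (Icc 0 T) t

/-- `v : [0, T] → 𝓓'(0, ∞)` solves the reduced initial-boundary value problem
`v_tt - v_xx + v_xxxx = 0`, `v(0) = v_t(0) = 0`, `v_x + γ v = φ` and `v_xx + δ v_x = ψ` at `x = 0`,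
for distributional boundary data. The boundary values are distributions in time: averaged against any
`χ ∈ C_c^∞(0, T)`, `v` is a function of `x` that is twice continuously differentiable up to
`x = 0`. -/
structure IsReducedSolution (γ δ T : ℝ) (φ ψ : 𝓢'(ℝ, ℂ)) (v : ℝ → 𝓓(halfLine, ℂ) → ℂ) : Prop where
  /-- Every `v(t)` is the restriction to `(0, ∞)` of a tempered distribution. -/
  restriction : ∀ t ∈ Icc 0 T, ∃ F : 𝓢'(ℝ, ℂ), RestrictsTo F (v t)
  /-- `v` is weakly smooth in time. -/
  smooth : ∀ θ, ContDiffOn ℝ ∞ (fun t => v t θ) (Icc 0 T)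
  /-- The equation, in the sense of distributions in `x`. -/
  equation : ∀ t ∈ Icc 0 T, ∀ θ : 𝓓(halfLine, ℂ),
    timeDeriv T v 2 t θ - v t (∂_{(1 : ℝ)} (∂_{(1 : ℝ)} θ))
      + v t (∂_{(1 : ℝ)} (∂_{(1 : ℝ)} (∂_{(1 : ℝ)} (∂_{(1 : ℝ)} θ)))) = 0
  /-- The first initial condition. -/
  initial : ∀ θ, v 0 θ = 0
  /-- The second initial condition. -/
  initial_deriv : ∀ θ, timeDeriv T v 1 0 θ = 0
  /-- The two Robin boundary conditions. -/
  boundary : ∀ χ : 𝓓(timeInterval T, ℂ), ∃ W : ℝ → ℂ, ContDiffOn ℝ 2 W (Ici 0) ∧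
    (∀ θ : 𝓓(halfLine, ℂ), ∫ t in Ioo 0 T, χ t * v t θ = ∫ x in Ioi 0, W x * θ x) ∧
    derivWithin W (Ici 0) 0 + γ * W 0 = φ (testToSchwartz χ) ∧
    iteratedDerivWithin 2 W (Ici 0) 0 + δ * derivWithin W (Ici 0) 0 = ψ (testToSchwartz χ)

end GoodBoussinesq

end

open GoodBoussinesq

noncomputable section

namespace GoodBoussinesq

/-! ### Weights and Fourier densities -/

/-! Transforms of the data. A distribution in H^σ supported in (0,T) has finite order, so its
transform is entire, coincides on the real line with its Fourier density, and grows at most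
polynomially in the closed lower half-plane (`isTimeTransform`). For |k| > 1, Im ω is a positive
multiple of Im k², so -ω on the first quadrant and ω on the second stay in that half-plane. Hence
the spectral densities grow at most polynomially in the sectors bounded by ∂D₁ and ∂D₂. The pairing
of e^{ikx} with a test function on (0,∞) decays there faster than any power, and on the contours the
time exponentials are bounded for t in [0,T]. All integrals therefore converge and may be
differentiated in t.

Radius, equation, initial data. With k = e^u, the exterior of a disc becomes a half-plane, where
holomorphic integrands have primitives. A contour integral is the difference of the limits of a
primitive along the two rays. So the radius is irrelevant and is fixed as `largeRadius`, a function
of γ and δ only. At t = 0 the integrand decays in the whole sector and the integral vanishes. The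
equation is ω² = k² + k⁴ under the integral sign.

Boundary values. Averaging in time against χ gives rapid decay in k, so the average W is smooth up
to x = 0. A boundary operator multiplies the density by a polynomial m(k). The map ν carries ∂D₁ to
∂D₂ near infinity, with ω(ν(k)) = -ω(k). Transported by ν, the two integrands add up to a multiple
of F(ω) dω by an algebraic identity between the coefficients. The sum of the two contour integrals
becomes an integral over the real ω-line (`contourS_add_contourS_eq`), evaluated by Parseval as the
datum paired with χ.

Estimate. It is proved piece by piece, each piece being represented by a Fourier density
(`HalfBound`). On the real rays this is Plancherel. On the imaginary ray e^{-rx} is extended to a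
Schwartz function of x, and the resulting kernel is dominated by the Hilbert-type kernel 1/(|ξ|+r),
bounded on L² by the Schur test. On the arc the kernels have L² norm of order (Im k)^{-1/2}, which
is integrable. On both axes ω is real with |ω| ≍ r² and |dω| ≥ r dr, so changing variables from r to
ω turns order s in x into order (2s-1)/4 for φ and (2s-3)/4 for ψ. Each time derivative costs ω,
that is, two orders in x. -/

/-- The weight `(1 + (2πξ)²)^{s/2}` of the Sobolev norm. -/
def weight (s ξ : ℝ) : ℝ := (1 + (2 * Real.pi * ξ) ^ 2) ^ (s / 2)

theorem weight_pos (s ξ : ℝ) : 0 < weight s ξ := by unfold weight; positivity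

theorem weight_mul (s r ξ : ℝ) : weight s ξ * weight r ξ = weight (s + r) ξ := by
  unfold weight
  rw [← Real.rpow_add (by positivity)]
  congr 1; ring

theorem weight_zero (ξ : ℝ) : weight 0 ξ = 1 := by simp [weight]

theorem weight_mul_neg (s ξ : ℝ) : weight s ξ * weight (-s) ξ = 1 := by
  rw [weight_mul, add_neg_cancel, weight_zero]

theorem weight_hasTemperateGrowth (s : ℝ) :
    Function.HasTemperateGrowth (fun ξ : ℝ => ((weight s ξ : ℝ) : ℂ)) := by
  have h1 : Function.HasTemperateGrowth (fun x : ℝ => (1 + ‖x‖ ^ 2) ^ (s / 2)) :=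
    Function.hasTemperateGrowth_one_add_norm_sq_rpow ℝ (s / 2)
  have h2 : Function.HasTemperateGrowth (fun x : ℝ => (2 * Real.pi) * x) := by fun_prop
  have h3 : Function.HasTemperateGrowth (fun ξ : ℝ => weight s ξ) := by
    convert h1.comp h2 using 2 with ξ
    simp [weight]
  fun_prop

theorem continuous_weight (s : ℝ) : Continuous (weight s) := by
  unfold weight
  refine Continuous.rpow_const (by fun_prop) fun ξ => Or.inl (by positivity)

theorem weight_smul_neg_smul (s : ℝ) (f : 𝓢(ℝ, ℂ)) :
    SchwartzMap.smulLeftCLM ℂ (fun ξ : ℝ => ((weight s ξ : ℝ) : ℂ))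
      (SchwartzMap.smulLeftCLM ℂ (fun ξ : ℝ => ((weight (-s) ξ : ℝ) : ℂ)) f) = f := by
  ext ξ
  rw [SchwartzMap.smulLeftCLM_apply_apply (weight_hasTemperateGrowth _),
    SchwartzMap.smulLeftCLM_apply_apply (weight_hasTemperateGrowth _), smul_smul,
    ← Complex.ofReal_mul, weight_mul_neg]
  simp

/-- `G` is the density of the Fourier transform of the tempered distribution `φ`. -/
def HasFourierDensity (φ : 𝓢'(ℝ, ℂ)) (G : ℝ → ℂ) : Prop :=
  ∀ f : 𝓢(ℝ, ℂ), φ f = ∫ ξ, G ξ * (𝓕⁻ f) ξ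

/-- L² embeds injectively in the tempered distributions, so the infimum defining the norm runs over
at most one function. -/
theorem sobolevNorm_eq {s : ℝ} {f : 𝓢'(ℝ, ℂ)} {g : Lp ℂ 2 (volume : Measure ℝ)}
    (h : TemperedDistribution.smulLeftCLM ℂ (fun ξ : ℝ => ((weight s ξ : ℝ) : ℂ)) (𝓕 f)
      = (g : 𝓢'(ℝ, ℂ))) :
    sobolevNorm s f = ENNReal.ofReal (Real.sqrt (2 * Real.pi)) * ‖g‖ₑ := by
  refine le_antisymm (iInf₂_le g h) (le_iInf₂ fun g' h' => ?_)
  have h'' : (g : 𝓢'(ℝ, ℂ)) = (g' : 𝓢'(ℝ, ℂ)) := h.symm.trans h'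
  have : g = g' := by
    have hk := MeasureTheory.Lp.ker_toTemperedDistributionCLM_eq_bot (F := ℂ) (E := ℝ)
      (μ := volume) (p := 2)
    rw [LinearMap.ker_eq_bot] at hk
    exact hk h''
  rw [this]

/-- A distribution of finite Sobolev norm has a Fourier density in the weighted `L²` space. -/
theorem exists_hasFourierDensity {s : ℝ} {φ : 𝓢'(ℝ, ℂ)} (h : sobolevNorm s φ < ⊤) :
    ∃ G : ℝ → ℂ, StronglyMeasurable G ∧ HasFourierDensity φ G ∧
      MemLp (fun ξ => (weight s ξ : ℂ) * G ξ) 2 ∧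
      sobolevNorm s φ =
        ENNReal.ofReal (Real.sqrt (2 * Real.pi)) * eLpNorm (fun ξ => (weight s ξ : ℂ) * G ξ) 2 := by
  obtain ⟨g, hg⟩ := iInf_lt_iff.mp h
  obtain ⟨hg, -⟩ := iInf_lt_iff.mp hg
  change TemperedDistribution.smulLeftCLM ℂ (fun ξ : ℝ => ((weight s ξ : ℝ) : ℂ)) (𝓕 φ)
      = (g : 𝓢'(ℝ, ℂ)) at hg
  have hfun : (fun ξ => (weight s ξ : ℂ) * ((weight (-s) ξ : ℂ) * g ξ)) = g := by
    ext ξ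
    rw [← mul_assoc, ← Complex.ofReal_mul, weight_mul_neg]; simp
  refine ⟨fun ξ => (weight (-s) ξ : ℂ) * g ξ, ?_, fun f => ?_, ?_, ?_⟩
  · exact (Complex.continuous_ofReal.comp (continuous_weight _)).stronglyMeasurable.mul
      (Lp.stronglyMeasurable g)
  · calc φ f = (𝓕 φ) (𝓕⁻ f) := by simp
      _ = (TemperedDistribution.smulLeftCLM ℂ (fun ξ : ℝ => ((weight s ξ : ℝ) : ℂ)) (𝓕 φ))
          (SchwartzMap.smulLeftCLM ℂ (fun ξ : ℝ => ((weight (-s) ξ : ℝ) : ℂ)) (𝓕⁻ f)) := by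
        rw [TemperedDistribution.smulLeftCLM_apply_apply, weight_smul_neg_smul]
      _ = _ := by
        rw [hg, Lp.toTemperedDistribution_apply]
        refine integral_congr_ae (.of_forall fun ξ => ?_)
        simp only [SchwartzMap.smulLeftCLM_apply_apply (weight_hasTemperateGrowth (-s)), smul_eq_mul]
        ring
  · rw [hfun]; exact Lp.memLp g
  · rw [hfun, sobolevNorm_eq hg, Lp.enorm_def]

/-- Every function in the weighted `L²` space is the Fourier density of an element of `H^s`. -/
theorem exists_of_memLp {s : ℝ} {G : ℝ → ℂ} (hG : MemLp (fun ξ => (weight s ξ : ℂ) * G ξ) 2) :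
    ∃ F : 𝓢'(ℝ, ℂ), HasFourierDensity F G ∧ sobolevNorm s F =
      ENNReal.ofReal (Real.sqrt (2 * Real.pi)) * eLpNorm (fun ξ => (weight s ξ : ℂ) * G ξ) 2 := by
  set g := hG.toLp _
  refine ⟨𝓕⁻ (TemperedDistribution.smulLeftCLM ℂ (fun ξ : ℝ => ((weight (-s) ξ : ℝ) : ℂ))
    (g : 𝓢'(ℝ, ℂ))), fun f => ?_, ?_⟩
  · rw [TemperedDistribution.fourierInv_apply, TemperedDistribution.smulLeftCLM_apply_apply,
      Lp.toTemperedDistribution_apply]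
    refine integral_congr_ae ?_
    filter_upwards [hG.coeFn_toLp] with ξ hξ
    simp only [SchwartzMap.smulLeftCLM_apply_apply (weight_hasTemperateGrowth (-s)), smul_eq_mul, g, hξ]
    have : ((weight s ξ : ℝ) : ℂ) * ((weight (-s) ξ : ℝ) : ℂ) = 1 := by
      rw [← Complex.ofReal_mul, weight_mul_neg, Complex.ofReal_one]
    linear_combination (G ξ * (𝓕⁻ f) ξ) * this
  · rw [sobolevNorm_eq (g := g), Lp.enorm_def, eLpNorm_congr_ae hG.coeFn_toLp]
    ext f
    simp only [FourierTransform.fourier_fourierInv_eq, TemperedDistribution.smulLeftCLM_apply_apply]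
    congr 1
    simpa using weight_smul_neg_smul (-s) f

/-! ### Transposition and derivatives under the Fourier transform. -/

theorem integral_mul_fourierInv_eq {B h : ℝ → ℂ} (hB : Integrable B) (hh : Integrable h) :
    ∫ ξ, B ξ * 𝓕⁻ h ξ = ∫ t, 𝓕⁻ B t * h t := by
  have := VectorFourier.integral_fourierIntegral_smul_eq_flip (μ := volume) (ν := volume)
    (f := B) (g := h) (e := Real.fourierChar) (L := -innerₗ ℝ) Real.continuous_fourierChar
    (continuous_inner (𝕜 := ℝ) (E := ℝ)).neg hB hh
  have hflip : (-innerₗ ℝ : ℝ →ₗ[ℝ] ℝ →ₗ[ℝ] ℝ).flip = -innerₗ ℝ := by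
    ext; simp
  rw [hflip] at this
  exact this.symm

theorem iterate_derivCLM_apply (f : 𝓢(ℝ, ℂ)) (n : ℕ) :
    (((SchwartzMap.derivCLM ℂ ℂ)^[n] f : 𝓢(ℝ, ℂ)) : ℝ → ℂ) = iteratedDeriv n f := by
  induction n generalizing f with
  | zero => simp
  | succ n ih =>
    rw [Function.iterate_succ_apply, ih, iteratedDeriv_succ']
    rfl

theorem fourierInv_derivCLM (f : 𝓢(ℝ, ℂ)) (ξ : ℝ) :
    (𝓕⁻ (SchwartzMap.derivCLM ℂ ℂ f)) ξ = -(2 * Real.pi * Complex.I * ξ) * (𝓕⁻ f) ξ := by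
  have h1 : SchwartzMap.derivCLM ℂ ℂ f = ∂_{(1 : ℝ)} f := by
    ext x
    rw [SchwartzMap.lineDerivOp_apply_eq_fderiv]
    simp
  have h2 : Function.HasTemperateGrowth (fun x : ℝ => inner ℝ x (1 : ℝ)) := by fun_prop
  rw [h1, SchwartzMap.fourierInv_lineDerivOp_eq]
  simp only [smul_apply, SchwartzMap.smulLeftCLM_apply_apply h2]
  simp
  ring

theorem fourier_derivCLM (f : 𝓢(ℝ, ℂ)) (ξ : ℝ) :
    (𝓕 (SchwartzMap.derivCLM ℂ ℂ f)) ξ = (2 * Real.pi * Complex.I * ξ) * (𝓕 f) ξ := by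
  have h1 : SchwartzMap.derivCLM ℂ ℂ f = ∂_{(1 : ℝ)} f := by
    ext x
    rw [SchwartzMap.lineDerivOp_apply_eq_fderiv]
    simp
  have h2 : Function.HasTemperateGrowth (fun x : ℝ => inner ℝ x (1 : ℝ)) := by fun_prop
  rw [h1, SchwartzMap.fourier_lineDerivOp_eq]
  simp only [smul_apply, SchwartzMap.smulLeftCLM_apply_apply h2]
  simp
  ring

theorem fourier_iterate_derivCLM (f : 𝓢(ℝ, ℂ)) (n : ℕ) (ξ : ℝ) :
    (𝓕 ((SchwartzMap.derivCLM ℂ ℂ)^[n] f)) ξ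
      = (2 * Real.pi * Complex.I * ξ) ^ n * (𝓕 f) ξ := by
  induction n with
  | zero => simp
  | succ n ih => rw [Function.iterate_succ_apply', fourier_derivCLM, ih]; ring

theorem fourierInv_iterate_derivCLM (f : 𝓢(ℝ, ℂ)) (n : ℕ) (ξ : ℝ) :
    (𝓕⁻ ((SchwartzMap.derivCLM ℂ ℂ)^[n] f)) ξ
      = (-(2 * Real.pi * Complex.I * ξ)) ^ n * (𝓕⁻ f) ξ := by
  induction n with
  | zero => simp
  | succ n ih => rw [Function.iterate_succ_apply', fourierInv_derivCLM, ih]; ring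

/-- The real multiplier `1 + (2πξ)^{4m}` of the operator `1 + ∂^{4m}`. -/
theorem fourierInv_add_iterate_derivCLM (f : 𝓢(ℝ, ℂ)) (m : ℕ) (ξ : ℝ) :
    (𝓕⁻ (f + (SchwartzMap.derivCLM ℂ ℂ)^[4 * m] f)) ξ
      = ((1 + (2 * Real.pi * ξ) ^ (4 * m) : ℝ) : ℂ) * (𝓕⁻ f) ξ := by
  rw [FourierTransform.fourierInv_add, add_apply, fourierInv_iterate_derivCLM]
  have : (-(2 * Real.pi * Complex.I * ξ) : ℂ) ^ (4 * m) = (2 * Real.pi * ξ) ^ (4 * m) := by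
    rw [pow_mul, pow_mul]
    congr 1
    linear_combination (2 * Real.pi * ξ : ℂ) ^ 4 * Complex.I_pow_four
  rw [this]; push_cast; ring

/-! ### Sobolev distributions as derivatives of bounded functions. -/

theorem memLp_weight_neg {r : ℝ} (hr : r ≤ -1) : MemLp (weight r) 2 := by
  rw [memLp_two_iff_integrable_sq (continuous_weight r).aestronglyMeasurable]
  have h1 : Integrable (fun ξ : ℝ => (1 + (2 * Real.pi * ξ) ^ 2)⁻¹) :=
    integrable_inv_one_add_sq.comp_mul_left' (by positivity)
  refine h1.mono' (by have := continuous_weight r; fun_prop) (.of_forall fun ξ => ?_)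
  rw [Real.norm_of_nonneg (by positivity), sq, weight_mul, weight, ← Real.rpow_neg_one]
  exact Real.rpow_le_rpow_of_exponent_le (by nlinarith [sq_nonneg (2 * Real.pi * ξ)]) (by linarith)

/-- The multiplier 1 + (2πξ)^{4m} has order 4m, so dividing by it leaves order at most -1; the
constant comes from convexity of y ↦ y^{2m}. -/
theorem weight_div_le (σ : ℝ) {m : ℕ} (hm : 1 - σ ≤ 4 * m) (ξ : ℝ) :
    weight (-σ) ξ / (1 + (2 * Real.pi * ξ) ^ (4 * m)) ≤ 2 ^ (2 * m) * weight (-1) ξ := by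
  have hy : 0 ≤ (2 * Real.pi * ξ) ^ (4 * m) := by
    rw [show 4 * m = 2 * (2 * m) by ring, pow_mul]; positivity
  rw [div_le_iff₀ (by positivity)]
  have h1 : weight (4 * m) ξ ≤ 2 ^ (2 * m) * (1 + (2 * Real.pi * ξ) ^ (4 * m)) := by
    have : weight (4 * m) ξ = (1 + (2 * Real.pi * ξ) ^ 2) ^ (2 * m) := by
      rw [weight, ← Real.rpow_natCast _ (2 * m)]
      congr 1; push_cast; ring
    rw [this]
    calc (1 + (2 * Real.pi * ξ) ^ 2) ^ (2 * m)
        ≤ 2 ^ (2 * m - 1) * (1 ^ (2 * m) + ((2 * Real.pi * ξ) ^ 2) ^ (2 * m)) :=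
          add_pow_le zero_le_one (by positivity) _
      _ ≤ 2 ^ (2 * m) * (1 + (2 * Real.pi * ξ) ^ (4 * m)) := by
          rw [one_pow, ← pow_mul, show 2 * (2 * m) = 4 * m by ring]
          gcongr
          · norm_num
          · omega
  have h2 : weight (-σ) ξ ≤ weight (-1) ξ * weight (4 * m) ξ := by
    rw [weight_mul]
    exact Real.rpow_le_rpow_of_exponent_le (by nlinarith [sq_nonneg (2 * Real.pi * ξ)])
      (by linarith)
  calc _ ≤ weight (-1) ξ * weight (4 * m) ξ := h2
    _ ≤ weight (-1) ξ * (2 ^ (2 * m) * (1 + (2 * Real.pi * ξ) ^ (4 * m))) := by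
      gcongr; exact (weight_pos _ _).le
    _ = _ := by ring

/-- A distribution in `H^σ` is `1 + ∂^{4m}` applied to a bounded continuous function. -/
theorem exists_bounded_representation (σ : ℝ) : ∃ (m : ℕ) (C : ℝ), 0 ≤ C ∧
    ∀ (φ : 𝓢'(ℝ, ℂ)) (G : ℝ → ℂ), HasFourierDensity φ G → AEStronglyMeasurable G →
      MemLp (fun ξ => (weight σ ξ : ℂ) * G ξ) 2 →
      ∃ b : ℝ → ℂ, Continuous b ∧
        (∀ t, ‖b t‖ ≤ C * (eLpNorm (fun ξ => (weight σ ξ : ℂ) * G ξ) 2).toReal) ∧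
        ∀ f : 𝓢(ℝ, ℂ), φ f = ∫ t, b t * (f t + iteratedDeriv (4 * m) f t) := by
  -- Order -1 is enough for square integrability on the line. The exponent 4m makes the symbol of 1
  -- + ∂^{4m} real and at least 1, hence invertible.
  obtain ⟨m, hm⟩ := exists_nat_ge (1 - σ)
  replace hm : 1 - σ ≤ 4 * m := hm.trans (by linarith [Nat.cast_nonneg (α := ℝ) m])
  set K : ℝ → ℝ := fun ξ => weight (-σ) ξ / (1 + (2 * Real.pi * ξ) ^ (4 * m)) with hK
  have hpos : ∀ ξ : ℝ, 0 < 1 + (2 * Real.pi * ξ) ^ (4 * m) := fun ξ => by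
    have : 0 ≤ (2 * Real.pi * ξ) ^ (4 * m) := by
      rw [show 4 * m = 2 * (2 * m) by ring, pow_mul]; positivity
    positivity
  have hKc : Continuous K := (continuous_weight _).div (by fun_prop) fun ξ => (hpos ξ).ne'
  have hKL : MemLp K 2 := by
    refine ((memLp_weight_neg le_rfl).const_mul (2 ^ (2 * m))).mono hKc.aestronglyMeasurable
      (.of_forall fun ξ => ?_)
    rw [Real.norm_of_nonneg (div_nonneg (weight_pos _ _).le (hpos ξ).le)]
    exact (weight_div_le σ hm ξ).trans (Real.le_norm_self _)
  refine ⟨m, (eLpNorm K 2).toReal, ENNReal.toReal_nonneg, fun φ G hφ hGm hG => ?_⟩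
  -- B equals G divided by 1 + (2πξ)^{4m}. As a product of two L² functions it is integrable, so its
  -- inverse transform is the bounded continuous function sought.
  set B : ℝ → ℂ := fun ξ => (K ξ : ℂ) * ((weight σ ξ : ℂ) * G ξ) with hBdef
  have hBI : Integrable B := MemLp.integrable_mul (hKL.ofReal (K := ℂ)) hG
  have hBn : ∫ ξ, ‖B ξ‖ ≤ (eLpNorm K 2).toReal *
      (eLpNorm (fun ξ => (weight σ ξ : ℂ) * G ξ) 2).toReal := by
    have h1 : eLpNorm B 1 ≤ eLpNorm K 2 * eLpNorm (fun ξ => (weight σ ξ : ℂ) * G ξ) 2 := by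
      have := eLpNorm_smul_le_mul_eLpNorm (p := 2) (q := 2) (r := 1) hG.1
        (φ := fun ξ => (K ξ : ℂ)) (hKL.ofReal (K := ℂ)).1
      refine this.trans_eq ?_
      congr 1
      exact eLpNorm_congr_norm_ae (.of_forall fun ξ => by simp)
    rw [← ENNReal.toReal_mul, integral_norm_eq_lintegral_enorm hBI.1,
      ← eLpNorm_one_eq_lintegral_enorm]
    exact ENNReal.toReal_mono (ENNReal.mul_ne_top hKL.2.ne hG.2.ne) h1
  refine ⟨𝓕⁻ B, ?_, fun t => ?_, fun f => ?_⟩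
  · exact VectorFourier.fourierIntegral_continuous Real.continuous_fourierChar
      (continuous_inner (𝕜 := ℝ) (E := ℝ)).neg hBI
  · exact (VectorFourier.norm_fourierIntegral_le_integral_norm _ _ _ _ _).trans hBn
  · have h2 := integral_mul_fourierInv_eq hBI
      (f + (SchwartzMap.derivCLM ℂ ℂ)^[4 * m] f).integrable
    rw [hφ f]
    calc _ = ∫ ξ, B ξ * (𝓕⁻ (f + (SchwartzMap.derivCLM ℂ ℂ)^[4 * m] f)) ξ := by
          refine integral_congr_ae (.of_forall fun ξ => ?_)
          simp only [fourierInv_add_iterate_derivCLM, hBdef, hK]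
          have e1 : (weight (-σ) ξ : ℂ) * (weight σ ξ : ℂ) = 1 := by
            rw [← Complex.ofReal_mul, mul_comm, weight_mul_neg, Complex.ofReal_one]
          have e2 : ((1 + (2 * Real.pi * ξ) ^ (4 * m) : ℝ) : ℂ) ≠ 0 := by
            exact_mod_cast (hpos ξ).ne'
          rw [Complex.ofReal_div]
          field_simp
          linear_combination (-(G ξ * (𝓕⁻ f) ξ)) * e1
      _ = _ := by
          rw [SchwartzMap.fourierInv_coe, h2]
          refine integral_congr_ae (.of_forall fun ξ => ?_)
          simp [iterate_derivCLM_apply]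

/-! ### Vanishing off the support, and Fourier transforms of compactly supported distributions. -/

section Support

open Distribution

theorem exists_smooth_cutoff {K U : Set ℝ} (hK : IsClosed K) (hU : IsOpen U) (hKU : K ⊆ U) :
    ∃ ρ : ℝ → ℝ, ContDiff ℝ ∞ ρ ∧ (∀ᶠ x in 𝓝ˢ K, ρ x = 1) ∧ tsupport ρ ⊆ U := by
  obtain ⟨V, hV, hKV, hVU⟩ := normal_exists_closure_subset hK hU hKU
  obtain ⟨f, hf1, hf0, -⟩ := exists_contMDiffMap_one_nhds_of_subset_interior
    (modelWithCornersSelf ℝ ℝ) (n := ⊤) hK (t := V) (by rwa [hV.interior_eq])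
  refine ⟨f, f.contMDiff.contDiff, hf1, (closure_mono fun x hx => ?_).trans hVU⟩
  by_contra h
  exact hx (hf0 x h)

theorem contDiff_coe_schwartz (f : 𝓢(ℝ, ℂ)) : ContDiff ℝ ∞ f := f.smooth ⊤

/-- The product of a Schwartz function and a smooth function, one of which has compact support. -/
theorem exists_schwartz_mul {ρ : ℝ → ℝ} (hρ : ContDiff ℝ ∞ ρ) (f : 𝓢(ℝ, ℂ))
    (h : HasCompactSupport f ∨ HasCompactSupport ρ) :
    ∃ g : 𝓢(ℝ, ℂ), HasCompactSupport g ∧ ∀ x, g x = ρ x * f x := by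
  have h1 : ContDiff ℝ ∞ (fun x => (ρ x : ℂ) * f x) :=
    (Complex.ofRealCLM.contDiff.comp hρ).mul (contDiff_coe_schwartz f)
  have h2 : HasCompactSupport (fun x => (ρ x : ℂ) * f x) := by
    rcases h with h | h
    · exact h.mul_left
    · exact (h.comp_left (g := ((↑) : ℝ → ℂ)) rfl).mul_right
  exact ⟨h2.toSchwartzMap h1, h2, fun x => rfl⟩

theorem tsupport_mul_one_sub_disjoint {ρ : ℝ → ℝ} {K : Set ℝ} (hρ : ∀ᶠ x in 𝓝ˢ K, ρ x = 1)
    (f : ℝ → ℂ) : Disjoint (tsupport fun x => ((1 - ρ x : ℝ) : ℂ) * f x) K := by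
  rw [Set.disjoint_right]
  intro x hx
  rw [notMem_tsupport_iff_eventuallyEq]
  have := eventually_nhdsSet_iff_forall.mp hρ x hx
  filter_upwards [this] with y hy
  simp [hy]

/-- A tempered distribution vanishes on compactly supported functions supported off its support. -/
theorem apply_eq_zero_of_disjoint {φ : 𝓢'(ℝ, ℂ)} {f : 𝓢(ℝ, ℂ)} (hf : HasCompactSupport f)
    (hd : Disjoint (tsupport f) (dsupport φ)) : φ f = 0 := by
  -- Induction over compact sets needs a property inherited by subsets and finite unions, so
  -- vanishing is required for every test function supported in some open neighbourhood.
  let P : Set ℝ → Prop := fun s => ∃ U, IsOpen U ∧ s ⊆ U ∧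
    ∀ u : 𝓢(ℝ, ℂ), HasCompactSupport u → tsupport u ⊆ U → φ u = 0
  suffices P (tsupport f) by
    obtain ⟨U, -, h1, h2⟩ := this
    exact h2 f hf h1
  refine IsCompact.induction_on (p := P) hf ?_ ?_ ?_ ?_
  · refine ⟨∅, isOpen_empty, subset_rfl, fun u _ hu => ?_⟩
    have : u = 0 := by
      ext x
      exact image_eq_zero_of_notMem_tsupport fun h => (hu h)
    simp [this]
  · rintro s t hst ⟨U, h1, h2, h3⟩
    exact ⟨U, h1, hst.trans h2, h3⟩
  · rintro s t ⟨U₁, ho1, hs1, h1⟩ ⟨U₂, ho2, hs2, h2⟩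
    refine ⟨U₁ ∪ U₂, ho1.union ho2, union_subset_union hs1 hs2, fun u hu hsub => ?_⟩
    -- A two-set partition of unity: ρu is supported in U₁ and, as ρ = 1 near the part of the
    -- support outside U₂, (1-ρ)u is supported in U₂.
    obtain ⟨ρ, hρ, hρ1, hρs⟩ := exists_smooth_cutoff (K := tsupport u \ U₂) (U := U₁)
      ((isClosed_tsupport u).sdiff ho2) ho1 (fun x hx => (hsub hx.1).resolve_right hx.2)
    obtain ⟨g, hg, hgx⟩ := exists_schwartz_mul hρ u (.inl hu)
    obtain ⟨g', hg', hgx'⟩ := exists_schwartz_mul (ρ := fun x => 1 - ρ x)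
      (contDiff_const.sub hρ) u (.inl hu)
    have hsum : u = g + g' := by
      ext x; simp [hgx, hgx']; ring
    have e1 : φ g = 0 := by
      refine h1 g hg (subset_trans ?_ hρs)
      refine closure_mono fun x hx h => hx ?_
      have h : ρ x = 0 := h
      simp [hgx, h]
    have e2 : φ g' = 0 := by
      refine h2 g' hg' fun x hx => ?_
      by_contra hx2
      have hfun : (g' : ℝ → ℂ) = fun x => ((1 - ρ x : ℝ) : ℂ) * u x := by
        ext x; simp [hgx']
      rw [hfun] at hx
      refine Set.disjoint_left.mp (tsupport_mul_one_sub_disjoint hρ1 u) hx ⟨?_, hx2⟩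
      exact tsupport_mul_subset_right hx
    rw [hsum, map_add, e1, e2, add_zero]
  · intro x hx
    have hx' := Set.disjoint_left.mp hd hx
    obtain ⟨s, hs, hso, hxs⟩ := (notMem_dsupport_iff x).mp hx'
    exact ⟨s, mem_nhdsWithin_of_mem_nhds (hso.mem_nhds hxs), s, hso, subset_rfl,
      fun u _ hu => hs u hu⟩

theorem exists_bound_iteratedDeriv {ρ : ℝ → ℝ} (hρ : ContDiff ℝ ∞ ρ) (hc : HasCompactSupport ρ)
    (n : ℕ) : ∃ M, 0 ≤ M ∧ ∀ x, ‖iteratedDeriv n ρ x‖ ≤ M := by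
  have h1 : Continuous (iteratedDeriv n ρ) := hρ.continuous_iteratedDeriv n (by exact_mod_cast le_top)
  obtain ⟨M, hM⟩ := (h1.bounded_above_of_compact_support (by
    rw [iteratedDeriv_eq_equiv_comp]
    exact (hc.iteratedFDeriv n).comp_left (by simp)))
  exact ⟨M, (norm_nonneg _).trans (hM 0), hM⟩

theorem iteratedDeriv_ofReal_mul {ρ : ℝ → ℝ} (hρ : ContDiff ℝ ∞ ρ) {f : ℝ → ℂ}
    (hf : ContDiff ℝ ∞ f) (n : ℕ) (x : ℝ) :
    iteratedDeriv n (fun x => (ρ x : ℂ) * f x) x = ∑ i ∈ Finset.range (n + 1),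
      (n.choose i : ℂ) * ((iteratedDeriv i ρ x : ℝ) : ℂ) * iteratedDeriv (n - i) f x := by
  have h1 : ContDiff ℝ ∞ (fun x => (ρ x : ℂ)) := Complex.ofRealCLM.contDiff.comp hρ
  have h := iteratedDeriv_fun_mul (n := n) (x := x) (f := fun x => (ρ x : ℂ)) (g := f)
    (h1.of_le (by exact_mod_cast le_top)).contDiffAt (hf.of_le (by exact_mod_cast le_top)).contDiffAt
  rw [h]
  refine Finset.sum_congr rfl fun i _ => ?_
  congr 2
  have := (Complex.ofRealCLM).iteratedFDeriv_comp_left (f := ρ) (x := x) (i := i)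
    (hρ.of_le le_rfl).contDiffAt (by exact_mod_cast le_top)
  simp only [iteratedDeriv_eq_iteratedFDeriv]
  change iteratedFDeriv ℝ i (Complex.ofRealCLM ∘ ρ) x _ = _
  rw [this]; simp

/-- A distribution of finite order vanishes on all Schwartz functions supported off its support. -/
theorem apply_eq_zero_of_disjoint_of_representation {φ : 𝓢'(ℝ, ℂ)} {b : ℝ → ℂ} {n : ℕ} {C : ℝ}
    (hb : Continuous b) (hbC : ∀ t, ‖b t‖ ≤ C)
    (hφ : ∀ f : 𝓢(ℝ, ℂ), φ f = ∫ t, b t * (f t + iteratedDeriv n f t))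
    {f : 𝓢(ℝ, ℂ)} (hd : Disjoint (tsupport f) (dsupport φ)) : φ f = 0 := by
  have hC : 0 ≤ C := (norm_nonneg _).trans (hbC 0)
  -- Truncate f by ρ(x/(N+1)). The dilation factor is at most 1, so the derivatives of the
  -- truncations are dominated by those of f uniformly in N, and the finite-order representation
  -- passes to the limit.
  let ρ : ContDiffBump (0 : ℝ) := ⟨1, 2, one_pos, one_lt_two⟩
  have hρ : ContDiff ℝ ∞ ρ := ρ.contDiff
  have hρc : HasCompactSupport ρ := ρ.hasCompactSupport
  choose M hM0 hM using exists_bound_iteratedDeriv hρ hρc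
  have hρR : ∀ N : ℕ, ContDiff ℝ ∞ (fun x => ρ ((N + 1 : ℝ)⁻¹ * x)) := fun N =>
    hρ.comp (contDiff_const.mul contDiff_id)
  have hρRc : ∀ N : ℕ, HasCompactSupport (fun x => ρ ((N + 1 : ℝ)⁻¹ * x)) := fun N =>
    hρc.comp_homeomorph (Homeomorph.mulLeft₀ ((N + 1 : ℝ)⁻¹) (by positivity))
  choose g hgc hg using fun N : ℕ => exists_schwartz_mul (hρR N) f (.inr (hρRc N))
  have hg0 : ∀ N, φ (g N) = 0 := fun N => by
    have hs : Function.support (g N) ⊆ Function.support f := fun x hx h => hx ?_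
    · exact apply_eq_zero_of_disjoint (hgc N) (hd.mono_left (closure_mono hs))
    · have h : f x = 0 := h
      simp [hg, h]
  have hgfun : ∀ N, (g N : ℝ → ℂ) = fun x => ((ρ ((N + 1 : ℝ)⁻¹ * x) : ℝ) : ℂ) * f x :=
    fun N => funext (hg N)
  have hbound : ∀ N k x, ‖iteratedDeriv k (g N) x‖ ≤ ∑ i ∈ Finset.range (k + 1),
      (k.choose i : ℝ) * M i * ‖iteratedDeriv (k - i) f x‖ := by
    intro N k x
    rw [hgfun, iteratedDeriv_ofReal_mul (hρR N) (contDiff_coe_schwartz f)]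
    refine (norm_sum_le _ _).trans (Finset.sum_le_sum fun i _ => ?_)
    rw [norm_mul, norm_mul, Complex.norm_natCast, Complex.norm_real]
    gcongr
    rw [iteratedDeriv_comp_const_mul (hρ.of_le (by exact_mod_cast le_top))]
    simp only [norm_mul, norm_pow, norm_inv]
    refine (mul_le_of_le_one_left (norm_nonneg _) ?_).trans (hM i _)
    refine pow_le_one₀ (by positivity) (inv_le_one_of_one_le₀ ?_)
    rw [Real.norm_of_nonneg (by positivity)]
    linarith [Nat.cast_nonneg (α := ℝ) N]
  have hint : ∀ k, Integrable (fun x => ∑ i ∈ Finset.range (k + 1),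
      (k.choose i : ℝ) * M i * ‖iteratedDeriv (k - i) f x‖) := fun k => by
    refine integrable_finsetSum _ fun i _ => Integrable.const_mul ?_ _
    rw [← iterate_derivCLM_apply]
    exact (SchwartzMap.integrable _).norm
  have hlim : Tendsto (fun N => φ (g N)) atTop (𝓝 (φ f)) := by
    rw [hφ f]
    simp only [hφ]
    refine tendsto_integral_of_dominated_convergence
      (fun x => C * ((∑ i ∈ Finset.range (0 + 1),
      ((0 : ℕ).choose i : ℝ) * M i * ‖iteratedDeriv (0 - i) f x‖) + ∑ i ∈ Finset.range (n + 1),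
      (n.choose i : ℝ) * M i * ‖iteratedDeriv (n - i) f x‖)) ?_ ?_ ?_ ?_
    · intro N
      rw [← iterate_derivCLM_apply]
      exact (hb.mul ((g N).continuous.add (SchwartzMap.continuous _))).aestronglyMeasurable
    · exact ((hint 0).add (hint n)).const_mul C
    · intro N
      refine .of_forall fun x => ?_
      rw [norm_mul]
      refine mul_le_mul (hbC x) ((norm_add_le _ _).trans (add_le_add ?_ (hbound N n x)))
        (norm_nonneg _) hC
      simpa using hbound N 0 x
    · refine .of_forall fun x => ?_
      refine tendsto_const_nhds.congr' ?_
      obtain ⟨N₀, hN₀⟩ := exists_nat_gt (|x| + 1)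
      filter_upwards [eventually_ge_atTop N₀] with N hN
      have hev : (g N : ℝ → ℂ) =ᶠ[𝓝 x] f := by
        have : Metric.ball x 1 ∈ 𝓝 x := Metric.ball_mem_nhds x one_pos
        filter_upwards [this] with y hy
        rw [hg]
        have hN' : (N₀ : ℝ) ≤ N := by exact_mod_cast hN
        have hy' : |y| < N + 1 := by
          rw [Metric.mem_ball, Real.dist_eq] at hy
          have := abs_sub_abs_le_abs_sub y x
          linarith
        rw [ρ.one_of_mem_closedBall]
        · simp
        · rw [mem_closedBall_zero_iff, norm_mul, norm_inv, Real.norm_of_nonneg (by positivity),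
            Real.norm_eq_abs, inv_mul_le_iff₀ (by positivity)]
          simpa [ρ] using hy'.le
      rw [hev.iteratedDeriv_eq, hev.self_of_nhds]
  exact tendsto_nhds_unique hlim (by simp [hg0])

/-! ### The transform as an integral, independent of the cutoff. -/

theorem cutoff_contDiff (T : ℝ) : ContDiff ℝ ∞ (cutoff T) :=
  (Real.smoothTransition.contDiff.comp (contDiff_id.add contDiff_const)).mul
    (Real.smoothTransition.contDiff.comp (contDiff_const.sub contDiff_id))

theorem cutoff_hasCompactSupport (T : ℝ) : HasCompactSupport (cutoff T) := by
  refine HasCompactSupport.intro (isCompact_Icc (a := (-1 : ℝ)) (b := T + 1)) fun t ht => ?_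
  unfold cutoff
  by_cases h1 : t < -1
  · rw [Real.smoothTransition.zero_of_nonpos (by linarith), zero_mul]
  · have h2 : T + 1 < t := by
      by_contra h3
      exact ht ⟨not_lt.mp h1, not_lt.mp h3⟩
    rw [Real.smoothTransition.zero_of_nonpos (x := T + 1 - t) (by linarith), mul_zero]

theorem cutoff_eq_one {T t : ℝ} (h : t ∈ Icc 0 T) : cutoff T t = 1 := by
  unfold cutoff
  rw [Real.smoothTransition.one_of_one_le (by linarith [h.1]),
    Real.smoothTransition.one_of_one_le (by linarith [h.2]), one_mul]

theorem cutoff_eventually_one {T : ℝ} {K : Set ℝ} (hK : K ⊆ Ioo 0 T) :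
    ∀ᶠ t in 𝓝ˢ K, cutoff T t = 1 := by
  refine Filter.Eventually.filter_mono (nhdsSet_mono hK) ?_
  rw [isOpen_Ioo.nhdsSet_eq]
  exact fun t ht => cutoff_eq_one (Ioo_subset_Icc_self ht)

/-- Two cutoffs equal to 1 near the support differ by a function that vanishes there. The freedom is
used twice: a cutoff supported inside (0,T) gives growth bounds, and the cutoff of a longer interval
gives constants uniform in T. -/
theorem timeFourier_eq_apply {T : ℝ} {φ : 𝓢'(ℝ, ℂ)} (hd : dsupport φ ⊆ Ioo 0 T)
    {χ : ℝ → ℝ} (hχ1 : ∀ᶠ t in 𝓝ˢ (dsupport φ), χ t = 1)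
    {w : ℂ} {g : 𝓢(ℝ, ℂ)} (hgc : HasCompactSupport g)
    (hg : ∀ t, g t = (χ t : ℂ) * Complex.exp (-Complex.I * w * t)) :
    timeFourier T φ w = φ g := by
  rw [timeFourier, ← sub_eq_zero, ← map_sub]
  have hc := cutExp_hasCompactSupport T w
  refine apply_eq_zero_of_disjoint ?_ ?_
  · exact HasCompactSupport.sub hc hgc
  · rw [Set.disjoint_right]
    intro x hx
    rw [notMem_tsupport_iff_eventuallyEq]
    filter_upwards [eventually_nhdsSet_iff_forall.mp hχ1 x hx,
      eventually_nhdsSet_iff_forall.mp (cutoff_eventually_one hd) x hx] with y h1 h2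
    simp [hg, cutExp, h1, h2]

/-- The symbol of `1 + ∂^n` acting on `χ(t) e^{-iwt}`. -/
def cutSymbol (n : ℕ) (χ : ℝ → ℝ) (w : ℂ) (t : ℝ) : ℂ :=
  (χ t : ℂ) + ∑ i ∈ Finset.range (n + 1),
    (n.choose i : ℂ) * ((iteratedDeriv i χ t : ℝ) : ℂ) * (-Complex.I * w) ^ (n - i)

theorem iteratedDeriv_exp_mul_ofReal (c : ℂ) (n : ℕ) (t : ℝ) :
    iteratedDeriv n (fun t : ℝ => Complex.exp (c * t)) t = c ^ n * Complex.exp (c * t) := by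
  induction n generalizing t with
  | zero => simp
  | succ n ih =>
    rw [iteratedDeriv_succ, funext ih]
    have h : HasDerivAt (fun t : ℝ => Complex.exp (c * t)) (Complex.exp (c * t) * (c * 1)) t := by
      have h0 : HasDerivAt (fun t : ℝ => (t : ℂ)) 1 t := (hasDerivAt_id t).ofReal_comp
      exact (h0.const_mul c).cexp
    rw [(h.const_mul (c ^ n)).deriv]; ring

theorem apply_modulated {φ : 𝓢'(ℝ, ℂ)} {b : ℝ → ℂ} {n : ℕ}
    (hφ : ∀ f : 𝓢(ℝ, ℂ), φ f = ∫ t, b t * (f t + iteratedDeriv n f t))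
    {χ : ℝ → ℝ} (hχ : ContDiff ℝ ∞ χ) {w : ℂ} {g : 𝓢(ℝ, ℂ)}
    (hg : ∀ t, g t = (χ t : ℂ) * Complex.exp (-Complex.I * w * t)) :
    φ g = ∫ t, b t * (cutSymbol n χ w t * Complex.exp (-Complex.I * w * t)) := by
  rw [hφ]
  refine integral_congr_ae (.of_forall fun t => ?_)
  have h2 : ContDiff ℝ ∞ (fun t : ℝ => Complex.exp (-Complex.I * w * t)) :=
    (contDiff_const.mul Complex.ofRealCLM.contDiff).cexp
  have : iteratedDeriv n g t = ∑ i ∈ Finset.range (n + 1), (n.choose i : ℂ) *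
      ((iteratedDeriv i χ t : ℝ) : ℂ) * iteratedDeriv (n - i)
        (fun t : ℝ => Complex.exp (-Complex.I * w * t)) t := by
    rw [← iteratedDeriv_ofReal_mul hχ h2, ← funext hg]
  simp only [this, hg, cutSymbol, iteratedDeriv_exp_mul_ofReal, add_mul, Finset.sum_mul]
  congr 2
  exact Finset.sum_congr rfl fun i _ => by ring

theorem exists_modulated {χ : ℝ → ℝ} (hχ : ContDiff ℝ ∞ χ) (hc : HasCompactSupport χ) (w : ℂ) :
    ∃ g : 𝓢(ℝ, ℂ), HasCompactSupport g ∧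
      ∀ t, g t = (χ t : ℂ) * Complex.exp (-Complex.I * w * t) := by
  have h1 : ContDiff ℝ ∞ (fun t : ℝ => (χ t : ℂ) * Complex.exp (-Complex.I * w * t)) :=
    (Complex.ofRealCLM.contDiff.comp hχ).mul (contDiff_const.mul Complex.ofRealCLM.contDiff).cexp
  have h2 : HasCompactSupport (fun t : ℝ => (χ t : ℂ) * Complex.exp (-Complex.I * w * t)) :=
    (hc.comp_left (g := ((↑) : ℝ → ℂ)) rfl).mul_right
  exact ⟨h2.toSchwartzMap h1, h2, fun x => rfl⟩

theorem timeFourier_eq_integral {T : ℝ} {φ : 𝓢'(ℝ, ℂ)} (hd : dsupport φ ⊆ Ioo 0 T)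
    {b : ℝ → ℂ} {n : ℕ} (hφ : ∀ f : 𝓢(ℝ, ℂ), φ f = ∫ t, b t * (f t + iteratedDeriv n f t))
    {χ : ℝ → ℝ} (hχ : ContDiff ℝ ∞ χ) (hc : HasCompactSupport χ)
    (hχ1 : ∀ᶠ t in 𝓝ˢ (dsupport φ), χ t = 1) (w : ℂ) :
    timeFourier T φ w = ∫ t, b t * (cutSymbol n χ w t * Complex.exp (-Complex.I * w * t)) := by
  obtain ⟨g, hgc, hg⟩ := exists_modulated hχ hc w
  rw [timeFourier_eq_apply hd hχ1 hgc hg, apply_modulated hφ hχ hg]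

theorem continuous_iteratedDeriv_smooth {χ : ℝ → ℝ} (hχ : ContDiff ℝ ∞ χ) (i : ℕ) :
    Continuous (iteratedDeriv i χ) :=
  hχ.continuous_iteratedDeriv i (by exact_mod_cast le_top)

theorem continuous_cutSymbol {χ : ℝ → ℝ} (hχ : ContDiff ℝ ∞ χ) (n : ℕ) :
    Continuous (fun p : ℂ × ℝ => cutSymbol n χ p.1 p.2) := by
  unfold cutSymbol
  have h := continuous_iteratedDeriv_smooth hχ
  have h0 := hχ.continuous
  fun_prop

theorem cutSymbol_eq_zero {χ : ℝ → ℝ} {n : ℕ} {t : ℝ} (ht : t ∉ tsupport χ) (w : ℂ) :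
    cutSymbol n χ w t = 0 := by
  have h : χ =ᶠ[𝓝 t] 0 := notMem_tsupport_iff_eventuallyEq.mp ht
  have h2 : ∀ i, iteratedDeriv i χ t = 0 := fun i => by
    rw [h.iteratedDeriv_eq]
    simp [iteratedDeriv_eq_iteratedFDeriv]
  simp [cutSymbol, h2, image_eq_zero_of_notMem_tsupport ht]

/-- The transform of a distribution with Fourier density `G` is given pointwise by
`timeFourier`. -/
theorem timeFourier_ae_eq {T : ℝ} {φ : 𝓢'(ℝ, ℂ)} (hd : dsupport φ ⊆ Ioo 0 T)
    {b : ℝ → ℂ} {n : ℕ} {C : ℝ} (hb : Continuous b) (hbC : ∀ t, ‖b t‖ ≤ C)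
    (hφ : ∀ f : 𝓢(ℝ, ℂ), φ f = ∫ t, b t * (f t + iteratedDeriv n f t))
    {G : ℝ → ℂ} (hG : HasFourierDensity φ G) (hGl : LocallyIntegrable G)
    (hcont : Continuous fun ξ : ℝ => timeFourier T φ ((2 * Real.pi * ξ : ℝ) : ℂ)) :
    ∀ᵐ ξ, timeFourier T φ ((2 * Real.pi * ξ : ℝ) : ℂ) = G ξ := by
  refine ae_eq_of_integral_contDiff_smul_eq hcont.locallyIntegrable hGl fun θ hθ hθc => ?_
  have hθ1 : ContDiff ℝ ∞ (fun x => (θ x : ℂ)) := Complex.ofRealCLM.contDiff.comp hθ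
  have hθ2 : HasCompactSupport (fun x => (θ x : ℂ)) := hθc.comp_left (g := ((↑) : ℝ → ℂ)) rfl
  set f : 𝓢(ℝ, ℂ) := hθ2.toSchwartzMap hθ1
  have hf : ∀ x, f x = θ x := fun x => rfl
  set χ := cutoff T
  have hχ : ContDiff ℝ ∞ χ := cutoff_contDiff T
  have hχc : HasCompactSupport χ := cutoff_hasCompactSupport T
  -- φ(𝓕θ) is computed twice: through the density, and, after cutting 𝓕θ off, through the bounded
  -- representation and an exchange of integrals. Cutting off a function without compact support is
  -- allowed because φ has finite order.
  obtain ⟨g, hgc, hg⟩ := exists_schwartz_mul hχ (𝓕 f) (.inr hχc)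
  have e1 : φ (𝓕 f) = ∫ ξ, θ ξ • G ξ := by
    rw [hG, FourierTransform.fourierInv_fourier_eq]
    refine integral_congr_ae (.of_forall fun ξ => ?_)
    simp only [hf, Complex.real_smul]; ring
  have e2 : φ (𝓕 f) = φ g := by
    rw [← sub_eq_zero, ← map_sub]
    refine apply_eq_zero_of_disjoint_of_representation hb hbC hφ ?_
    have : ((𝓕 f - g : 𝓢(ℝ, ℂ)) : ℝ → ℂ) = fun x => ((1 - χ x : ℝ) : ℂ) * (𝓕 f) x := by
      ext x; simp [hg]; ring
    rw [this]
    exact tsupport_mul_one_sub_disjoint (cutoff_eventually_one hd) _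
  -- Derivatives of 𝓕θ bring down powers of -2πiξ, so Leibniz' rule for χ · 𝓕θ reproduces
  -- `cutSymbol` at w = 2πξ.
  have hder : ∀ k t, iteratedDeriv k (𝓕 f : 𝓢(ℝ, ℂ)) t =
      ∫ ξ : ℝ, (-Complex.I * ((2 * Real.pi * ξ : ℝ) : ℂ)) ^ k * θ ξ *
        Complex.exp (-Complex.I * ((2 * Real.pi * ξ : ℝ) : ℂ) * t) := by
    intro k t
    rw [SchwartzMap.fourier_coe, Real.iteratedDeriv_fourier (N := ⊤) (n := k) (fun m _ => ?_) le_top,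
      Real.fourier_real_eq_integral_exp_smul]
    · refine integral_congr_ae (.of_forall fun ξ => ?_)
      simp only [smul_eq_mul, hf]
      push_cast
      ring_nf
    · have := SchwartzMap.integrable (μ := volume) (SchwartzMap.smulLeftCLM ℂ (fun x : ℝ => ((x ^ m : ℝ) : ℂ)) f)
      refine this.congr (.of_forall fun x => ?_)
      have h2 : Function.HasTemperateGrowth (fun x : ℝ => ((x ^ m : ℝ) : ℂ)) := by fun_prop
      rw [SchwartzMap.smulLeftCLM_apply_apply h2]; simp
  have hcs : Continuous (fun p : ℝ × ℝ => cutSymbol n χ ((2 * Real.pi * p.2 : ℝ) : ℂ) p.1) :=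
    (continuous_cutSymbol hχ n).comp (f := fun p : ℝ × ℝ => (((2 * Real.pi * p.2 : ℝ) : ℂ), p.1))
      (by fun_prop)
  have hθcont := hθ.continuous
  have e3 : φ g = ∫ t, ∫ ξ : ℝ, b t * (cutSymbol n χ ((2 * Real.pi * ξ : ℝ) : ℂ) t * θ ξ *
      Complex.exp (-Complex.I * ((2 * Real.pi * ξ : ℝ) : ℂ) * t)) := by
    rw [hφ]
    refine integral_congr_ae (.of_forall fun t => ?_)
    have hgd : iteratedDeriv n g t = ∑ i ∈ Finset.range (n + 1), (n.choose i : ℂ) *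
        ((iteratedDeriv i χ t : ℝ) : ℂ) * iteratedDeriv (n - i) (𝓕 f : 𝓢(ℝ, ℂ)) t := by
      rw [← iteratedDeriv_ofReal_mul hχ (contDiff_coe_schwartz _), ← funext hg]
    have hint : ∀ k, Integrable fun ξ : ℝ => (-Complex.I * ((2 * Real.pi * ξ : ℝ) : ℂ)) ^ k * θ ξ *
        Complex.exp (-Complex.I * ((2 * Real.pi * ξ : ℝ) : ℂ) * t) := fun k =>
      Continuous.integrable_of_hasCompactSupport (by fun_prop) (hθ2.mul_left.mul_right)
    have h0 : (𝓕 f) t = iteratedDeriv 0 (𝓕 f : 𝓢(ℝ, ℂ)) t := by simp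
    simp only [hgd, hg, integral_const_mul]
    rw [h0]
    simp only [hder]
    congr 1
    rw [← integral_const_mul]
    simp only [← integral_const_mul]
    rw [← integral_finsetSum _ fun i _ => (hint _).const_mul _, ← integral_add]
    · refine integral_congr_ae (.of_forall fun ξ => ?_)
      simp only [cutSymbol, add_mul, Finset.sum_mul, pow_zero, one_mul]
      congr 1
      · ring
      · exact Finset.sum_congr rfl fun i _ => by ring
    · exact (hint 0).const_mul _
    · exact integrable_finsetSum _ fun i _ => (hint _).const_mul _
  rw [← e1, e2, e3, integral_integral_swap_of_hasCompactSupport]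
  · refine integral_congr_ae (.of_forall fun ξ => ?_)
    simp only [timeFourier_eq_integral hd hφ hχ hχc (cutoff_eventually_one hd), Complex.real_smul]
    rw [← integral_const_mul]
    refine integral_congr_ae (.of_forall fun t => ?_)
    simp only []
    ring
  · simp only [Function.uncurry_def]
    fun_prop
  · refine HasCompactSupport.intro (hχc.prod hθc) fun p hp => ?_
    rw [Set.mem_prod, not_and_or] at hp
    rcases hp with hp | hp
    · simp only [Function.uncurry_def, cutSymbol_eq_zero hp]; simp
    · simp only [Function.uncurry_def, image_eq_zero_of_notMem_tsupport hp]; simp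

/-! ### The transform as an entire function: growth and bounds on discs. -/

/-- The Fourier transform of a compactly supported continuous function is entire. -/
theorem differentiable_integral_mul_exp {c : ℝ → ℂ} (hc : Continuous c) (hcs : HasCompactSupport c) :
    Differentiable ℂ fun w : ℂ => ∫ t, c t * Complex.exp (-Complex.I * w * t) := by
  intro w₀
  have hbd : Integrable fun t : ℝ => ‖c t‖ * (|t| * Real.exp ((‖w₀‖ + 1) * |t|)) :=
    Continuous.integrable_of_hasCompactSupport (by fun_prop) hcs.norm.mul_right
  refine (hasDerivAt_integral_of_dominated_loc_of_deriv_le (s := Metric.ball w₀ 1)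
    (F := fun w t => c t * Complex.exp (-Complex.I * w * t))
    (F' := fun w t => c t * (Complex.exp (-Complex.I * w * t) * (-Complex.I * t)))
    (bound := fun t : ℝ => ‖c t‖ * (|t| * Real.exp ((‖w₀‖ + 1) * |t|)))
    (Metric.ball_mem_nhds w₀ one_pos) ?_ ?_ ?_ ?_ hbd ?_).2.differentiableAt
  · exact .of_forall fun w => Continuous.aestronglyMeasurable (by fun_prop)
  · exact Continuous.integrable_of_hasCompactSupport (by fun_prop) hcs.mul_right
  · exact Continuous.aestronglyMeasurable (by fun_prop)
  · refine .of_forall fun t w hw => ?_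
    have hw' : ‖w‖ ≤ ‖w₀‖ + 1 := by
      have h1 : ‖w - w₀‖ < 1 := by simpa [dist_eq_norm] using hw
      have := norm_sub_norm_le w w₀
      linarith
    rw [norm_mul, norm_mul, mul_comm ‖Complex.exp _‖]
    gcongr
    · simp
    · rw [Complex.norm_exp]
      refine Real.exp_le_exp.mpr ((Complex.re_le_norm _).trans ?_)
      simp only [norm_mul, norm_neg, Complex.norm_I, one_mul, Complex.norm_real, Real.norm_eq_abs]
      gcongr
  · refine .of_forall fun t w _ => ?_
    have h := (((hasDerivAt_id w).const_mul (-Complex.I)).mul_const (t : ℂ)).cexp.const_mul (c t)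
    simpa using h

/-- The powers of w come out of the integral, leaving transforms of compactly supported functions
that do not depend on w; analyticity in w is then immediate. -/
theorem integral_cutSymbol_eq {b : ℝ → ℂ} (hb : Continuous b) {χ : ℝ → ℝ} (hχ : ContDiff ℝ ∞ χ)
    (hc : HasCompactSupport χ) (n : ℕ) (w : ℂ) :
    ∫ t, b t * (cutSymbol n χ w t * Complex.exp (-Complex.I * w * t)) =
      (∫ t, b t * (χ t : ℂ) * Complex.exp (-Complex.I * w * t)) +
      ∑ i ∈ Finset.range (n + 1), (n.choose i : ℂ) * (-Complex.I * w) ^ (n - i) *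
        ∫ t, b t * ((iteratedDeriv i χ t : ℝ) : ℂ) * Complex.exp (-Complex.I * w * t) := by
  have hcont := continuous_iteratedDeriv_smooth hχ
  have hχc := hχ.continuous
  have hsup : ∀ i, HasCompactSupport fun t => ((iteratedDeriv i χ t : ℝ) : ℂ) := fun i => by
    refine HasCompactSupport.comp_left (g := ((↑) : ℝ → ℂ)) ?_ rfl
    rw [iteratedDeriv_eq_equiv_comp]
    exact (hc.iteratedFDeriv i).comp_left (by simp)
  have hint : ∀ i, Integrable fun t =>
      b t * ((iteratedDeriv i χ t : ℝ) : ℂ) * Complex.exp (-Complex.I * w * t) := fun i =>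
    Continuous.integrable_of_hasCompactSupport (by have := hcont i; fun_prop)
      ((hsup i).mul_left.mul_right)
  simp only [← integral_const_mul]
  rw [← integral_finsetSum _ fun i _ => (hint i).const_mul _, ← integral_add]
  · refine integral_congr_ae (.of_forall fun t => ?_)
    simp only [cutSymbol, add_mul, mul_add, Finset.sum_mul, Finset.mul_sum]
    congr 1
    · ring
    · exact Finset.sum_congr rfl fun i _ => by ring
  · have := hint 0
    simpa using this
  · exact integrable_finsetSum _ fun i _ => (hint i).const_mul _

theorem hasCompactSupport_iteratedDeriv_ofReal {χ : ℝ → ℝ} (hc : HasCompactSupport χ) (i : ℕ) :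
    HasCompactSupport fun t => ((iteratedDeriv i χ t : ℝ) : ℂ) := by
  refine HasCompactSupport.comp_left (g := ((↑) : ℝ → ℂ)) ?_ rfl
  rw [iteratedDeriv_eq_equiv_comp]
  exact (hc.iteratedFDeriv i).comp_left (by simp)

theorem differentiable_integral_cutSymbol {b : ℝ → ℂ} (hb : Continuous b) {χ : ℝ → ℝ}
    (hχ : ContDiff ℝ ∞ χ) (hc : HasCompactSupport χ) (n : ℕ) :
    Differentiable ℂ fun w =>
      ∫ t, b t * (cutSymbol n χ w t * Complex.exp (-Complex.I * w * t)) := by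
  simp only [integral_cutSymbol_eq hb hχ hc]
  have hcont := continuous_iteratedDeriv_smooth hχ
  refine Differentiable.add ?_ (Differentiable.fun_sum fun i _ => Differentiable.mul (by fun_prop) ?_)
  · exact differentiable_integral_mul_exp (hb.mul (Complex.continuous_ofReal.comp hχ.continuous))
      (hc.comp_left (g := ((↑) : ℝ → ℂ)) rfl).mul_left
  · exact differentiable_integral_mul_exp (hb.mul (Complex.continuous_ofReal.comp (hcont i)))
      (hasCompactSupport_iteratedDeriv_ofReal hc i).mul_left

theorem norm_cutSymbol_le (n : ℕ) (χ : ℝ → ℝ) (w : ℂ) (t : ℝ) :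
    ‖cutSymbol n χ w t‖ ≤ (|χ t| + ∑ i ∈ Finset.range (n + 1),
      (n.choose i : ℝ) * |iteratedDeriv i χ t|) * (1 + ‖w‖) ^ n := by
  have h1 : (1 : ℝ) ≤ (1 + ‖w‖) ^ n := one_le_pow₀ (by linarith [norm_nonneg w])
  rw [cutSymbol, add_mul, Finset.sum_mul]
  refine (norm_add_le _ _).trans (add_le_add ?_ ((norm_sum_le _ _).trans
    (Finset.sum_le_sum fun i hi => ?_)))
  · rw [Complex.norm_real]; exact le_mul_of_one_le_right (abs_nonneg _) h1
  · rw [norm_mul, norm_mul, Complex.norm_real, Complex.norm_natCast, norm_pow, norm_mul, norm_neg,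
      Complex.norm_I, one_mul, Real.norm_eq_abs]
    gcongr
    calc ‖w‖ ^ (n - i) ≤ (1 + ‖w‖) ^ (n - i) := by gcongr; linarith
      _ ≤ (1 + ‖w‖) ^ n := pow_le_pow_right₀ (by linarith [norm_nonneg w]) (Nat.sub_le _ _)

/-- If `|e^{-iwt}| ≤ E` on the support of the cutoff, the transform grows at most polynomially. -/
theorem exists_norm_integral_cutSymbol_le {χ : ℝ → ℝ} (hχ : ContDiff ℝ ∞ χ)
    (hc : HasCompactSupport χ) (n : ℕ) : ∃ K, 0 ≤ K ∧ ∀ {b : ℝ → ℂ} {C : ℝ}, (∀ t, ‖b t‖ ≤ C) →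
      ∀ {w : ℂ} {E : ℝ}, (∀ t ∈ tsupport χ, w.im * t ≤ E) →
      ‖∫ t, b t * (cutSymbol n χ w t * Complex.exp (-Complex.I * w * t))‖ ≤
        K * C * (1 + ‖w‖) ^ n * Real.exp E := by
  set k : ℝ → ℝ := fun t => |χ t| + ∑ i ∈ Finset.range (n + 1),
      (n.choose i : ℝ) * |iteratedDeriv i χ t| with hk
  have hk0 : ∀ t, 0 ≤ k t := fun t => by positivity
  have hkI : Integrable k := by
    refine Integrable.add ?_ (integrable_finsetSum _ fun i _ => Integrable.const_mul ?_ _)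
    · exact (hχ.continuous.integrable_of_hasCompactSupport hc).abs
    · refine ((continuous_iteratedDeriv_smooth hχ i).integrable_of_hasCompactSupport ?_).abs
      rw [iteratedDeriv_eq_equiv_comp]
      exact (hc.iteratedFDeriv i).comp_left (by simp)
  refine ⟨∫ t, k t, integral_nonneg hk0, fun {b C} hb {w E} hE => ?_⟩
  have hC : 0 ≤ C := (norm_nonneg _).trans (hb 0)
  have hle : ∀ t, ‖b t * (cutSymbol n χ w t * Complex.exp (-Complex.I * w * t))‖ ≤
      k t * (C * (1 + ‖w‖) ^ n * Real.exp E) := fun t => by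
    by_cases ht : t ∈ tsupport χ
    · have h1 : ‖Complex.exp (-Complex.I * w * t)‖ ≤ Real.exp E := by
        rw [Complex.norm_exp]
        refine Real.exp_le_exp.mpr ?_
        simpa using hE t ht
      rw [norm_mul, norm_mul]
      calc _ ≤ C * ((k t * (1 + ‖w‖) ^ n) * Real.exp E) := by
            gcongr
            · exact hb t
            · exact norm_cutSymbol_le n χ w t
        _ = _ := by ring
    · rw [cutSymbol_eq_zero ht]
      simp only [zero_mul, mul_zero, norm_zero]
      have := hk0 t
      positivity
  refine (norm_integral_le_of_norm_le (hkI.mul_const _) (.of_forall hle)).trans_eq ?_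
  rw [integral_mul_const]; ring

/-- One cutoff, that of the longest interval, then serves all shorter ones; this keeps the constants
bounded as T → 0. -/
theorem timeFourier_eq_of_le {T T' : ℝ} (hT : T ≤ T') {φ : 𝓢'(ℝ, ℂ)}
    (hd : dsupport φ ⊆ Ioo 0 T) : timeFourier T φ = timeFourier T' φ := by
  ext w
  exact timeFourier_eq_apply hd (cutoff_eventually_one (hd.trans (Ioo_subset_Ioo_right hT)))
    (cutExp_hasCompactSupport T' w) fun t => rfl

/-- The transform is bounded on discs by the Sobolev norm, locally uniformly in `T`. -/
theorem exists_norm_timeFourier_le (σ R N : ℝ) : ∃ K, 0 ≤ K ∧ ∀ T ≤ N, ∀ φ : 𝓢'(ℝ, ℂ),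
    dsupport φ ⊆ Ioo 0 T → sobolevNorm σ φ < ⊤ → ∀ w : ℂ, ‖w‖ ≤ R →
      ‖timeFourier T φ w‖ ≤ K * (sobolevNorm σ φ).toReal := by
  obtain ⟨m, C, hC, hrep⟩ := exists_bounded_representation σ
  obtain ⟨K, hK, hbound⟩ := exists_norm_integral_cutSymbol_le (cutoff_contDiff N)
    (cutoff_hasCompactSupport N) (4 * m)
  have hs : 0 < Real.sqrt (2 * Real.pi) := by positivity
  obtain ⟨B, hB⟩ := (cutoff_hasCompactSupport N).isCompact.isBounded.exists_norm_le
  refine ⟨K * (C / Real.sqrt (2 * Real.pi)) * (1 + |R|) ^ (4 * m) * Real.exp (|R| * |B|),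
    by positivity, fun T hT φ hd hφ w hw => ?_⟩
  obtain ⟨G, hGm, hG, hGL, hGn⟩ := exists_hasFourierDensity hφ
  obtain ⟨b, hb, hbC, hrep⟩ := hrep φ G hG hGm.aestronglyMeasurable hGL
  have hn : (eLpNorm (fun ξ => (weight σ ξ : ℂ) * G ξ) 2).toReal =
      (sobolevNorm σ φ).toReal / Real.sqrt (2 * Real.pi) := by
    rw [hGn, ENNReal.toReal_mul, ENNReal.toReal_ofReal hs.le]; field_simp
  rw [timeFourier_eq_of_le hT hd, timeFourier_eq_integral (hd.trans (Ioo_subset_Ioo_right hT)) hrep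
    (cutoff_contDiff N) (cutoff_hasCompactSupport N)
    (cutoff_eventually_one (hd.trans (Ioo_subset_Ioo_right hT)))]
  have hRn : ‖w‖ ≤ |R| := hw.trans (le_abs_self R)
  refine (hbound (C := C * ((sobolevNorm σ φ).toReal / Real.sqrt (2 * Real.pi)))
    (fun t => by rw [← hn]; exact hbC t) (E := |R| * |B|) fun t ht => ?_).trans ?_
  · calc w.im * t ≤ |w.im * t| := le_abs_self _
      _ = |w.im| * |t| := abs_mul _ _
      _ ≤ |R| * |B| := by
        exact mul_le_mul ((Complex.abs_im_le_norm w).trans hRn) ((hB t ht).trans (le_abs_self _))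
          (abs_nonneg _) (abs_nonneg _)
  · calc _ ≤ K * (C * ((sobolevNorm σ φ).toReal / Real.sqrt (2 * Real.pi))) * (1 + |R|) ^ (4 * m) *
          Real.exp (|R| * |B|) := by gcongr
      _ = _ := by ring

/-- The properties of the transform of Sobolev boundary data supported in `(0, T)`. -/
structure IsTimeTransform (σ : ℝ) (φ : 𝓢'(ℝ, ℂ)) (Φ : ℂ → ℂ) : Prop where
  differentiable : Differentiable ℂ Φ
  growth : ∃ (K : ℝ) (n : ℕ), 0 ≤ K ∧ ∀ w : ℂ, w.im ≤ 0 → ‖Φ w‖ ≤ K * (1 + ‖w‖) ^ n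
  density : HasFourierDensity φ fun ξ => Φ ((2 * Real.pi * ξ : ℝ) : ℂ)
  norm_eq : sobolevNorm σ φ = ENNReal.ofReal (Real.sqrt (2 * Real.pi)) *
    eLpNorm (fun ξ => (weight σ ξ : ℂ) * Φ ((2 * Real.pi * ξ : ℝ) : ℂ)) 2

/-- A Paley–Wiener statement: compact support makes the transform entire, finite order makes its
growth polynomial, and support in t > 0 confines that growth bound to the lower half-plane. -/
theorem isTimeTransform {σ T : ℝ} {φ : 𝓢'(ℝ, ℂ)} (hd : dsupport φ ⊆ Ioo 0 T)
    (hφ : sobolevNorm σ φ < ⊤) : IsTimeTransform σ φ (timeFourier T φ) := by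
  obtain ⟨m, C, hC, hrep⟩ := exists_bounded_representation σ
  obtain ⟨G, hGm, hG, hGL, hGn⟩ := exists_hasFourierDensity hφ
  obtain ⟨b, hb, hbC, hrep⟩ := hrep φ G hG hGm.aestronglyMeasurable hGL
  -- The standard cutoff reaches into t < 0, where |e^{-iwt}| = e^{t Im w} grows as Im w → -∞. A
  -- cutoff supported in (0,T) keeps this factor at most 1 for Im w ≤ 0.
  obtain ⟨χ, hχ, hχ1, hχs⟩ := exists_smooth_cutoff isClosed_dsupport isOpen_Ioo hd
  have hχc : HasCompactSupport χ :=
    isCompact_Icc.of_isClosed_subset (isClosed_tsupport _) (hχs.trans Ioo_subset_Icc_self)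
  have heq := timeFourier_eq_integral hd hrep hχ hχc hχ1
  have hdiff : Differentiable ℂ (timeFourier T φ) := by
    rw [funext heq]; exact differentiable_integral_cutSymbol hb hχ hχc _
  have hGl : LocallyIntegrable G := by
    have h1 : LocallyIntegrable (fun ξ => (weight σ ξ : ℂ) * G ξ) :=
      hGL.locallyIntegrable one_le_two
    have h2 := (locallyIntegrable_iff.mp h1)
    refine locallyIntegrable_iff.mpr fun K hK => ?_
    have h3 := (h2 K hK).continuousOn_mul (g := fun ξ => ((weight (-σ) ξ : ℝ) : ℂ))
      (Complex.continuous_ofReal.comp (continuous_weight _)).continuousOn hK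
    refine h3.congr_fun_ae (.of_forall fun ξ => ?_)
    simp only []
    rw [← mul_assoc, ← Complex.ofReal_mul, mul_comm (weight _ _), weight_mul_neg]; simp
  have hae := timeFourier_ae_eq hd hb hbC hrep hG hGl
    (hdiff.continuous.comp (by fun_prop))
  refine ⟨hdiff, ?_, fun f => ?_, ?_⟩
  · obtain ⟨K, hK, hbound⟩ := exists_norm_integral_cutSymbol_le hχ hχc (4 * m)
    set M := C * (eLpNorm (fun ξ => (weight σ ξ : ℂ) * G ξ) 2).toReal with hM
    have hM0 : 0 ≤ M := by positivity
    refine ⟨K * M, 4 * m, by positivity, fun w hw => ?_⟩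
    rw [heq]
    refine (hbound hbC (E := 0) fun t ht => ?_).trans_eq (by simp [hM])
    exact mul_nonpos_of_nonpos_of_nonneg hw (hχs ht).1.le
  · rw [hG]
    refine integral_congr_ae ?_
    filter_upwards [hae] with ξ hξ
    rw [hξ]
  · rw [hGn]
    congr 1
    refine eLpNorm_congr_ae ?_
    filter_upwards [hae] with ξ hξ
    rw [hξ]

end Support

/-! ### The branch of the root -/

theorem norm_inv_sq_lt_one {k : ℂ} (hk : 1 < ‖k‖) : ‖(k ^ 2)⁻¹‖ < 1 := by
  rw [norm_inv, norm_pow]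
  exact inv_lt_one_of_one_lt₀ (one_lt_pow₀ hk two_ne_zero)

theorem one_add_re_pos {z : ℂ} (hz : ‖z‖ < 1) : 0 < (1 + z).re := by
  have := (abs_le.mp (Complex.abs_re_le_norm z)).1
  simp only [Complex.add_re, Complex.one_re]
  linarith

theorem one_add_mem_slitPlane {z : ℂ} (hz : ‖z‖ < 1) : 1 + z ∈ Complex.slitPlane :=
  Or.inl (one_add_re_pos hz)

theorem cpow_half_sq (z : ℂ) : (z ^ (1 / 2 : ℂ)) ^ 2 = z := by
  rw [← Complex.cpow_nat_mul]; simp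

theorem rootBranch_sq {k : ℂ} (hk : 1 < ‖k‖) : rootBranch k ^ 2 = 1 + k ^ 2 := by
  have h0 : k ≠ 0 := fun h => by simp [h] at hk; linarith
  rw [rootBranch, mul_pow, cpow_half_sq]
  field_simp
  ring

theorem norm_lt_open (a : ℝ) : IsOpen {k : ℂ | a < ‖k‖} := isOpen_lt continuous_const continuous_norm

theorem ne_zero_of_one_lt_norm {k : ℂ} (hk : 1 < ‖k‖) : k ≠ 0 :=
  norm_pos_iff.mp (one_pos.trans hk)

theorem rootBranch_ne_zero {k : ℂ} (hk : 1 < ‖k‖) : rootBranch k ≠ 0 := by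
  have h : (1 + (k ^ 2)⁻¹ : ℂ) ≠ 0 := fun h => by
    have := one_add_re_pos (norm_inv_sq_lt_one hk)
    simp [h] at this
  unfold rootBranch
  refine mul_ne_zero (ne_zero_of_one_lt_norm hk) ?_
  rw [Complex.cpow_ne_zero_iff]
  exact Or.inl h

theorem differentiableAt_rootBranch {k : ℂ} (hk : 1 < ‖k‖) : DifferentiableAt ℂ rootBranch k := by
  have h0 := ne_zero_of_one_lt_norm hk
  unfold rootBranch
  refine differentiableAt_id.mul (DifferentiableAt.cpow_const ?_ ?_)
  · exact (differentiableAt_const _).add ((differentiableAt_id.pow 2).inv (pow_ne_zero 2 h0))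
  · exact one_add_mem_slitPlane (norm_inv_sq_lt_one hk)

theorem differentiableAt_disp {k : ℂ} (hk : 1 < ‖k‖) : DifferentiableAt ℂ disp k :=
  differentiableAt_id.mul (differentiableAt_rootBranch hk)

theorem differentiableAt_nu {k : ℂ} (hk : 1 < ‖k‖) : DifferentiableAt ℂ nu k :=
  (differentiableAt_const _).mul (differentiableAt_rootBranch hk)

theorem disp_sq {k : ℂ} (hk : 1 < ‖k‖) : disp k ^ 2 = k ^ 2 + k ^ 4 := by
  rw [disp, mul_pow, rootBranch_sq hk]; ring

theorem disp_ne_zero {k : ℂ} (hk : 1 < ‖k‖) : disp k ≠ 0 :=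
  mul_ne_zero (ne_zero_of_one_lt_norm hk) (rootBranch_ne_zero hk)

theorem norm_rootBranch_sq_bounds {k : ℂ} (hk : 2 ≤ ‖k‖) :
    3 / 4 * ‖k‖ ^ 2 ≤ ‖rootBranch k‖ ^ 2 ∧ ‖rootBranch k‖ ^ 2 ≤ 5 / 4 * ‖k‖ ^ 2 := by
  rw [← norm_pow (rootBranch k), rootBranch_sq (by linarith)]
  have h1 := norm_add_le (1 : ℂ) (k ^ 2)
  have h2 := norm_sub_norm_le (k ^ 2) (-1)
  rw [sub_neg_eq_add, add_comm (k ^ 2)] at h2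
  simp only [norm_neg, norm_one, norm_pow] at h1 h2
  constructor <;> nlinarith

theorem norm_rootBranch_le {k : ℂ} (hk : 2 ≤ ‖k‖) : ‖rootBranch k‖ ≤ 2 * ‖k‖ := by
  have := (norm_rootBranch_sq_bounds hk).2
  refine abs_le_of_sq_le_sq' (a := ‖rootBranch k‖) ?_ (by positivity) |>.2
  nlinarith [norm_nonneg k]

theorem norm_rootBranch_ge {k : ℂ} (hk : 2 ≤ ‖k‖) : ‖k‖ / 2 ≤ ‖rootBranch k‖ := by
  have := (norm_rootBranch_sq_bounds hk).1
  refine abs_le_of_sq_le_sq' (a := ‖k‖ / 2) ?_ (norm_nonneg _) |>.2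
  nlinarith [norm_nonneg k]

theorem norm_nu (k : ℂ) : ‖nu k‖ = ‖rootBranch k‖ := by simp [nu]

/-- The factor `(Im ω) / Im (k²)` is positive. -/
theorem exists_disp_im {k : ℂ} (hk : 1 < ‖k‖) : ∃ c : ℝ, 0 < c ∧ (disp k).im = c * (k ^ 2).im := by
  set z := k ^ 2 with hz
  set s := (1 + z⁻¹) ^ (1 / 2 : ℂ) with hs
  have hz1 : 1 < ‖z‖ := by rw [hz, norm_pow]; exact one_lt_pow₀ hk two_ne_zero
  have hd : disp k = z * s := by rw [disp, rootBranch, hs, hz]; ring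
  have hsq : s ^ 2 = 1 + z⁻¹ := cpow_half_sq _
  -- The number 1 + 1/z has positive real part, and halving its argument keeps the root in the right
  -- half-plane.
  have hre : 0 < s.re := by
    rw [hs, one_div, Complex.cpow_def_of_ne_zero]
    · rw [Complex.exp_re]
      refine mul_pos (Real.exp_pos _) (Real.cos_pos_of_mem_Ioo ?_)
      have h1 := Complex.abs_arg_lt_pi_div_two_iff.mpr (Or.inl (one_add_re_pos (z := z⁻¹)
        (by rw [norm_inv]; exact inv_lt_one_of_one_lt₀ hz1)))
      have h2 : (Complex.log (1 + z⁻¹) * (2 : ℂ)⁻¹).im = Complex.arg (1 + z⁻¹) / 2 := by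
        rw [← Complex.ofReal_ofNat, ← Complex.ofReal_inv, Complex.im_mul_ofReal, Complex.log_im]; ring
      rw [h2]
      have := abs_lt.mp h1
      constructor <;> linarith [Real.pi_pos]
    · intro h
      have := one_add_re_pos (z := z⁻¹) (by rw [norm_inv]; exact inv_lt_one_of_one_lt₀ hz1)
      simp [h] at this
  set N := Complex.normSq z with hN
  have hN1 : 1 < N := by
    rw [hN, Complex.normSq_eq_norm_sq]; exact one_lt_pow₀ hz1 two_ne_zero
  have e1 : s.re * s.re - s.im * s.im = 1 + z.re / N := by
    have := congrArg Complex.re hsq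
    simpa [sq, Complex.inv_re] using this
  have e2 : s.re * s.im + s.im * s.re = -z.im / N := by
    have := congrArg Complex.im hsq
    simpa [sq, Complex.inv_im] using this
  -- Eliminating Im s gives Im(zs) = Im z · (Re s - Re z/(2N Re s)). The bracket is positive because
  -- N (Re s)² ≥ N + Re z, (Re z)² ≤ N and N > 1.
  have him : s.im = -z.im / (2 * N * s.re) := by
    field_simp; field_simp at e2; linarith
  refine ⟨s.re - z.re / (2 * N * s.re), ?_, ?_⟩
  · rw [sub_pos, div_lt_iff₀ (by positivity)]
    have h3 : N + z.re ≤ N * (s.re * s.re) := by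
      have : N * (s.re * s.re - s.im * s.im) = N + z.re := by rw [e1]; field_simp
      nlinarith [mul_self_nonneg s.im]
    have h4 : z.re ^ 2 ≤ N := by
      rw [hN, Complex.normSq_apply]; nlinarith [mul_self_nonneg z.im]
    nlinarith [sq_nonneg (z.re + 1)]
  · rw [hd, Complex.mul_im, him]; field_simp; ring

/-! ### The determinants Δ₁, Δ₂ and admissible radii. -/

/-- `Δ₁` (for `ε = 1`) and `Δ₂` (for `ε = -1`). -/
def DeltaS (ε γ δ : ℝ) (k : ℂ) : ℂ :=
  -γ * (k + ε * nu k) + Complex.I * (γ * δ - ε * k * nu k)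

theorem DeltaS_one (γ δ : ℝ) : DeltaS 1 γ δ = Delta1 γ δ := by
  ext k; simp [DeltaS, Delta1]

theorem DeltaS_neg_one (γ δ : ℝ) : DeltaS (-1) γ δ = Delta2 γ δ := by
  ext k; simp only [DeltaS, Delta2]; push_cast; ring

theorem differentiableAt_DeltaS (ε γ δ : ℝ) {k : ℂ} (hk : 1 < ‖k‖) :
    DifferentiableAt ℂ (DeltaS ε γ δ) k := by
  have := differentiableAt_nu hk
  unfold DeltaS
  fun_prop

/-- A radius beyond which all the symbols have their asymptotic size. -/
def largeRadius (γ δ : ℝ) : ℝ := 2 + 24 * |γ| + 4 * |γ * δ| + |δ|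

theorem two_le_largeRadius (γ δ : ℝ) : 2 ≤ largeRadius γ δ := by
  unfold largeRadius
  have := abs_nonneg γ; have := abs_nonneg (γ * δ); have := abs_nonneg δ
  linarith

/-- The product kν dominates, with |kν| ≥ |k|²/2. The rest is at most 3|γ||k| + |γδ||k|/2, using |k|
≥ 2, and this is at most |k|²/8 since 24|γ| + 4|γδ| ≤ |k|. -/
theorem norm_DeltaS_ge {ε : ℝ} (hε : |ε| = 1) (γ δ : ℝ) {k : ℂ} (hk : largeRadius γ δ ≤ ‖k‖) :
    ‖k‖ ^ 2 / 8 ≤ ‖DeltaS ε γ δ k‖ := by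
  have h2 : 2 ≤ ‖k‖ := (two_le_largeRadius γ δ).trans hk
  have hl := norm_rootBranch_ge h2
  have hu := norm_rootBranch_le h2
  have e1 : ‖(-γ * (k + ε * nu k) : ℂ)‖ ≤ |γ| * (3 * ‖k‖) := by
    rw [norm_mul, norm_neg, Complex.norm_real, Real.norm_eq_abs]
    gcongr
    refine (norm_add_le _ _).trans ?_
    rw [norm_mul, Complex.norm_real, Real.norm_eq_abs, hε, one_mul, norm_nu]
    linarith
  have e2 : ‖(ε * k * nu k : ℂ)‖ = ‖k‖ * ‖rootBranch k‖ := by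
    rw [norm_mul, norm_mul, Complex.norm_real, Real.norm_eq_abs, hε, one_mul, norm_nu]
  have e3 : ‖(γ * δ : ℂ)‖ = |γ * δ| := by
    rw [← Complex.ofReal_mul, Complex.norm_real, Real.norm_eq_abs]
  have e4 : ‖(ε * k * nu k : ℂ)‖ - ‖(γ * δ : ℂ)‖ ≤ ‖Complex.I * (γ * δ - ε * k * nu k)‖ := by
    rw [norm_mul Complex.I, Complex.norm_I, one_mul, norm_sub_rev]
    exact norm_sub_norm_le _ _
  have e5 : ‖Complex.I * (γ * δ - ε * k * nu k)‖ - ‖(-γ * (k + ε * nu k) : ℂ)‖ ≤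
      ‖DeltaS ε γ δ k‖ := by
    have := norm_sub_norm_le (Complex.I * (γ * δ - ε * k * nu k)) (-(-γ * (k + ε * nu k)))
    rwa [norm_neg, sub_neg_eq_add, add_comm (Complex.I * _)] at this
  have h5 : ‖k‖ * (‖k‖ / 2) ≤ ‖k‖ * ‖rootBranch k‖ := by gcongr
  have h6 : (24 * |γ| + 4 * |γ * δ|) ≤ ‖k‖ - 2 := by
    unfold largeRadius at hk; linarith [abs_nonneg δ]
  have h7 : (24 * |γ| + 4 * |γ * δ|) * ‖k‖ ≤ (‖k‖ - 2) * ‖k‖ := by gcongr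
  have h8 : |γ * δ| * 2 ≤ |γ * δ| * ‖k‖ := by gcongr
  nlinarith [abs_nonneg (γ * δ), abs_nonneg γ]

theorem admissibleRadius_iff {γ δ a : ℝ} : AdmissibleRadius γ δ a ↔
    1 < a ∧ ∀ k : ℂ, a ≤ ‖k‖ → ∀ ε : ℝ, (ε = 1 ∨ ε = -1) → DeltaS ε γ δ k ≠ 0 := by
  refine and_congr_right fun _ => forall₂_congr fun k _ => ⟨?_, fun h => ⟨?_, ?_⟩⟩
  · rintro ⟨h1, h2⟩ ε (rfl | rfl)
    · rwa [DeltaS_one]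
    · rwa [DeltaS_neg_one]
  · rw [← DeltaS_one]; exact h 1 (.inl rfl)
  · rw [← DeltaS_neg_one]; exact h (-1) (.inr rfl)

theorem admissibleRadius_largeRadius (γ δ : ℝ) : AdmissibleRadius γ δ (largeRadius γ δ) := by
  refine admissibleRadius_iff.mpr ⟨by linarith [two_le_largeRadius γ δ], fun k hk ε hε h => ?_⟩
  have := norm_DeltaS_ge (ε := ε) (by rcases hε with rfl | rfl <;> simp) γ δ hk
  rw [h, norm_zero] at this
  have h2 : 2 ≤ ‖k‖ := (two_le_largeRadius γ δ).trans hk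
  nlinarith

/-- An admissible radius can be decreased a little. -/
theorem AdmissibleRadius.exists_lt {γ δ a : ℝ} (ha : AdmissibleRadius γ δ a) :
    ∃ a' < a, AdmissibleRadius γ δ a' := by
  rw [admissibleRadius_iff] at ha
  obtain ⟨ha1, ha⟩ := ha
  -- Nonvanishing is an open condition and the circle |k| = a is compact, so a whole annulus around
  -- it is free of zeros. A point just inside is compared with its radial projection. The gained
  -- margin makes the integrands holomorphic on an open set containing the contour.
  set U : Set ℂ := {k : ℂ | 1 < ‖k‖} ∩ (fun k => DeltaS 1 γ δ k * DeltaS (-1) γ δ k) ⁻¹' {0}ᶜ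
  have hU : IsOpen U := by
    refine ContinuousOn.isOpen_inter_preimage (fun k hk => ?_) (norm_lt_open 1)
      isOpen_compl_singleton
    exact ((differentiableAt_DeltaS 1 γ δ hk).continuousAt.mul
      (differentiableAt_DeltaS (-1) γ δ hk).continuousAt).continuousWithinAt
  have hsub : Metric.sphere (0 : ℂ) a ⊆ U := fun k hk => by
    have hk : ‖k‖ = a := by simpa using hk
    exact ⟨by simp [hk, ha1], mul_ne_zero (ha k hk.ge 1 (.inl rfl)) (ha k hk.ge (-1) (.inr rfl))⟩
  obtain ⟨r, hr, hrU⟩ := (isCompact_sphere (0 : ℂ) a).exists_thickening_subset_open hU hsub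
  refine ⟨max (a - r / 2) ((1 + a) / 2), max_lt (by linarith) (by linarith),
    admissibleRadius_iff.mpr ⟨lt_max_of_lt_right (by linarith), fun k hk ε hε => ?_⟩⟩
  by_cases hka : a ≤ ‖k‖
  · exact ha k hka ε hε
  push Not at hka
  have hk0 : 0 < ‖k‖ := lt_of_lt_of_le (lt_max_of_lt_right (by linarith)) hk
  have hkU : k ∈ U := by
    refine hrU (Metric.mem_thickening_iff.mpr ⟨((a / ‖k‖ : ℝ) : ℂ) * k, ?_, ?_⟩)
    · simp only [mem_sphere_zero_iff_norm, norm_mul, Complex.norm_real, norm_div, Real.norm_eq_abs,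
        abs_norm]
      rw [abs_of_pos (by linarith)]; field_simp
    · rw [dist_eq_norm]
      have : k - ((a / ‖k‖ : ℝ) : ℂ) * k = ((1 - a / ‖k‖ : ℝ) : ℂ) * k := by push_cast; ring
      rw [this, norm_mul, Complex.norm_real, Real.norm_eq_abs]
      have h1 : 1 - a / ‖k‖ = (‖k‖ - a) / ‖k‖ := by field_simp
      rw [h1, abs_div, abs_norm, div_mul_cancel₀ _ hk0.ne', abs_of_neg (by linarith)]
      have := (le_max_left _ _).trans hk
      linarith
  have := hkU.2
  rcases hε with rfl | rfl
  · exact left_ne_zero_of_mul this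
  · exact right_ne_zero_of_mul this

/-! ### Contour integrals by primitives in the logarithmic variable -/

/-- The contours `∂D₁` (for `ε = 1`) and `∂D₂` (for `ε = -1`). -/
def contourS (ε a : ℝ) (f : ℂ → ℂ) : ℂ :=
  (∫ r in Ioi a, f (ε * r))
  - (∫ ϑ in (Real.pi / 4 * (1 - ε))..(Real.pi / 4 * (1 - ε) + Real.pi / 2),
      f (circleMap 0 a ϑ) * (Complex.I * circleMap 0 a ϑ))
  - ε * ∫ r in Ioi a, f (Complex.I * r) * Complex.I

theorem contourS_one (a : ℝ) (f : ℂ → ℂ) : contourS 1 a f = contourD1 a f := by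
  simp [contourS, contourD1]; ring

theorem contourS_neg_one (a : ℝ) (f : ℂ → ℂ) : contourS (-1) a f = contourD2 a f := by
  have h1 : Real.pi / 4 * (1 - -1) = Real.pi / 2 := by ring
  have h2 : Real.pi / 2 + Real.pi / 2 = Real.pi := by ring
  rw [contourS, contourD2, h1, h2]
  simp

/-- Quadratic decay along the two rays of the contour. -/
def AxisDecay (ε a : ℝ) (f : ℂ → ℂ) : Prop :=
  ∃ C, ∀ r : ℝ, a ≤ r → ‖f (ε * r)‖ ≤ C / r ^ 2 ∧ ‖f (Complex.I * r)‖ ≤ C / r ^ 2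

theorem AxisDecay.mono {ε a b : ℝ} {f : ℂ → ℂ} (h : AxisDecay ε a f) (hab : a ≤ b) :
    AxisDecay ε b f := by
  obtain ⟨C, hC⟩ := h
  exact ⟨C, fun r hr => hC r (hab.trans hr)⟩

theorem integrableOn_div_sq {a : ℝ} (ha : 0 < a) (C : ℝ) :
    IntegrableOn (fun r : ℝ => C / r ^ 2) (Ioi a) := by
  have := (integrableOn_Ioi_rpow_of_lt (a := -2) (by norm_num) ha).const_mul C
  refine IntegrableOn.congr_fun this (fun r hr => ?_) measurableSet_Ioi
  have hr : 0 < r := ha.trans hr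
  change C * r ^ (-2 : ℝ) = C / r ^ 2
  rw [Real.rpow_neg hr.le, div_eq_mul_inv]; norm_cast

theorem integrableOn_ray {a' a : ℝ} (ha' : 0 < a') (haa : a' < a) {f : ℂ → ℂ}
    (hf : ContinuousOn f {k | a' < ‖k‖}) {c : ℂ} (hc : ‖c‖ = 1) {C : ℝ}
    (hC : ∀ r : ℝ, a ≤ r → ‖f (c * r)‖ ≤ C / r ^ 2) :
    IntegrableOn (fun r : ℝ => f (c * r)) (Ioi a) := by
  refine (integrableOn_div_sq (ha'.trans haa) C).mono' ?_ ?_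
  · refine ContinuousOn.aestronglyMeasurable (fun r hr => ?_) measurableSet_Ioi
    have hr : a < r := hr
    refine ContinuousAt.continuousWithinAt (ContinuousAt.comp (g := f) ?_ (by fun_prop))
    refine hf.continuousAt ((norm_lt_open a').mem_nhds ?_)
    change a' < ‖c * r‖
    rw [norm_mul, hc, one_mul, Complex.norm_real, Real.norm_of_nonneg (by linarith)]
    linarith
  · filter_upwards [ae_restrict_mem measurableSet_Ioi] with r hr
    exact hC r (le_of_lt hr)

theorem AxisDecay.integrableOn {ε : ℝ} (hε : |ε| = 1) {a' a : ℝ} (ha' : 0 < a') (haa : a' < a)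
    {f : ℂ → ℂ} (hf : ContinuousOn f {k | a' < ‖k‖}) (h : AxisDecay ε a f) :
    IntegrableOn (fun r : ℝ => f (ε * r)) (Ioi a) ∧
      IntegrableOn (fun r : ℝ => f (Complex.I * r)) (Ioi a) := by
  obtain ⟨C, hC⟩ := h
  exact ⟨integrableOn_ray ha' haa hf (by simpa using hε) fun r hr => (hC r hr).1,
    integrableOn_ray ha' haa hf (by simp) fun r hr => (hC r hr).2⟩

/-- `P` is a primitive of `f` for `|k| > a'` in the variable `u = log k`. -/
def IsLogPrimitive (a' : ℝ) (f P : ℂ → ℂ) : Prop :=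
  ∀ u : ℂ, Real.log a' < u.re → HasDerivAt P (f (Complex.exp u) * Complex.exp u) u

theorem lt_norm_exp {a' : ℝ} (ha' : 0 < a') {u : ℂ} (hu : Real.log a' < u.re) :
    a' < ‖Complex.exp u‖ := by
  rw [Complex.norm_exp]; exact (Real.log_lt_iff_lt_exp ha').mp hu

/-- The exterior of a disc is not simply connected, but its preimage under exp is a half-plane,
which is convex. A nonzero residue at infinity therefore does no harm. -/
theorem exists_isLogPrimitive {a' : ℝ} (ha' : 0 < a') {f : ℂ → ℂ}
    (hf : DifferentiableOn ℂ f {k | a' < ‖k‖}) : ∃ P, IsLogPrimitive a' f P := by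
  have hs : Convex ℝ {u : ℂ | Real.log a' < u.re} := convex_halfSpace_re_gt _
  have ho : IsOpen {u : ℂ | Real.log a' < u.re} := isOpen_lt continuous_const Complex.continuous_re
  have hg : DifferentiableOn ℂ (fun u => f (Complex.exp u) * Complex.exp u)
      {u : ℂ | Real.log a' < u.re} := by
    refine DifferentiableOn.mul (hf.comp Complex.differentiable_exp.differentiableOn fun u hu => ?_)
      Complex.differentiable_exp.differentiableOn
    exact lt_norm_exp ha' hu
  obtain ⟨P, hP⟩ := hs.exists_forall_hasDerivWithinAt hg
  exact ⟨P, fun u hu => (hP u hu).hasDerivAt (ho.mem_nhds hu)⟩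

theorem exp_log_add {r : ℝ} (hr : 0 < r) (θ : ℝ) :
    Complex.exp (Real.log r + θ * Complex.I) = r * Complex.exp (θ * Complex.I) := by
  rw [Complex.exp_add, ← Complex.ofReal_exp, Real.exp_log hr]

theorem exp_rayAngle {ε : ℝ} (hε : ε = 1 ∨ ε = -1) :
    Complex.exp (((Real.pi / 2 * (1 - ε) : ℝ) : ℂ) * Complex.I) = ε := by
  rcases hε with rfl | rfl
  · simp
  · have : Real.pi / 2 * (1 - -1) = Real.pi := by ring
    rw [this, Complex.exp_pi_mul_I]; simp

theorem exp_half_pi : Complex.exp (((Real.pi / 2 : ℝ) : ℂ) * Complex.I) = Complex.I := by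
  push_cast; exact Complex.exp_pi_div_two_mul_I

theorem log_lt_re {a' r : ℝ} (ha' : 0 < a') (hr : a' < r) (θ : ℝ) :
    Real.log a' < ((Real.log r : ℂ) + θ * Complex.I).re := by
  simpa using Real.log_lt_log ha' hr

theorem IsLogPrimitive.hasDerivAt_ray {a' : ℝ} (ha' : 0 < a') {f P : ℂ → ℂ}
    (hP : IsLogPrimitive a' f P) (θ : ℝ) {r : ℝ} (hr : a' < r) :
    HasDerivAt (fun r : ℝ => P (Real.log r + θ * Complex.I))
      (f (Complex.exp (θ * Complex.I) * r) * Complex.exp (θ * Complex.I)) r := by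
  have hr0 : 0 < r := ha'.trans hr
  have h1 : HasDerivAt (fun r : ℝ => ((Real.log r : ℝ) : ℂ) + θ * Complex.I)
      (((r⁻¹ : ℝ) : ℂ)) r := ((Real.hasDerivAt_log hr0.ne').ofReal_comp).add_const _
  have h2 := (hP _ (log_lt_re ha' hr θ)).comp r h1
  refine h2.congr_deriv ?_
  have : (r : ℂ) ≠ 0 := by exact_mod_cast hr0.ne'
  rw [exp_log_add hr0, mul_comm (Complex.exp _) (r : ℂ)]
  push_cast
  field_simp

theorem IsLogPrimitive.hasDerivAt_arc {a' : ℝ} (ha' : 0 < a') {f P : ℂ → ℂ}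
    (hP : IsLogPrimitive a' f P) {r : ℝ} (hr : a' < r) (θ : ℝ) :
    HasDerivAt (fun θ : ℝ => P (Real.log r + θ * Complex.I))
      (f (circleMap 0 r θ) * (Complex.I * circleMap 0 r θ)) θ := by
  have hr0 : 0 < r := ha'.trans hr
  have h1 : HasDerivAt (fun θ : ℝ => ((Real.log r : ℝ) : ℂ) + θ * Complex.I) Complex.I θ := by
    have h0 : HasDerivAt (fun t : ℝ => (t : ℂ)) 1 θ := (hasDerivAt_id θ).ofReal_comp
    simpa using (h0.mul_const Complex.I).const_add ((Real.log r : ℝ) : ℂ)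
  have h2 := (hP _ (log_lt_re ha' hr θ)).comp θ h1
  refine h2.congr_deriv ?_
  rw [exp_log_add hr0, circleMap_zero]
  ring

theorem continuous_circleMap_mul {a' : ℝ} {f : ℂ → ℂ} (hf : ContinuousOn f {k | a' < ‖k‖})
    {r : ℝ} (hr0 : 0 < r) (hr : a' < r) :
    Continuous fun θ : ℝ => f (circleMap 0 r θ) * (Complex.I * circleMap 0 r θ) := by
  refine Continuous.mul ?_ (continuous_const.mul (continuous_circleMap 0 r))
  refine continuous_iff_continuousAt.mpr fun θ => ContinuousAt.comp (g := f) ?_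
    (continuous_circleMap 0 r).continuousAt
  refine hf.continuousAt ((norm_lt_open a').mem_nhds ?_)
  change a' < ‖circleMap 0 r θ‖
  simpa [abs_of_pos hr0] using hr

/-- The contour integral in terms of the limits of a primitive along the two rays. -/
theorem IsLogPrimitive.exists_limits {ε : ℝ} (hε : ε = 1 ∨ ε = -1) {a' a : ℝ} (ha' : 0 < a')
    (haa : a' < a) {f P : ℂ → ℂ} (hP : IsLogPrimitive a' f P)
    (hf : ContinuousOn f {k | a' < ‖k‖}) (hdec : AxisDecay ε a f) :
    ∃ L₁ L₂ : ℂ,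
      Tendsto (fun r : ℝ => P (Real.log r + ((Real.pi / 2 * (1 - ε) : ℝ) : ℂ) * Complex.I)) atTop
        (𝓝 L₁) ∧
      Tendsto (fun r : ℝ => P (Real.log r + ((Real.pi / 2 : ℝ) : ℂ) * Complex.I)) atTop (𝓝 L₂) ∧
      contourS ε a f = ε * (L₁ - L₂) := by
  have ha0 : 0 < a := ha'.trans haa
  have hεε : (ε : ℂ) * ε = 1 := by rcases hε with rfl | rfl <;> simp
  obtain ⟨hi1, hi2⟩ := hdec.integrableOn (by rcases hε with rfl | rfl <;> simp) ha' haa hf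
  -- Integrability along a ray gives the primitive a limit at infinity. In the sum of rays and arc
  -- the values at the two corners of radius a cancel, leaving only these limits.
  have key : ∀ θ : ℝ, IntegrableOn (fun r : ℝ => f (Complex.exp (θ * Complex.I) * r)) (Ioi a) →
      ∃ L, Tendsto (fun r : ℝ => P (Real.log r + θ * Complex.I)) atTop (𝓝 L) ∧
        (∫ r in Ioi a, f (Complex.exp (θ * Complex.I) * r)) * Complex.exp (θ * Complex.I) =
          L - P (Real.log a + θ * Complex.I) := by
    intro θ hθ
    have hder : ∀ r ∈ Ici a, HasDerivAt (fun r : ℝ => P (Real.log r + θ * Complex.I))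
        (f (Complex.exp (θ * Complex.I) * r) * Complex.exp (θ * Complex.I)) r := fun r hr =>
      hP.hasDerivAt_ray ha' θ (haa.trans_le hr)
    have hlim := tendsto_limUnder_of_hasDerivAt_of_integrableOn_Ioi
      (fun r hr => hder r (Ioi_subset_Ici_self hr)) (hθ.mul_const _)
    refine ⟨_, hlim, ?_⟩
    rw [← integral_mul_const]
    exact integral_Ioi_of_hasDerivAt_of_tendsto (hder a self_mem_Ici).continuousAt.continuousWithinAt
      (fun r hr => hder r (Ioi_subset_Ici_self hr)) (hθ.mul_const _) hlim
  obtain ⟨L₁, hL₁, e1⟩ := key (Real.pi / 2 * (1 - ε)) (by rwa [exp_rayAngle hε])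
  obtain ⟨L₂, hL₂, e2⟩ := key (Real.pi / 2) (by rwa [exp_half_pi])
  refine ⟨L₁, L₂, hL₁, hL₂, ?_⟩
  rw [exp_rayAngle hε] at e1
  rw [exp_half_pi] at e2
  have e3 : (∫ ϑ in (Real.pi / 4 * (1 - ε))..(Real.pi / 4 * (1 - ε) + Real.pi / 2),
      f (circleMap 0 a ϑ) * (Complex.I * circleMap 0 a ϑ)) =
      P (Real.log a + ((Real.pi / 4 * (1 - ε) + Real.pi / 2 : ℝ) : ℂ) * Complex.I) -
      P (Real.log a + ((Real.pi / 4 * (1 - ε) : ℝ) : ℂ) * Complex.I) :=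
    intervalIntegral.integral_eq_sub_of_hasDerivAt
      (f := fun θ : ℝ => P (Real.log a + θ * Complex.I))
      (fun θ _ => hP.hasDerivAt_arc ha' haa θ)
      ((continuous_circleMap_mul hf ha0 haa).intervalIntegrable _ _)
  have e1' : (∫ r in Ioi a, f (ε * r)) =
      ε * (L₁ - P (Real.log a + ((Real.pi / 2 * (1 - ε) : ℝ) : ℂ) * Complex.I)) := by
    rw [← e1]; linear_combination (-(∫ r in Ioi a, f (ε * r))) * hεε
  rw [contourS, e3, e1', integral_mul_const, e2]
  rcases hε with rfl | rfl
  · simp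
  · have h1 : Real.pi / 4 * (1 - -1) = Real.pi / 2 := by ring
    have h2 : Real.pi / 2 + Real.pi / 2 = Real.pi := by ring
    have h3 : Real.pi / 2 * (1 - -1) = Real.pi := by ring
    simp only [h1, h2, h3]
    push_cast; ring

/-- The contour integral does not depend on the radius. -/
theorem contourS_eq_of_decay {ε : ℝ} (hε : ε = 1 ∨ ε = -1) {a' a b : ℝ} (ha' : 0 < a')
    (haa : a' < a) (hab : a' < b) {f : ℂ → ℂ} (hf : DifferentiableOn ℂ f {k | a' < ‖k‖})
    (ha : AxisDecay ε a f) (hb : AxisDecay ε b f) : contourS ε a f = contourS ε b f := by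
  -- One primitive serves both radii, and its limits at infinity do not see where the contour turns.
  obtain ⟨P, hP⟩ := exists_isLogPrimitive ha' hf
  obtain ⟨L₁, L₂, h1, h2, h3⟩ := hP.exists_limits hε ha' haa hf.continuousOn ha
  obtain ⟨M₁, M₂, h4, h5, h6⟩ := hP.exists_limits hε ha' hab hf.continuousOn hb
  rw [h3, h6, tendsto_nhds_unique h1 h4, tendsto_nhds_unique h2 h5]

/-- The contour integral vanishes if the integrand decays in the whole sector. -/
theorem contourS_eq_zero {ε : ℝ} (hε : ε = 1 ∨ ε = -1) {a' a : ℝ} (ha' : 0 < a')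
    (haa : a' < a) {f : ℂ → ℂ} (hf : DifferentiableOn ℂ f {k | a' < ‖k‖}) {C : ℝ}
    (hC : ∀ k : ℂ, a ≤ ‖k‖ → 0 ≤ ε * k.re → 0 ≤ k.im → ‖f k‖ ≤ C / ‖k‖ ^ 2) :
    contourS ε a f = 0 := by
  have ha0 : 0 < a := ha'.trans haa
  obtain ⟨P, hP⟩ := exists_isLogPrimitive ha' hf
  have hdec : AxisDecay ε a f := by
    refine ⟨C, fun r hr => ?_⟩
    have hr0 : 0 < r := ha0.trans_le hr
    have h1 := hC (ε * r)
    have h2 := hC (Complex.I * r)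
    have hn : |ε| = 1 := by rcases hε with rfl | rfl <;> simp
    have hεε : ε * ε = 1 := by rcases hε with rfl | rfl <;> simp
    simp only [norm_mul, Complex.norm_real, Complex.norm_I, Real.norm_eq_abs, hn, one_mul,
      abs_of_pos hr0, Complex.mul_re, Complex.mul_im, Complex.ofReal_re, Complex.ofReal_im,
      Complex.I_re, Complex.I_im, zero_mul, mul_zero, sub_zero, add_zero, zero_add] at h1 h2
    refine ⟨h1 hr ?_ le_rfl, h2 hr le_rfl hr0.le⟩
    rw [← mul_assoc, hεε, one_mul]; exact hr0.le
  obtain ⟨L₁, L₂, h1, h2, h3⟩ := hP.exists_limits hε ha' haa hf.continuousOn hdec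
  suffices L₁ - L₂ = 0 by rw [h3, this, mul_zero]
  refine tendsto_nhds_unique (h1.sub h2) ?_
  rw [tendsto_zero_iff_norm_tendsto_zero]
  -- The two limits are compared along the arc of radius r: there the angular derivative of P has
  -- modulus |f||k| ≤ C/r, and the angle varies by at most π.
  refine squeeze_zero' (g := fun r : ℝ => C / r * Real.pi) (.of_forall fun _ => norm_nonneg _) ?_ ?_
  · filter_upwards [eventually_ge_atTop a] with r hr
    have hr0 : 0 < r := ha0.trans_le hr
    set s : Set ℝ := if ε = 1 then Icc 0 (Real.pi / 2) else Icc (Real.pi / 2) Real.pi with hs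
    have hsc : Convex ℝ s := by rw [hs]; split_ifs <;> exact convex_Icc _ _
    have hsub : ∀ θ ∈ s, 0 ≤ ε * Real.cos θ ∧ 0 ≤ Real.sin θ := by
      intro θ hθ
      rcases hε with rfl | rfl
      · simp only [hs, if_true] at hθ
        exact ⟨by rw [one_mul]; exact Real.cos_nonneg_of_mem_Icc ⟨by linarith [hθ.1, Real.pi_pos], hθ.2⟩,
          Real.sin_nonneg_of_mem_Icc ⟨hθ.1, by linarith [hθ.2, Real.pi_pos]⟩⟩
      · rw [hs, if_neg (by norm_num)] at hθ
        have hcos := Real.cos_nonpos_of_pi_div_two_le_of_le hθ.1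
          (by linarith [hθ.2, Real.pi_pos])
        exact ⟨by linarith, Real.sin_nonneg_of_mem_Icc ⟨by linarith [hθ.1, Real.pi_pos], hθ.2⟩⟩
    have hm1 : Real.pi / 2 * (1 - ε) ∈ s := by
      rcases hε with rfl | rfl
      · simp only [hs, if_true]; constructor <;> linarith [Real.pi_pos]
      · rw [hs, if_neg (by norm_num)]; constructor <;> linarith [Real.pi_pos]
    have hm2 : Real.pi / 2 ∈ s := by
      rcases hε with rfl | rfl
      · simp only [hs, if_true]; constructor <;> linarith [Real.pi_pos]
      · rw [hs, if_neg (by norm_num)]; constructor <;> linarith [Real.pi_pos]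
    have hmv := hsc.norm_image_sub_le_of_norm_hasDerivWithin_le (C := C / r)
      (f := fun θ : ℝ => P (Real.log r + θ * Complex.I))
      (fun θ _ => (hP.hasDerivAt_arc ha' (haa.trans_le hr) θ).hasDerivWithinAt) (fun θ hθ => ?_)
      hm2 hm1
    · refine hmv.trans ?_
      have h5 : ‖Real.pi / 2 * (1 - ε) - Real.pi / 2‖ ≤ Real.pi := by
        rcases hε with rfl | rfl
        · rw [sub_self, mul_zero, zero_sub, norm_neg, Real.norm_of_nonneg (by positivity)]
          linarith [Real.pi_pos]
        · rw [Real.norm_of_nonneg (by linarith [Real.pi_pos])]; linarith [Real.pi_pos]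
      have h6 : 0 ≤ C / r := by
        have := hC (circleMap 0 r (Real.pi / 2)) (by simpa [abs_of_pos hr0] using hr)
        obtain ⟨q1, q2⟩ := hsub _ hm2
        have h7 := this (by simp [circleMap]) (by simp [circleMap]; positivity)
        have h8 := (norm_nonneg _).trans h7
        simp only [norm_circleMap_zero, sq_abs] at h8
        have : C / r = C / r ^ 2 * r := by field_simp
        rw [this]; positivity
      gcongr
    · obtain ⟨q1, q2⟩ := hsub θ hθ
      have h7 := hC (circleMap 0 r θ) (by simpa [abs_of_pos hr0] using hr)
        (by
          have : (circleMap 0 r θ).re = r * Real.cos θ := by simp [circleMap, Complex.exp_re]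
          rw [this, mul_left_comm]; positivity)
        (by
          have : (circleMap 0 r θ).im = r * Real.sin θ := by simp [circleMap, Complex.exp_im]
          rw [this]; positivity)
      rw [norm_mul, norm_mul, Complex.norm_I, one_mul]
      simp only [norm_circleMap_zero, abs_of_pos hr0] at h7 ⊢
      calc _ ≤ C / r ^ 2 * r := by gcongr
        _ = C / r := by field_simp
  · have := (tendsto_const_nhds (x := C)).div_atTop (tendsto_id (α := ℝ) (x := atTop))
    simpa using this.mul_const Real.pi

/-! ### A Schwartz extension of the decaying exponential -/

/-- A smooth function on the line equal to `e^{-y}` for `y ≥ -1` and to `0` for `y ≤ -2`. -/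
def expExtFun (y : ℝ) : ℂ := ((Real.smoothTransition (y + 2) * Real.exp (-y) : ℝ) : ℂ)

theorem expExtFun_contDiff : ContDiff ℝ ∞ expExtFun :=
  Complex.ofRealCLM.contDiff.comp ((Real.smoothTransition.contDiff.comp
    (contDiff_id.add contDiff_const)).mul (Real.contDiff_exp.comp contDiff_neg))

theorem iteratedDeriv_exp_neg_complex (n : ℕ) (y : ℝ) :
    iteratedDeriv n (fun y : ℝ => Complex.exp (-1 * y)) y = (-1) ^ n * Complex.exp (-1 * y) :=
  iteratedDeriv_exp_mul_ofReal (-1) n y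

theorem iteratedDeriv_expExtFun_of_gt {y : ℝ} (hy : -1 < y) (n : ℕ) :
    iteratedDeriv n expExtFun y = (-1) ^ n * Complex.exp (-y) := by
  have h : expExtFun =ᶠ[𝓝 y] fun y : ℝ => Complex.exp (-1 * y) := by
    filter_upwards [lt_mem_nhds hy] with z hz
    rw [expExtFun, Real.smoothTransition.one_of_one_le (by linarith)]
    push_cast; simp
  rw [h.iteratedDeriv_eq, iteratedDeriv_exp_neg_complex]; simp

theorem iteratedDeriv_expExtFun_of_lt {y : ℝ} (hy : y < -2) (n : ℕ) :
    iteratedDeriv n expExtFun y = 0 := by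
  have h : expExtFun =ᶠ[𝓝 y] 0 := by
    filter_upwards [gt_mem_nhds hy] with z hz
    rw [expExtFun, Real.smoothTransition.zero_of_nonpos (by linarith)]; simp
  rw [h.iteratedDeriv_eq]
  simp [iteratedDeriv_eq_iteratedFDeriv]

theorem expExtFun_decay (k n : ℕ) : ∃ C, ∀ y : ℝ, ‖y‖ ^ k * ‖iteratedFDeriv ℝ n expExtFun y‖ ≤ C := by
  have hc : Continuous fun y : ℝ => ‖y‖ ^ k * ‖iteratedFDeriv ℝ n expExtFun y‖ := by
    have := expExtFun_contDiff.continuous_iteratedFDeriv (m := n) (by exact_mod_cast le_top)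
    fun_prop
  obtain ⟨M, hM⟩ := (isCompact_Icc (a := (-2 : ℝ)) (b := 0)).exists_bound_of_continuousOn
    hc.continuousOn
  refine ⟨max M k.factorial, fun y => ?_⟩
  by_cases h1 : y < -2
  · rw [norm_iteratedFDeriv_eq_norm_iteratedDeriv, iteratedDeriv_expExtFun_of_lt h1]
    simp only [norm_zero, mul_zero]
    exact le_max_of_le_right (by positivity)
  by_cases h2 : y ≤ 0
  · exact le_max_of_le_left ((le_abs_self _).trans (hM y ⟨not_lt.mp h1, h2⟩))
  · push Not at h2
    rw [norm_iteratedFDeriv_eq_norm_iteratedDeriv, iteratedDeriv_expExtFun_of_gt (by linarith)]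
    refine le_max_of_le_right ?_
    rw [norm_mul, norm_pow, norm_neg, norm_one, one_pow, one_mul, ← Complex.ofReal_neg,
      ← Complex.ofReal_exp, Complex.norm_real, Real.norm_of_nonneg (Real.exp_pos _).le,
      Real.norm_of_nonneg h2.le, Real.exp_neg, ← div_eq_mul_inv, div_le_iff₀ (Real.exp_pos _)]
    have := Real.pow_div_factorial_le_exp y h2.le k
    rw [div_le_iff₀ (by positivity)] at this
    linarith

/-- The Schwartz extension of the exponential. -/
def expExt : 𝓢(ℝ, ℂ) where
  toFun := expExtFun
  smooth' := expExtFun_contDiff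
  decay' := expExtFun_decay

/-- Schwartz extensions of the exponential whose first `m` moments vanish. -/
def expExtMoment (m : ℕ) : 𝓢(ℝ, ℂ) := (-1 : ℂ) ^ m • (SchwartzMap.derivCLM ℂ ℂ)^[m] expExt

theorem expExtMoment_apply (m : ℕ) {y : ℝ} (hy : 0 ≤ y) : expExtMoment m y = Complex.exp (-y) := by
  have h : iteratedDeriv m expExt y = (-1) ^ m * Complex.exp (-y) :=
    iteratedDeriv_expExtFun_of_gt (by linarith) m
  rw [expExtMoment, smul_apply, iterate_derivCLM_apply, h, smul_eq_mul, ← mul_assoc, ← mul_pow]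
  simp

theorem fourier_expExtMoment (m : ℕ) (ξ : ℝ) :
    (𝓕 (expExtMoment m)) ξ = (-(2 * Real.pi * Complex.I * ξ)) ^ m * (𝓕 expExt) ξ := by
  rw [expExtMoment, FourierTransform.fourier_smul, smul_apply, fourier_iterate_derivCLM, smul_eq_mul,
    ← mul_assoc, ← mul_pow]
  ring

theorem exists_weight_mul_schwartz_le (f : 𝓢(ℝ, ℂ)) (s : ℝ) :
    ∃ C, 0 ≤ C ∧ ∀ ξ, weight s ξ * ‖f ξ‖ ≤ C := by
  obtain ⟨C, hC⟩ := (SchwartzMap.smulLeftCLM ℂ (fun ξ : ℝ => ((weight s ξ : ℝ) : ℂ)) f).decay 0 0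
  refine ⟨C, hC.1.le, fun ξ => ?_⟩
  have := hC.2 ξ
  rw [norm_iteratedFDeriv_zero, SchwartzMap.smulLeftCLM_apply_apply (weight_hasTemperateGrowth s)]
    at this
  simpa [abs_of_pos (weight_pos s ξ)] using this

theorem one_le_weight {s : ℝ} (hs : 0 ≤ s) (ξ : ℝ) : 1 ≤ weight s ξ :=
  Real.one_le_rpow (by nlinarith [sq_nonneg (2 * Real.pi * ξ)]) (by positivity)

theorem weight_mono {s r : ℝ} (h : s ≤ r) (ξ : ℝ) : weight s ξ ≤ weight r ξ :=
  Real.rpow_le_rpow_of_exponent_le (by nlinarith [sq_nonneg (2 * Real.pi * ξ)]) (by linarith)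

theorem abs_le_weight_one (ξ : ℝ) : |ξ| ≤ weight 1 ξ := by
  rw [weight, ← Real.sqrt_eq_rpow]
  refine Real.abs_le_sqrt ?_
  have h : (1 : ℝ) ≤ (2 * Real.pi) ^ 2 := by nlinarith [Real.pi_gt_three]
  rw [mul_pow]
  nlinarith [mul_le_mul_of_nonneg_right h (sq_nonneg ξ)]

/-- For each `s` there is an extension of the exponential whose transform makes the rescaled kernel
homogeneous of degree `-1` in the scale of `H^s`. -/
theorem exists_expExt_kernel_bound (s : ℝ) : ∃ (m : ℕ) (C : ℝ), 0 ≤ C ∧ ∀ (ξ r : ℝ), 1 ≤ r →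
    weight s ξ * ‖(𝓕 (expExtMoment m)) (ξ / r)‖ * r⁻¹ ≤ C * r ^ s * (|ξ| + r)⁻¹ := by
  -- The factor 1 + |ξ/r| absorbs the denominator, since r(1 + |ξ/r|) = |ξ| + r.
  suffices h : ∃ (m : ℕ) (C : ℝ), 0 ≤ C ∧ ∀ (ξ r : ℝ), 1 ≤ r →
      weight s ξ * (‖(𝓕 (expExtMoment m)) (ξ / r)‖ * (1 + |ξ / r|)) ≤ C * r ^ s by
    obtain ⟨m, C, hC, h⟩ := h
    refine ⟨m, C, hC, fun ξ r hr => ?_⟩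
    have hr0 : 0 < r := by linarith
    have hpos : 0 < |ξ| + r := by positivity
    rw [← div_eq_mul_inv (_ * _), ← div_eq_mul_inv, div_le_div_iff₀ hr0 hpos]
    have := mul_le_mul_of_nonneg_right (h ξ r hr) hr0.le
    refine le_trans (le_of_eq ?_) this
    rw [abs_div, abs_of_pos hr0]; field_simp; ring
  -- For s ≥ 0 the weight at ξ is at most r^s times the weight at ξ/r, and Schwartz decay suffices.
  -- For s < 0 the weight near ξ = 0 does not become small as r grows, while r^s does; m ≥ -s
  -- vanishing moments supply the missing power of |ξ/r|.
  rcases le_or_gt 0 s with hs | hs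
  · obtain ⟨C, hC, h⟩ := exists_weight_mul_schwartz_le (𝓕 (expExtMoment 0)) (s + 1)
    refine ⟨0, 2 * C, by positivity, fun ξ r hr => ?_⟩
    have hr0 : 0 < r := by linarith
    have h1 : weight s ξ ≤ weight s (ξ / r) * r ^ s := by
      have : r ^ s = (r ^ 2) ^ (s / 2) := by
        rw [← Real.rpow_natCast, ← Real.rpow_mul hr0.le]; congr 1; push_cast; ring
      rw [weight, weight, this, ← Real.mul_rpow (by positivity) (by positivity)]
      refine Real.rpow_le_rpow (by positivity) ?_ (by positivity)
      have : (1 + (2 * Real.pi * (ξ / r)) ^ 2) * r ^ 2 = r ^ 2 + (2 * Real.pi * ξ) ^ 2 := by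
        field_simp
      rw [this]; nlinarith
    have h2 : 1 + |ξ / r| ≤ 2 * weight 1 (ξ / r) := by
      linarith [one_le_weight zero_le_one (ξ / r), abs_le_weight_one (ξ / r)]
    calc _ ≤ weight s (ξ / r) * r ^ s *
          (‖(𝓕 (expExtMoment 0)) (ξ / r)‖ * (2 * weight 1 (ξ / r))) := by
            gcongr
            exact mul_nonneg (weight_pos _ _).le (Real.rpow_nonneg hr0.le _)
      _ = 2 * (weight (s + 1) (ξ / r) * ‖(𝓕 (expExtMoment 0)) (ξ / r)‖) * r ^ s := by
          rw [← weight_mul]; ring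
      _ ≤ 2 * C * r ^ s := by gcongr; exact h _
  · obtain ⟨m, hm⟩ := exists_nat_ge (-s)
    obtain ⟨C, hC, h⟩ := exists_weight_mul_schwartz_le (𝓕 expExt) (m + s + 1)
    refine ⟨m, 2 * C, by positivity, fun ξ r hr => ?_⟩
    have hr0 : 0 < r := by linarith
    rw [fourier_expExtMoment, norm_mul, norm_pow, norm_neg]
    have hn : ‖(2 * Real.pi * Complex.I * ((ξ / r : ℝ) : ℂ) : ℂ)‖ = 2 * Real.pi * |ξ / r| := by
      simp [abs_of_pos Real.pi_pos, abs_div]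
    rw [hn]
    set ρ := 2 * Real.pi * |ξ / r| with hρ
    have hρ0 : 0 ≤ ρ := by positivity
    have h2 : 1 + |ξ / r| ≤ 2 * weight 1 (ξ / r) := by
      linarith [one_le_weight zero_le_one (ξ / r), abs_le_weight_one (ξ / r)]
    have h3 : weight s ξ * ρ ^ m ≤ r ^ s * weight (m + s) (ξ / r) := by
      rcases hρ0.eq_or_lt with h0 | h0
      · rw [← h0]
        rcases Nat.eq_zero_or_pos m with rfl | hm0
        · simp at hm; linarith
        · rw [zero_pow hm0.ne', mul_zero]
          exact mul_nonneg (Real.rpow_nonneg hr0.le _) (weight_pos _ _).le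
      have h4 : weight s ξ ≤ r ^ s * ρ ^ s := by
        have hpos : 0 < r * ρ := by positivity
        rw [← Real.mul_rpow hr0.le hρ0, weight]
        have : (r * ρ) ^ s = ((r * ρ) ^ 2) ^ (s / 2) := by
          rw [← Real.rpow_natCast, ← Real.rpow_mul hpos.le]; congr 1; push_cast; ring
        rw [this]
        refine Real.rpow_le_rpow_of_nonpos (by positivity) ?_ (by linarith)
        have : r * ρ = 2 * Real.pi * |ξ| := by rw [hρ, abs_div, abs_of_pos hr0]; field_simp
        rw [this, mul_pow _ |ξ|, sq_abs, ← mul_pow]; linarith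
      have h5 : ρ ^ s * ρ ^ m ≤ weight (m + s) (ξ / r) := by
        rw [← Real.rpow_natCast, ← Real.rpow_add h0, weight]
        have : ρ ^ (s + m) = (ρ ^ 2) ^ ((m + s) / 2) := by
          rw [← Real.rpow_natCast ρ 2, ← Real.rpow_mul hρ0]; congr 1; push_cast; ring
        rw [this]
        refine Real.rpow_le_rpow (by positivity) ?_ (by linarith)
        rw [hρ, mul_pow _ |ξ / r|, sq_abs, ← mul_pow]; linarith
      calc _ ≤ r ^ s * ρ ^ s * ρ ^ m := by gcongr
        _ = r ^ s * (ρ ^ s * ρ ^ m) := by ring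
        _ ≤ _ := by gcongr
    calc _ = (weight s ξ * ρ ^ m) * ‖(𝓕 expExt) (ξ / r)‖ * (1 + |ξ / r|) := by ring
      _ ≤ (r ^ s * weight (m + s) (ξ / r)) * ‖(𝓕 expExt) (ξ / r)‖ * (2 * weight 1 (ξ / r)) := by
          refine mul_le_mul (mul_le_mul_of_nonneg_right h3 (norm_nonneg _)) h2 (by positivity)
            (mul_nonneg (mul_nonneg (Real.rpow_nonneg hr0.le _) (weight_pos _ _).le)
              (norm_nonneg _))
      _ = 2 * (weight (m + s + 1) (ξ / r) * ‖(𝓕 expExt) (ξ / r)‖) * r ^ s := by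
          rw [← weight_mul (m + s) 1]; ring
      _ ≤ 2 * C * r ^ s := by gcongr; exact h _

/-! ### Half-line norms from Fourier densities -/

theorem eLpNorm_two_le {f : ℝ → ℂ} {μ : Measure ℝ} {B : ℝ≥0∞} (h : ∫⁻ x, ‖f x‖ₑ ^ 2 ∂μ ≤ B ^ 2) :
    eLpNorm f 2 μ ≤ B := by
  rw [eLpNorm_eq_lintegral_rpow_enorm_toReal two_ne_zero ENNReal.ofNat_ne_top]
  simp only [ENNReal.toReal_ofNat, ENNReal.rpow_two]
  refine (ENNReal.rpow_le_rpow h (by norm_num)).trans (le_of_eq ?_)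
  rw [← ENNReal.rpow_natCast, ← ENNReal.rpow_mul]; simp

theorem eLpNorm_two_sq (f : ℝ → ℂ) (μ : Measure ℝ) : eLpNorm f 2 μ ^ 2 = ∫⁻ x, ‖f x‖ₑ ^ 2 ∂μ := by
  rw [eLpNorm_eq_lintegral_rpow_enorm_toReal two_ne_zero ENNReal.ofNat_ne_top]
  simp only [ENNReal.toReal_ofNat, ENNReal.rpow_two]
  rw [← ENNReal.rpow_natCast, ← ENNReal.rpow_mul]; simp

theorem coe_testToSchwartz {Ω : Opens ℝ} (θ : 𝓓(Ω, ℂ)) : ⇑(testToSchwartz θ) = θ := rfl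

theorem fourierInv_testToSchwartz (θ : 𝓓(halfLine, ℂ)) (ξ : ℝ) :
    (𝓕⁻ (testToSchwartz θ)) ξ = expPairing θ ((2 * Real.pi * ξ : ℝ) : ℂ) := by
  rw [SchwartzMap.fourierInv_coe, Real.fourierInv_eq', expPairing]
  refine integral_congr_ae (.of_forall fun x => ?_)
  simp only [coe_testToSchwartz, smul_eq_mul]
  congr 2
  simp; ring

theorem test_apply_of_nonpos (θ : 𝓓(halfLine, ℂ)) {x : ℝ} (hx : x ≤ 0) : θ x = 0 := by
  by_contra h
  have : x ∈ (halfLine : Set ℝ) := θ.tsupport_subset (subset_tsupport _ h)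
  exact absurd (show 0 < x from this) (not_lt.mpr hx)

/-- The functional `u` on test functions is given by a Fourier density whose weighted `L²` norm is at
most `B`. -/
def HalfBound (s : ℝ) (u : 𝓓(halfLine, ℂ) → ℂ) (B : ℝ≥0∞) : Prop :=
  ∃ G : ℝ → ℂ, AEStronglyMeasurable G ∧ eLpNorm (fun ξ => (weight s ξ : ℂ) * G ξ) 2 ≤ B ∧
    ∀ θ, u θ = ∫ ξ, G ξ * (𝓕⁻ (testToSchwartz θ)) ξ

theorem aestronglyMeasurable_weight_mul (s : ℝ) {G : ℝ → ℂ} (hG : AEStronglyMeasurable G) :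
    AEStronglyMeasurable (fun ξ => (weight s ξ : ℂ) * G ξ) :=
  (Complex.continuous_ofReal.comp (continuous_weight s)).aestronglyMeasurable.mul hG

theorem HalfBound.exists_restriction {s : ℝ} {u : 𝓓(halfLine, ℂ) → ℂ} {B : ℝ≥0∞}
    (h : HalfBound s u B) (hB : B ≠ ⊤) : ∃ F : 𝓢'(ℝ, ℂ), RestrictsTo F u ∧
      sobolevNorm s F ≤ ENNReal.ofReal (Real.sqrt (2 * Real.pi)) * B := by
  obtain ⟨G, hGm, hG, hu⟩ := h
  obtain ⟨F, hF, hn⟩ := exists_of_memLp (s := s) (G := G)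
    ⟨aestronglyMeasurable_weight_mul s hGm, hG.trans_lt (lt_top_iff_ne_top.mpr hB)⟩
  refine ⟨F, fun θ => (hF _).trans (hu θ).symm, ?_⟩
  rw [hn]; gcongr

theorem HalfBound.sobolevNormHalfLine_le {s : ℝ} {u : 𝓓(halfLine, ℂ) → ℂ} {B : ℝ≥0∞}
    (h : HalfBound s u B) (hB : B ≠ ⊤) :
    sobolevNormHalfLine s u ≤ ENNReal.ofReal (Real.sqrt (2 * Real.pi)) * B := by
  obtain ⟨F, hF, hn⟩ := h.exists_restriction hB
  exact (iInf₂_le F hF).trans hn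

theorem integrable_mul_schwartz {s : ℝ} {G : ℝ → ℂ} (hGm : AEStronglyMeasurable G)
    (hG : eLpNorm (fun ξ => (weight s ξ : ℂ) * G ξ) 2 ≠ ⊤) (f : 𝓢(ℝ, ℂ)) :
    Integrable fun ξ => G ξ * f ξ := by
  have h1 : MemLp (fun ξ => (weight s ξ : ℂ) * G ξ) 2 :=
    ⟨aestronglyMeasurable_weight_mul s hGm, lt_top_iff_ne_top.mpr hG⟩
  have h2 : MemLp (fun ξ => ((weight (-s) ξ : ℝ) : ℂ) * f ξ) 2 := by
    have := (SchwartzMap.smulLeftCLM ℂ (fun ξ : ℝ => ((weight (-s) ξ : ℝ) : ℂ)) f).memLp 2 volume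
    refine this.congr_norm ?_ (.of_forall fun ξ => ?_)
    · exact aestronglyMeasurable_weight_mul (-s) f.continuous.aestronglyMeasurable
    · rw [SchwartzMap.smulLeftCLM_apply_apply (weight_hasTemperateGrowth (-s))]; rfl
  refine (h1.integrable_mul h2).congr (.of_forall fun ξ => ?_)
  have : ((weight s ξ : ℝ) : ℂ) * ((weight (-s) ξ : ℝ) : ℂ) = 1 := by
    rw [← Complex.ofReal_mul, weight_mul_neg, Complex.ofReal_one]
  change (weight s ξ : ℂ) * G ξ * (((weight (-s) ξ : ℝ) : ℂ) * f ξ) = G ξ * f ξ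
  linear_combination (G ξ * f ξ) * this

theorem HalfBound.add {s : ℝ} {u v : 𝓓(halfLine, ℂ) → ℂ} {A B : ℝ≥0∞}
    (hu : HalfBound s u A) (hv : HalfBound s v B) (hA : A ≠ ⊤) (hB : B ≠ ⊤) :
    HalfBound s (fun θ => u θ + v θ) (A + B) := by
  obtain ⟨G, hGm, hG, hu⟩ := hu
  obtain ⟨H, hHm, hH, hv⟩ := hv
  refine ⟨fun ξ => G ξ + H ξ, hGm.add hHm, ?_, fun θ => ?_⟩
  · refine le_trans (le_of_eq ?_) ((eLpNorm_add_le (aestronglyMeasurable_weight_mul s hGm)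
      (aestronglyMeasurable_weight_mul s hHm) one_le_two).trans (add_le_add hG hH))
    congr 1; ext ξ; exact mul_add _ _ _
  · change u θ + v θ = _
    rw [hu, hv, ← integral_add
      (integrable_mul_schwartz hGm (ne_top_of_le_ne_top hA hG) _)
      (integrable_mul_schwartz hHm (ne_top_of_le_ne_top hB hH) _)]
    simp only [add_mul]

theorem HalfBound.const_mul {s : ℝ} {u : 𝓓(halfLine, ℂ) → ℂ} {A : ℝ≥0∞}
    (hu : HalfBound s u A) (c : ℂ) : HalfBound s (fun θ => c * u θ) (‖c‖ₑ * A) := by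
  obtain ⟨G, hGm, hG, hu⟩ := hu
  refine ⟨fun ξ => c * G ξ, hGm.const_mul c, ?_, fun θ => ?_⟩
  · refine le_trans (le_of_eq ?_) (mul_le_mul_right hG ‖c‖ₑ)
    rw [← eLpNorm_const_smul]
    congr 1; ext ξ; simp; ring
  · simp only [hu, mul_assoc, integral_const_mul]

theorem HalfBound.mono {s : ℝ} {u : 𝓓(halfLine, ℂ) → ℂ} {A B : ℝ≥0∞}
    (hu : HalfBound s u A) (h : A ≤ B) : HalfBound s u B := by
  obtain ⟨G, hGm, hG, hu⟩ := hu
  exact ⟨G, hGm, hG.trans h, hu⟩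

/-! ### Superpositions of decaying exponentials as Fourier integrals. -/

/-- The kernel which represents `e^{i(p + iq)x}` for `x > 0`. -/
def expKernel (m : ℕ) (p q ξ : ℝ) : ℂ :=
  (q : ℂ)⁻¹ * (𝓕 (expExtMoment m)) ((ξ - p / (2 * Real.pi)) / q)

/-- The inverse transform of the kernel is e^{ipx} times the Schwartz extension evaluated at qx. It
equals e^{i(p+iq)x} for x > 0, and the test function vanishes for x ≤ 0. -/
theorem expPairing_eq_integral_expKernel (m : ℕ) (p : ℝ) {q : ℝ} (hq : 0 < q)
    (θ : 𝓓(halfLine, ℂ)) : expPairing θ (p + Complex.I * q) =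
      ∫ ξ, expKernel m p q ξ * (𝓕⁻ (testToSchwartz θ)) ξ := by
  have hB : Integrable (expKernel m p q) :=
    (((𝓕 (expExtMoment m)).integrable.comp_div hq.ne').comp_sub_right _).const_mul _
  have key : ∀ x : ℝ, 𝓕⁻ (expKernel m p q) x = Complex.exp (Complex.I * p * x) *
      expExtMoment m (q * x) := by
    intro x
    set g : ℝ → ℂ := fun η => Complex.exp (2 * Real.pi * Complex.I * η * (q * x)) *
      (𝓕 (expExtMoment m)) η with hg
    have h1 : ∫ η, g η = expExtMoment m (q * x) := by
      have : expExtMoment m (q * x) = (𝓕⁻ (𝓕 (expExtMoment m))) (q * x) := by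
        rw [FourierTransform.fourierInv_fourier_eq]
      rw [this, SchwartzMap.fourierInv_coe, Real.fourierInv_eq']
      refine integral_congr_ae (.of_forall fun η => ?_)
      simp only [hg, smul_eq_mul]
      congr 2
      simp; ring
    have h2 := integral_sub_right_eq_self (μ := volume) (fun ξ => g (ξ / q)) (p / (2 * Real.pi))
    rw [Measure.integral_comp_div, h1, abs_of_pos hq] at h2
    rw [Real.fourierInv_eq']
    have h3 : ∀ ξ : ℝ, Complex.exp (((2 * Real.pi * inner ℝ ξ x : ℝ) : ℂ) * Complex.I) •
        expKernel m p q ξ = (Complex.exp (Complex.I * p * x) * (q : ℂ)⁻¹) *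
          g ((ξ - p / (2 * Real.pi)) / q) := by
      intro ξ
      have hq' : (q : ℂ) ≠ 0 := by exact_mod_cast hq.ne'
      have hp' : (Real.pi : ℂ) ≠ 0 := by exact_mod_cast Real.pi_ne_zero
      have : Complex.exp (((2 * Real.pi * inner ℝ ξ x : ℝ) : ℂ) * Complex.I) =
          Complex.exp (Complex.I * p * x) * Complex.exp (2 * Real.pi * Complex.I *
            (((ξ - p / (2 * Real.pi)) / q : ℝ) : ℂ) * (q * x)) := by
        rw [← Complex.exp_add]
        congr 1
        simp
        field_simp
        ring
      rw [this, expKernel, hg, smul_eq_mul]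
      ring
    simp only [h3]
    rw [integral_const_mul, h2]
    rw [Complex.real_smul]
    have hq' : (q : ℂ) ≠ 0 := by exact_mod_cast hq.ne'
    field_simp
  have := integral_mul_fourierInv_eq hB (testToSchwartz θ).integrable
  rw [← SchwartzMap.fourierInv_coe] at this
  rw [this, expPairing]
  refine integral_congr_ae (.of_forall fun x => ?_)
  change _ = 𝓕⁻ (expKernel m p q) x * θ x
  rcases le_or_gt x 0 with hx | hx
  · simp [test_apply_of_nonpos θ hx]
  · rw [key, expExtMoment_apply m (by positivity), ← Complex.exp_add]
    have : Complex.I * (p + Complex.I * q) * x = Complex.I * p * x + -((q * x : ℝ) : ℂ) := by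
      push_cast
      linear_combination (q * x : ℂ) * Complex.I_sq
    rw [← this]

theorem measurable_expKernel (m : ℕ) {p q : ℝ → ℝ} (hp : Measurable p) (hq : Measurable q) :
    Measurable fun z : ℝ × ℝ => expKernel m (p z.2) (q z.2) z.1 := by
  have h : Measurable (fun y => (𝓕 (expExtMoment m)) y) := (𝓕 (expExtMoment m)).continuous.measurable
  unfold expKernel
  fun_prop

/-- The hypothesis, with absolute values inside, serves twice: it bounds the density obtained by
integrating the kernels in r, and by Cauchy–Schwarz against a Schwartz function it gives the
absolute convergence needed to exchange the integrals. -/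
theorem HalfBound.of_expKernel {s : ℝ} (m : ℕ) {p q : ℝ → ℝ} {A : ℝ → ℂ} (hp : Measurable p)
    (hq : Measurable q) (hA : Measurable A) {S : Set ℝ} (hS : MeasurableSet S)
    (hq0 : ∀ r ∈ S, 0 < q r) {B : ℝ≥0∞} (hB : B ≠ ⊤)
    (h : ∫⁻ ξ, (∫⁻ r in S, ‖(weight s ξ : ℂ) * expKernel m (p r) (q r) ξ * A r‖ₑ) ^ 2 ≤ B ^ 2) :
    HalfBound s (fun θ => ∫ r in S, expPairing θ (p r + Complex.I * q r) * A r) B := by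
  have hK := measurable_expKernel m hp hq
  have hKA : Measurable fun z : ℝ × ℝ => expKernel m (p z.2) (q z.2) z.1 * A z.2 :=
    hK.mul (hA.comp measurable_snd)
  set N : ℝ → ℝ≥0∞ := fun ξ => ∫⁻ r in S, ‖(weight s ξ : ℂ) * expKernel m (p r) (q r) ξ * A r‖ₑ
  have hW : Measurable fun ξ : ℝ => (weight s ξ : ℂ) :=
    (Complex.continuous_ofReal.comp (continuous_weight s)).measurable
  have hN : Measurable N := by
    refine Measurable.lintegral_prod_right' (f := fun z : ℝ × ℝ =>
      ‖(weight s z.1 : ℂ) * expKernel m (p z.2) (q z.2) z.1 * A z.2‖ₑ) ?_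
    exact (((hW.comp measurable_fst).mul hK).mul (hA.comp measurable_snd)).enorm
  have hGm : AEStronglyMeasurable fun ξ => ∫ r in S, expKernel m (p r) (q r) ξ * A r :=
    (hKA.stronglyMeasurable.integral_prod_right (ν := volume.restrict S)).aestronglyMeasurable
  refine ⟨fun ξ => ∫ r in S, expKernel m (p r) (q r) ξ * A r, hGm, ?_, fun θ => ?_⟩
  · refine eLpNorm_two_le ((lintegral_mono fun ξ => ?_).trans h)
    gcongr
    rw [← integral_const_mul]
    refine (enorm_integral_le_lintegral_enorm _).trans (le_of_eq ?_)
    simp only [mul_assoc]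
  · set f := 𝓕⁻ (testToSchwartz θ)
    have hfin : ∫⁻ ξ, ∫⁻ r in S, ‖expKernel m (p r) (q r) ξ * A r * f ξ‖ₑ < ⊤ := by
      have h1 : ∀ ξ, ∫⁻ r in S, ‖expKernel m (p r) (q r) ξ * A r * f ξ‖ₑ =
          N ξ * ‖((weight (-s) ξ : ℝ) : ℂ) * f ξ‖ₑ := by
        intro ξ
        rw [← lintegral_mul_const']
        · refine lintegral_congr fun r => ?_
          rw [← enorm_mul]
          congr 1
          have : ((weight s ξ : ℝ) : ℂ) * ((weight (-s) ξ : ℝ) : ℂ) = 1 := by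
            rw [← Complex.ofReal_mul, weight_mul_neg, Complex.ofReal_one]
          linear_combination (-(expKernel m (p r) (q r) ξ * A r * f ξ)) * this
        · exact enorm_ne_top
      simp only [h1]
      have h2 : MemLp (fun ξ => ((weight (-s) ξ : ℝ) : ℂ) * f ξ) 2 := by
        have := (SchwartzMap.smulLeftCLM ℂ
          (fun ξ : ℝ => ((weight (-s) ξ : ℝ) : ℂ)) f).memLp 2 volume
        refine this.congr_norm ?_ (.of_forall fun ξ => ?_)
        · exact aestronglyMeasurable_weight_mul (-s) f.continuous.aestronglyMeasurable
        · rw [SchwartzMap.smulLeftCLM_apply_apply (weight_hasTemperateGrowth (-s))]; rfl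
      have h3 := ENNReal.lintegral_mul_le_Lp_mul_Lq volume Real.HolderConjugate.two_two
        hN.aemeasurable h2.1.enorm
      refine h3.trans_lt (ENNReal.mul_lt_top ?_ ?_)
      · refine ENNReal.rpow_lt_top_of_nonneg (by norm_num) ?_
        simp only [ENNReal.rpow_two]
        exact ne_top_of_le_ne_top (ENNReal.pow_ne_top hB) h
      · refine ENNReal.rpow_lt_top_of_nonneg (by norm_num) ?_
        simp only [ENNReal.rpow_two]
        rw [← eLpNorm_two_sq]
        exact ENNReal.pow_ne_top h2.2.ne
    have hint : Integrable (Function.uncurry fun ξ r => expKernel m (p r) (q r) ξ * A r * f ξ)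
        (volume.prod (volume.restrict S)) := by
      have hm : Measurable (Function.uncurry fun ξ r => expKernel m (p r) (q r) ξ * A r * f ξ) :=
        hKA.mul (f.continuous.measurable.comp measurable_fst)
      refine ⟨hm.aestronglyMeasurable, ?_⟩
      rw [hasFiniteIntegral_iff_enorm, lintegral_prod _ hm.enorm.aemeasurable]
      exact hfin
    have hswap := integral_integral_swap hint
    calc ∫ r in S, expPairing θ (p r + Complex.I * q r) * A r
        = ∫ r in S, ∫ ξ, expKernel m (p r) (q r) ξ * A r * f ξ := by
          refine setIntegral_congr_fun hS fun r hr => ?_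
          rw [expPairing_eq_integral_expKernel m (p r) (hq0 r hr) θ, ← integral_mul_const]
          refine integral_congr_ae (.of_forall fun ξ => ?_)
          change _ * f ξ * A r = _
          ring
      _ = ∫ ξ, ∫ r in S, expKernel m (p r) (q r) ξ * A r * f ξ := hswap.symm
      _ = _ := by
          refine integral_congr_ae (.of_forall fun ξ => ?_)
          exact integral_mul_const _ _

/-! ### Bounds on the pieces of the contour -/

/-- Cauchy–Schwarz with the splitting h² ≤ uv left free; the Schur test and the arc estimate choose
different splittings. -/
theorem lintegral_sq_le_mul {α : Type*} [MeasurableSpace α] {μ : Measure α} {h u v : α → ℝ≥0∞}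
    (hu : AEMeasurable u μ) (hv : AEMeasurable v μ) (huv : ∀ᵐ x ∂μ, h x ^ 2 ≤ u x * v x) :
    (∫⁻ x, h x ∂μ) ^ 2 ≤ (∫⁻ x, u x ∂μ) * ∫⁻ x, v x ∂μ := by
  have h1 : ∫⁻ x, h x ∂μ ≤ ∫⁻ x, ((fun x => u x ^ (1 / 2 : ℝ)) * fun x => v x ^ (1 / 2 : ℝ)) x ∂μ := by
    refine lintegral_mono_ae (huv.mono fun x hx => ?_)
    have := ENNReal.rpow_le_rpow hx (z := 1 / 2) (by norm_num)
    rw [← ENNReal.rpow_natCast, ← ENNReal.rpow_mul, ENNReal.mul_rpow_of_nonneg _ _ (by norm_num)]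
      at this
    simpa using this
  have h2 := h1.trans (ENNReal.lintegral_mul_le_Lp_mul_Lq μ Real.HolderConjugate.two_two
    (hu.pow_const _) (hv.pow_const _))
  refine (pow_le_pow_left₀ (zero_le) h2 2).trans (le_of_eq ?_)
  rw [mul_pow]
  simp only [← ENNReal.rpow_mul, ← ENNReal.rpow_natCast]
  simp

/-- The Schur test. -/
theorem lintegral_schur {α β : Type*} [MeasurableSpace α] [MeasurableSpace β] {μ : Measure α}
    {ν : Measure β} [SFinite μ] [SFinite ν] {K : α → β → ℝ≥0∞} {A p : β → ℝ≥0∞} {q : α → ℝ≥0∞}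
    (hK : Measurable (Function.uncurry K)) (hA : Measurable A) (hp : Measurable p)
    (hq : Measurable q) (hp0 : ∀ᵐ r ∂ν, p r ≠ 0 ∧ p r ≠ ⊤) {C D : ℝ≥0∞}
    (h1 : ∀ᵐ ξ ∂μ, ∫⁻ r, K ξ r * p r ∂ν ≤ C * q ξ) (h2 : ∀ᵐ r ∂ν, ∫⁻ ξ, K ξ r * q ξ ∂μ ≤ D * p r) :
    ∫⁻ ξ, (∫⁻ r, K ξ r * A r ∂ν) ^ 2 ∂μ ≤ C * D * ∫⁻ r, A r ^ 2 ∂ν := by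
  have hKr : ∀ ξ, Measurable (K ξ) := fun ξ => hK.comp measurable_prodMk_left
  have hKx : ∀ r, Measurable fun ξ => K ξ r := fun r => hK.comp measurable_prodMk_right
  calc ∫⁻ ξ, (∫⁻ r, K ξ r * A r ∂ν) ^ 2 ∂μ
      ≤ ∫⁻ ξ, ∫⁻ r, C * (q ξ * (K ξ r * ((p r)⁻¹ * A r ^ 2))) ∂ν ∂μ := by
        refine lintegral_mono_ae (h1.mono fun ξ hξ => ?_)
        refine (lintegral_sq_le_mul (u := fun r => K ξ r * p r)
          (v := fun r => K ξ r * ((p r)⁻¹ * A r ^ 2)) ((hKr ξ).mul hp).aemeasurable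
          ((hKr ξ).mul (hp.inv.mul (hA.pow_const 2))).aemeasurable ?_).trans ?_
        · refine hp0.mono fun r hr => le_of_eq ?_
          calc (K ξ r * A r) ^ 2 = K ξ r * K ξ r * A r ^ 2 * 1 := by ring
            _ = K ξ r * K ξ r * A r ^ 2 * (p r * (p r)⁻¹) := by
              rw [ENNReal.mul_inv_cancel hr.1 hr.2]
            _ = _ := by ring
        · have hm : Measurable fun r => K ξ r * ((p r)⁻¹ * A r ^ 2) :=
            (hKr ξ).mul (hp.inv.mul (hA.pow_const 2))
          rw [lintegral_const_mul _ (hm.const_mul _), lintegral_const_mul _ hm, ← mul_assoc]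
          gcongr
    _ = ∫⁻ r, ∫⁻ ξ, C * (q ξ * (K ξ r * ((p r)⁻¹ * A r ^ 2))) ∂μ ∂ν := by
        refine lintegral_lintegral_swap (Measurable.aemeasurable ?_)
        have : Measurable fun z : α × β => K z.1 z.2 := hK
        exact ((hq.comp measurable_fst).mul (this.mul ((hp.comp measurable_snd).inv.mul
          ((hA.comp measurable_snd).pow_const 2)))).const_mul C
    _ ≤ ∫⁻ r, C * D * A r ^ 2 ∂ν := by
        refine lintegral_mono_ae ?_
        filter_upwards [h2, hp0] with r hr hr0
        calc ∫⁻ ξ, C * (q ξ * (K ξ r * ((p r)⁻¹ * A r ^ 2))) ∂μ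
            = ∫⁻ ξ, C * ((p r)⁻¹ * A r ^ 2) * (K ξ r * q ξ) ∂μ := by congr 1; ext ξ; ring
          _ = C * ((p r)⁻¹ * A r ^ 2) * ∫⁻ ξ, K ξ r * q ξ ∂μ :=
            lintegral_const_mul _ ((hKx r).mul hq)
          _ ≤ C * ((p r)⁻¹ * A r ^ 2) * (D * p r) := by gcongr
          _ = C * D * A r ^ 2 * (p r * (p r)⁻¹) := by ring
          _ = _ := by rw [ENNReal.mul_inv_cancel hr0.1 hr0.2, mul_one]
    _ = _ := lintegral_const_mul _ (hA.pow_const 2)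

/-- Split at r = y, bounding 1/(y+r) by 1/y below and by 1/r above; each half contributes 2y^{-1/2}.
-/
theorem lintegral_hilbert_kernel {y : ℝ} (hy : 0 < y) :
    ∫⁻ r in Ioi 0, ENNReal.ofReal ((y + r)⁻¹) * ENNReal.ofReal (r ^ (-(1 / 2) : ℝ)) ≤
      ENNReal.ofReal (4 * y ^ (-(1 / 2) : ℝ)) := by
  have hle : ∀ r : ℝ, 0 < r → ENNReal.ofReal ((y + r)⁻¹) * ENNReal.ofReal (r ^ (-(1 / 2) : ℝ)) ≤
      ENNReal.ofReal (y⁻¹ * r ^ (-(1 / 2) : ℝ)) ∧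
      ENNReal.ofReal ((y + r)⁻¹) * ENNReal.ofReal (r ^ (-(1 / 2) : ℝ)) ≤
      ENNReal.ofReal (r ^ (-(3 / 2) : ℝ)) := by
    intro r hr
    rw [← ENNReal.ofReal_mul (by positivity)]
    constructor
    · gcongr; linarith
    · have : r ^ (-(3 / 2) : ℝ) = r⁻¹ * r ^ (-(1 / 2) : ℝ) := by
        rw [← Real.rpow_neg_one, ← Real.rpow_add hr]; norm_num
      rw [this]
      gcongr; linarith
  have hi1 : IntegrableOn (fun r : ℝ => y⁻¹ * r ^ (-(1 / 2) : ℝ)) (Ioc 0 y) := by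
    have := intervalIntegral.intervalIntegrable_rpow' (a := 0) (b := y) (r := -(1 / 2))
      (by norm_num)
    exact ((intervalIntegrable_iff_integrableOn_Ioc_of_le hy.le).mp this).const_mul _
  have hi2 : IntegrableOn (fun r : ℝ => r ^ (-(3 / 2) : ℝ)) (Ioi y) :=
    integrableOn_Ioi_rpow_of_lt (by norm_num) hy
  have e1 : ∫⁻ r in Ioc 0 y, ENNReal.ofReal (y⁻¹ * r ^ (-(1 / 2) : ℝ)) =
      ENNReal.ofReal (2 * y ^ (-(1 / 2) : ℝ)) := by
    rw [← ofReal_integral_eq_lintegral_ofReal hi1]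
    · congr 1
      rw [integral_const_mul, ← intervalIntegral.integral_of_le hy.le, integral_rpow (by norm_num)]
      norm_num
      have : y ^ (-(1 / 2) : ℝ) = y⁻¹ * y ^ (1 / 2 : ℝ) := by
        rw [← Real.rpow_neg_one, ← Real.rpow_add hy]; norm_num
      rw [this]; ring
    · exact (ae_restrict_mem measurableSet_Ioc).mono fun r hr =>
        mul_nonneg (inv_nonneg.mpr hy.le) (Real.rpow_nonneg hr.1.le _)
  have e2 : ∫⁻ r in Ioi y, ENNReal.ofReal (r ^ (-(3 / 2) : ℝ)) =
      ENNReal.ofReal (2 * y ^ (-(1 / 2) : ℝ)) := by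
    rw [← ofReal_integral_eq_lintegral_ofReal hi2]
    · congr 1
      rw [integral_Ioi_rpow_of_lt (by norm_num) hy]
      norm_num
      ring
    · exact (ae_restrict_mem measurableSet_Ioi).mono fun r hr =>
        Real.rpow_nonneg (hy.trans hr).le _
  have hnn : 0 ≤ 2 * y ^ (-(1 / 2) : ℝ) := by positivity
  rw [← Ioc_union_Ioi_eq_Ioi hy.le]
  refine (lintegral_union_le _ _ _).trans ?_
  have : 4 * y ^ (-(1 / 2) : ℝ) = 2 * y ^ (-(1 / 2) : ℝ) + 2 * y ^ (-(1 / 2) : ℝ) := by ring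
  rw [this, ENNReal.ofReal_add hnn hnn, ← e1]
  nth_rw 2 [e1]
  rw [← e2]
  exact add_le_add (setLIntegral_mono' measurableSet_Ioc fun r hr => (hle r hr.1).1)
    (setLIntegral_mono' measurableSet_Ioi fun r hr => (hle r (hy.trans hr)).2)

theorem lintegral_abs (f : ℝ → ℝ≥0∞) : ∫⁻ x, f |x| = 2 * ∫⁻ x in Ioi 0, f x := by
  have h1 : ∫⁻ x in Ioi (0 : ℝ), f |x| = ∫⁻ x in Ioi 0, f x :=
    setLIntegral_congr_fun measurableSet_Ioi fun x (hx : 0 < x) => by simp only [abs_of_pos hx]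
  have h2 : ∫⁻ x in Iio (0 : ℝ), f |x| = ∫⁻ x in Ioi 0, f |x| := by
    have := (Measure.measurePreserving_neg (volume : Measure ℝ)).setLIntegral_comp_preimage_emb
      (MeasurableEquiv.neg ℝ).measurableEmbedding (fun x => f |x|) (Iio 0)
    rw [← this]
    simp
  rw [← lintegral_add_compl (fun x => f |x|) (measurableSet_Ioi (a := (0 : ℝ))), compl_Ioi,
    ← setLIntegral_congr (Iio_ae_eq_Iic (a := (0 : ℝ))), h2, h1, two_mul]

/-- On this ray the exponentials are e^{-rx}. With the weights r^s and that of order s absorbed, the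
kernel is dominated by 1/(|ξ|+r), which is bounded on L² by the Schur test with r^{-1/2} and
|ξ|^{-1/2}. -/
theorem HalfBound.imag_ray (s : ℝ) : ∃ C : ℝ, ∀ a : ℝ, 1 ≤ a → ∀ A : ℝ → ℂ, Measurable A →
    ∀ B : ℝ≥0∞, B ≠ ⊤ → ∫⁻ r in Ioi a, (ENNReal.ofReal (r ^ s) * ‖A r‖ₑ) ^ 2 ≤ B ^ 2 →
    HalfBound s (fun θ => ∫ r in Ioi a, expPairing θ (Complex.I * r) * A r)
      (ENNReal.ofReal C * B) := by
  obtain ⟨m, C, hC, hk⟩ := exists_expExt_kernel_bound s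
  -- The Schur constants are 4 in r and 8 in ξ, which runs over two half-lines, and 4 · 8 ≤ 8².
  refine ⟨8 * C, fun a ha A hA B hB h => ?_⟩
  have key := HalfBound.of_expKernel (s := s) m (p := fun _ => 0) (q := fun r => r) (A := A)
    measurable_const measurable_id hA (S := Ioi a) measurableSet_Ioi
    (fun r hr => by have : a < r := hr; linarith) (B := ENNReal.ofReal (8 * C) * B)
    (ENNReal.mul_ne_top ENNReal.ofReal_ne_top hB) ?_
  · simpa using key
  have hrm : Measurable fun r : ℝ => ENNReal.ofReal (r ^ s) * ‖A r‖ₑ := by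
    have := hA.enorm
    fun_prop
  have schur := lintegral_schur (μ := volume) (ν := volume.restrict (Ioi a))
    (K := fun ξ r : ℝ => ENNReal.ofReal ((|ξ| + r)⁻¹))
    (A := fun r => ENNReal.ofReal (r ^ s) * ‖A r‖ₑ)
    (p := fun r => ENNReal.ofReal (r ^ (-(1 / 2) : ℝ)))
    (q := fun ξ => ENNReal.ofReal (|ξ| ^ (-(1 / 2) : ℝ))) (C := 4) (D := 8)
    (by unfold Function.uncurry; fun_prop) hrm (by fun_prop) (by fun_prop)
    ((ae_restrict_mem measurableSet_Ioi).mono fun r hr => by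
      have : 0 < r := by have : a < r := hr; linarith
      exact ⟨by simpa using Real.rpow_pos_of_pos this _, ENNReal.ofReal_ne_top⟩) ?_ ?_
  · calc _ ≤ ∫⁻ ξ, (ENNReal.ofReal C * ∫⁻ r in Ioi a, ENNReal.ofReal ((|ξ| + r)⁻¹) *
          (ENNReal.ofReal (r ^ s) * ‖A r‖ₑ)) ^ 2 := by
          refine lintegral_mono fun ξ => ?_
          have hm : Measurable fun r : ℝ => ENNReal.ofReal ((|ξ| + r)⁻¹) *
              (ENNReal.ofReal (r ^ s) * ‖A r‖ₑ) := by
            have : Measurable fun r : ℝ => ENNReal.ofReal ((|ξ| + r)⁻¹) := by fun_prop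
            exact this.mul hrm
          rw [← lintegral_const_mul _ hm]
          refine pow_le_pow_left₀ zero_le (setLIntegral_mono' measurableSet_Ioi fun r hr => ?_) 2
          have hr1 : 1 ≤ r := ha.trans (le_of_lt hr)
          have hr0 : 0 < r := by linarith
          rw [enorm_mul, ← mul_assoc, ← mul_assoc, ← ENNReal.ofReal_mul hC,
            ← ENNReal.ofReal_mul (by positivity)]
          gcongr
          rw [← ofReal_norm]
          refine ENNReal.ofReal_le_ofReal ?_
          have := hk ξ r hr1
          rw [norm_mul, expKernel, norm_mul, norm_inv, Complex.norm_real, Complex.norm_real,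
            Real.norm_of_nonneg (weight_pos _ _).le, Real.norm_of_nonneg hr0.le, zero_div, sub_zero]
          calc _ = _ := by ring
            _ ≤ _ := this
            _ = _ := by ring
      _ = ENNReal.ofReal C ^ 2 * ∫⁻ ξ, (∫⁻ r in Ioi a, ENNReal.ofReal ((|ξ| + r)⁻¹) *
          (ENNReal.ofReal (r ^ s) * ‖A r‖ₑ)) ^ 2 := by
          simp only [mul_pow]
          rw [lintegral_const_mul' _ _ (ENNReal.pow_ne_top ENNReal.ofReal_ne_top)]
      _ ≤ ENNReal.ofReal C ^ 2 * (4 * 8 * B ^ 2) := by gcongr; exact schur.trans (by gcongr)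
      _ = 32 * (ENNReal.ofReal C ^ 2 * B ^ 2) := by ring
      _ ≤ 64 * (ENNReal.ofReal C ^ 2 * B ^ 2) := by gcongr; norm_num
      _ = _ := by
        rw [ENNReal.ofReal_mul (by norm_num), mul_pow, mul_pow]
        norm_num; ring
  · have h0 : ∀ᵐ ξ : ℝ, ξ ≠ 0 := by simp [ae_iff]
    filter_upwards [h0] with ξ hξ
    have hξ : 0 < |ξ| := abs_pos.mpr hξ
    refine (lintegral_mono_set (Ioi_subset_Ioi (by linarith : (0 : ℝ) ≤ a))).trans
      ((lintegral_hilbert_kernel hξ).trans (le_of_eq ?_))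
    rw [ENNReal.ofReal_mul (by norm_num)]; norm_num
  · refine (ae_restrict_mem measurableSet_Ioi).mono fun r hr => ?_
    have hr : 0 < r := by have : a < r := hr; linarith
    rw [lintegral_abs (fun x => ENNReal.ofReal ((x + r)⁻¹) * ENNReal.ofReal (x ^ (-(1 / 2) : ℝ)))]
    simp only [add_comm _ r]
    refine (mul_le_mul_right (lintegral_hilbert_kernel hr) 2).trans (le_of_eq ?_)
    rw [ENNReal.ofReal_mul (by norm_num), ← mul_assoc]; norm_num

theorem lintegral_comp_mul_left (f : ℝ → ℝ≥0∞) (hf : Measurable f) {c : ℝ} (hc : c ≠ 0) :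
    ∫⁻ x, f (c * x) = ENNReal.ofReal |c⁻¹| * ∫⁻ x, f x := by
  rw [← lintegral_map hf (measurable_const_mul c), Real.map_volume_mul_left hc,
    lintegral_smul_measure, smul_eq_mul]

theorem rpow_eq_sq_rpow {r : ℝ} (hr : 0 < r) (s : ℝ) : r ^ s = (r ^ 2) ^ (s / 2) := by
  rw [← Real.rpow_natCast r 2, ← Real.rpow_mul hr.le]; congr 1; push_cast; ring

theorem exists_japanese_le (s : ℝ) : ∃ C : ℝ, 0 < C ∧ ∀ r : ℝ, 1 ≤ r →
    (1 + r ^ 2) ^ (s / 2) ≤ C * r ^ s ∧ r ^ s ≤ C * (1 + r ^ 2) ^ (s / 2) := by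
  refine ⟨2 ^ (|s| / 2), by positivity, fun r hr => ?_⟩
  have h1 : 1 ≤ r ^ 2 := one_le_pow₀ hr
  have hC : (1 : ℝ) ≤ 2 ^ (|s| / 2) := Real.one_le_rpow (by norm_num) (by positivity)
  rw [rpow_eq_sq_rpow (by linarith : 0 < r) s]
  rcases le_total 0 s with hs | hs
  · rw [abs_of_nonneg hs, ← Real.mul_rpow (by norm_num) (by positivity)]
    refine ⟨Real.rpow_le_rpow (by positivity) (by linarith) (by linarith), ?_⟩
    refine (Real.rpow_le_rpow (by positivity) (by linarith : r ^ 2 ≤ 2 * (1 + r ^ 2))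
      (by linarith)).trans (le_of_eq ?_)
    rw [Real.mul_rpow (by norm_num) (by positivity)]
  · constructor
    · refine (Real.rpow_le_rpow_of_nonpos (by positivity) (by linarith : r ^ 2 ≤ 1 + r ^ 2)
        (by linarith)).trans ?_
      exact le_mul_of_one_le_left (by positivity) hC
    · have : (2 : ℝ) ^ (|s| / 2) = (1 / 2 : ℝ) ^ (s / 2) := by
        rw [one_div, Real.inv_rpow (by norm_num), ← Real.rpow_neg (by norm_num), abs_of_nonpos hs,
          neg_div]
      rw [this, ← Real.mul_rpow (by norm_num) (by positivity)]
      exact Real.rpow_le_rpow_of_nonpos (by positivity) (by linarith) (by linarith)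

/-- For real k the integral is already an inverse Fourier transform, so the density is A itself,
extended by zero and rescaled by k = 2πξ; the bound is Plancherel. -/
theorem HalfBound.real_ray (s : ℝ) : ∃ C : ℝ, ∀ ε : ℝ, (ε = 1 ∨ ε = -1) → ∀ a : ℝ, 1 ≤ a →
    ∀ A : ℝ → ℂ, Measurable A →
    ∀ B : ℝ≥0∞, ∫⁻ r in Ioi a, (ENNReal.ofReal (r ^ s) * ‖A r‖ₑ) ^ 2 ≤ B ^ 2 →
    HalfBound s (fun θ => ∫ r in Ioi a, expPairing θ (ε * r) * A r) (ENNReal.ofReal C * B) := by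
  obtain ⟨C, hC, hw⟩ := exists_japanese_le s
  refine ⟨2 * Real.pi * C, fun ε hε a ha A hA B h => ?_⟩
  have hπ := Real.pi_pos
  have hεε : ε * ε = 1 := by rcases hε with rfl | rfl <;> norm_num
  have hc : 2 * Real.pi * ε ≠ 0 := by rcases hε with rfl | rfl <;> simp [Real.pi_ne_zero]
  have habs : |(2 * Real.pi * ε)⁻¹| = (2 * Real.pi)⁻¹ := by
    rcases hε with rfl | rfl <;> simp [abs_of_pos hπ]
  have hgm : Measurable ((Ioi a).indicator A) := hA.indicator measurableSet_Ioi
  refine ⟨fun ξ => 2 * Real.pi * (Ioi a).indicator A (2 * Real.pi * ε * ξ),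
    ((hgm.comp (measurable_const_mul _)).const_mul _).aestronglyMeasurable, ?_, fun θ => ?_⟩
  · set F : ℝ → ℝ≥0∞ := (Ioi a).indicator fun r =>
      ENNReal.ofReal (2 * Real.pi * C) ^ 2 * (ENNReal.ofReal (r ^ s) * ‖A r‖ₑ) ^ 2 with hF
    have hFm : Measurable F := by
      refine Measurable.indicator ?_ measurableSet_Ioi
      have := hA.enorm
      fun_prop
    refine eLpNorm_two_le ((lintegral_mono (g := fun ξ => F (2 * Real.pi * ε * ξ))
      fun ξ => ?_).trans ?_)
    · change ‖(weight s ξ : ℂ) * (2 * Real.pi * (Ioi a).indicator A (2 * Real.pi * ε * ξ))‖ₑ ^ 2 ≤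
        F (2 * Real.pi * ε * ξ)
      by_cases hr : 2 * Real.pi * ε * ξ ∈ Ioi a
      · rw [hF, indicator_of_mem hr, indicator_of_mem hr]
        set r := 2 * Real.pi * ε * ξ with hr'
        have hr1 : 1 ≤ r := ha.trans (le_of_lt hr)
        rw [← mul_pow, ← mul_assoc, enorm_mul, ← mul_assoc (ENNReal.ofReal _),
          ← ENNReal.ofReal_mul (by positivity)]
        gcongr
        rw [← ofReal_norm]
        refine ENNReal.ofReal_le_ofReal ?_
        have h2 : weight s ξ = (1 + r ^ 2) ^ (s / 2) := by
          rw [weight, hr']; congr 2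
          linear_combination (-(2 * Real.pi * ξ) ^ 2) * hεε
        rw [norm_mul, norm_mul, Complex.norm_real, h2, Complex.norm_real,
          Real.norm_of_nonneg (by positivity), Real.norm_of_nonneg hπ.le, Complex.norm_ofNat]
        nlinarith [(hw r hr1).1]
      · rw [indicator_of_notMem hr]; simp
    · rw [lintegral_comp_mul_left F hFm hc, habs, hF, lintegral_indicator measurableSet_Ioi,
        lintegral_const_mul' _ _ (ENNReal.pow_ne_top ENNReal.ofReal_ne_top), mul_pow]
      refine (mul_le_mul' ?_ (by gcongr)).trans_eq (one_mul _)
      rw [ENNReal.ofReal_le_one]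
      exact inv_le_one_of_one_le₀ (by linarith [Real.pi_gt_three])
  · have h1 : ∀ ξ : ℝ, 2 * Real.pi * (Ioi a).indicator A (2 * Real.pi * ε * ξ) *
        (𝓕⁻ (testToSchwartz θ)) ξ = 2 * Real.pi *
        (Ioi a).indicator (fun r : ℝ => expPairing θ (ε * r) * A r) (2 * Real.pi * ε * ξ) := by
      intro ξ
      by_cases hr : 2 * Real.pi * ε * ξ ∈ Ioi a
      · rw [indicator_of_mem hr, indicator_of_mem hr, fourierInv_testToSchwartz]
        have : (ε : ℂ) * ((2 * Real.pi * ε * ξ : ℝ) : ℂ) = ((2 * Real.pi * ξ : ℝ) : ℂ) := by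
          rw [← Complex.ofReal_mul]; congr 1; linear_combination (2 * Real.pi * ξ) * hεε
        rw [this]; ring
      · rw [indicator_of_notMem hr, indicator_of_notMem hr]; simp
    simp only [h1]
    rw [integral_const_mul, Measure.integral_comp_mul_left
      (fun y => (Ioi a).indicator (fun r : ℝ => expPairing θ (ε * r) * A r) y) (2 * Real.pi * ε),
      habs, integral_indicator measurableSet_Ioi, Complex.real_smul, ← mul_assoc]
    have hp' : (Real.pi : ℂ) ≠ 0 := by exact_mod_cast Real.pi_ne_zero
    push_cast
    field_simp

theorem integrable_weight_neg_two : Integrable (weight (-2)) := by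
  have := (memLp_two_iff_integrable_sq (continuous_weight (-1)).aestronglyMeasurable).mp
    (memLp_weight_neg le_rfl)
  refine this.congr (.of_forall fun ξ => ?_)
  change weight (-1) ξ ^ 2 = _
  rw [sq, weight_mul]; norm_num

theorem lintegral_weight_comp_affine (p : ℝ) {q : ℝ} (hq : 0 < q) :
    ∫⁻ ξ, ENNReal.ofReal (weight (-2) ((ξ - p) / q)) =
      ENNReal.ofReal (q * ∫ ξ, weight (-2) ξ) := by
  have hi : Integrable fun ξ => weight (-2) ((ξ - p) / q) :=
    (integrable_weight_neg_two.comp_div hq.ne').comp_sub_right _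
  rw [← ofReal_integral_eq_lintegral_ofReal hi (.of_forall fun ξ => (weight_pos _ _).le)]
  congr 1
  rw [integral_sub_right_eq_self (fun ξ => weight (-2) (ξ / q)) p, Measure.integral_comp_div,
    abs_of_pos hq, smul_eq_mul]

/-- The kernel of e^{i(p+iq)x} has L² norm of order q^{-1/2}, because e^{-qx} does. Superposing
costs the integral of q^{-1/2} by Minkowski's inequality, obtained here from Cauchy–Schwarz with u =
q^{-1/2} and v carrying the remaining powers of q. -/
theorem HalfBound.arc (s R : ℝ) : ∃ C : ℝ, ∀ p q : ℝ → ℝ, Measurable p → Measurable q →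
    ∀ S : Set ℝ, MeasurableSet S → (∀ r ∈ S, 0 < q r ∧ q r ≤ R ∧ |p r| ≤ R) →
    ∀ J : ℝ, ∫⁻ r in S, ENNReal.ofReal (q r ^ (-(1 / 2) : ℝ)) ≤ ENNReal.ofReal J →
    ∀ A : ℝ → ℂ, Measurable A → ∀ M : ℝ≥0∞, M ≠ ⊤ → (∀ r ∈ S, ‖A r‖ₑ ≤ M) →
    HalfBound s (fun θ => ∫ r in S, expPairing θ (p r + Complex.I * q r) * A r)
      (ENNReal.ofReal (C * J) * M) := by
  -- Since p and q are bounded by R, the weight of order n at ξ is controlled by the weight at the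
  -- rescaled variable when n ≥ 0; negative orders are simply raised to 0.
  set n := max s 0 with hn
  have hn0 : 0 ≤ n := le_max_right _ _
  obtain ⟨C, hC, hk⟩ := exists_weight_mul_schwartz_le (𝓕 (expExtMoment 0)) (n + 1)
  set I := ∫ ξ, weight (-2) ξ with hI
  have hI0 : 0 ≤ I := integral_nonneg fun ξ => (weight_pos _ _).le
  set D := (1 + 2 * R ^ 2) ^ (n / 2) * C with hD
  have hD0 : 0 ≤ D := by positivity
  refine ⟨D * Real.sqrt I, fun p q hp hq S hS hpq J hJ A hA M hM hAM => ?_⟩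
  refine HalfBound.of_expKernel 0 hp hq hA hS (fun r hr => (hpq r hr).1)
    (ENNReal.mul_ne_top ENNReal.ofReal_ne_top hM) ?_
  have hpt : ∀ r ∈ S, ∀ ξ, ‖(weight s ξ : ℂ) * expKernel 0 (p r) (q r) ξ‖ ≤
      D * (q r)⁻¹ * weight (-1) ((ξ - p r / (2 * Real.pi)) / q r) := by
    intro r hr ξ
    obtain ⟨hq0, hqR, hpR⟩ := hpq r hr
    set η := (ξ - p r / (2 * Real.pi)) / q r with hη
    have hw : weight s ξ ≤ (1 + 2 * R ^ 2) ^ (n / 2) * weight n η := by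
      refine (weight_mono (le_max_left s 0) ξ).trans ?_
      rw [weight, weight, ← Real.mul_rpow (by positivity) (by positivity)]
      refine Real.rpow_le_rpow (by positivity) ?_ (by positivity)
      have e : 2 * Real.pi * ξ = p r + q r * (2 * Real.pi * η) := by
        rw [hη]; field_simp; ring
      rw [e]
      have h1 : p r ^ 2 ≤ R ^ 2 := sq_le_sq.mpr (hpR.trans (le_abs_self R))
      have h2 : (q r * (2 * Real.pi * η)) ^ 2 ≤ R ^ 2 * (2 * Real.pi * η) ^ 2 := by
        rw [mul_pow]; gcongr
      nlinarith [sq_nonneg (p r - q r * (2 * Real.pi * η)), sq_nonneg (2 * Real.pi * η)]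
    have h3 := hk η
    rw [← weight_mul] at h3
    have h4 : weight n η * ‖(𝓕 (expExtMoment 0)) η‖ ≤ C * weight (-1) η := by
      have := mul_le_mul_of_nonneg_right h3 (weight_pos (-1) η).le
      calc _ = weight n η * (weight 1 η * weight (-1) η) * ‖(𝓕 (expExtMoment 0)) η‖ := by
            rw [weight_mul_neg]; ring
        _ = _ := by ring
        _ ≤ _ := this
    rw [norm_mul, expKernel, norm_mul, norm_inv, Complex.norm_real, Complex.norm_real,
      Real.norm_of_nonneg (weight_pos _ _).le, Real.norm_of_nonneg hq0.le]
    calc _ ≤ (1 + 2 * R ^ 2) ^ (n / 2) * weight n η * ((q r)⁻¹ * ‖(𝓕 (expExtMoment 0)) η‖) := by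
          gcongr
      _ = (1 + 2 * R ^ 2) ^ (n / 2) * (q r)⁻¹ * (weight n η * ‖(𝓕 (expExtMoment 0)) η‖) := by ring
      _ ≤ (1 + 2 * R ^ 2) ^ (n / 2) * (q r)⁻¹ * (C * weight (-1) η) := by gcongr
      _ = _ := by rw [hD]; ring
  clear_value D
  have hKm := measurable_expKernel 0 hp hq
  have hwm : Measurable fun ξ : ℝ => ENNReal.ofReal (weight (-2) ξ) :=
    (continuous_weight (-2)).measurable.ennreal_ofReal
  set u : ℝ → ℝ≥0∞ := fun r => ENNReal.ofReal (q r ^ (-(1 / 2) : ℝ)) with hu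
  have hum : Measurable u := by rw [hu]; fun_prop
  set v : ℝ → ℝ → ℝ≥0∞ := fun ξ r => ENNReal.ofReal (D ^ 2 * (q r)⁻¹ ^ 2 * q r ^ (1 / 2 : ℝ)) *
    ENNReal.ofReal (weight (-2) ((ξ - p r / (2 * Real.pi)) / q r)) * M ^ 2 with hv
  have hvm : Measurable (Function.uncurry v) := by
    have h1 : Measurable fun z : ℝ × ℝ =>
        ENNReal.ofReal (weight (-2) ((z.1 - p z.2 / (2 * Real.pi)) / q z.2)) :=
      hwm.comp (g := fun ξ : ℝ => ENNReal.ofReal (weight (-2) ξ)) (by fun_prop)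
    rw [hv]; unfold Function.uncurry; fun_prop
  calc _ ≤ ∫⁻ ξ, (∫⁻ r in S, u r) * ∫⁻ r in S, v ξ r := by
        refine lintegral_mono fun ξ => lintegral_sq_le_mul hum.aemeasurable
          (hvm.comp measurable_prodMk_left).aemeasurable ?_
        refine (ae_restrict_mem hS).mono fun r hr => ?_
        have hq0 := (hpq r hr).1
        have e : u r * v ξ r = (ENNReal.ofReal (D * (q r)⁻¹ *
            weight (-1) ((ξ - p r / (2 * Real.pi)) / q r)) * M) ^ 2 := by
          rw [hu, hv, mul_pow, ← ENNReal.ofReal_pow (mul_nonneg (by positivity) (weight_pos _ _).le),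
            ← mul_assoc, ← mul_assoc, ← ENNReal.ofReal_mul (by positivity),
            ← ENNReal.ofReal_mul (by positivity)]
          congr 2
          have h1 : q r ^ (-(1 / 2) : ℝ) * q r ^ (1 / 2 : ℝ) = 1 := by
            rw [← Real.rpow_add hq0]; norm_num
          have h2 : weight (-2) ((ξ - p r / (2 * Real.pi)) / q r) =
              weight (-1) ((ξ - p r / (2 * Real.pi)) / q r) ^ 2 := by
            rw [sq, weight_mul]; norm_num
          rw [h2]
          linear_combination (D ^ 2 * (q r)⁻¹ ^ 2 *
            weight (-1) ((ξ - p r / (2 * Real.pi)) / q r) ^ 2) * h1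
        rw [e, enorm_mul]
        gcongr
        · rw [← ofReal_norm]; exact ENNReal.ofReal_le_ofReal (hpt r hr ξ)
        · exact hAM r hr
    _ = (∫⁻ r in S, u r) * ∫⁻ r in S, ∫⁻ ξ, v ξ r := by
        rw [lintegral_const_mul _ (show Measurable fun ξ => ∫⁻ r in S, v ξ r from
            hvm.lintegral_prod_right' (ν := volume.restrict S)), lintegral_lintegral_swap hvm.aemeasurable]
    _ = (∫⁻ r in S, u r) * ∫⁻ r in S, ENNReal.ofReal (D ^ 2 * I) * M ^ 2 * u r := by
        congr 1
        refine setLIntegral_congr_fun hS fun r hr => ?_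
        have hq0 := (hpq r hr).1
        change ∫⁻ ξ, v ξ r = _
        simp only [hv, hu]
        rw [lintegral_mul_const' _ _ (ENNReal.pow_ne_top hM),
          lintegral_const_mul' _ _ ENNReal.ofReal_ne_top, lintegral_weight_comp_affine _ hq0,
          ← ENNReal.ofReal_mul (by positivity), mul_right_comm (ENNReal.ofReal (D ^ 2 * _)),
          ← ENNReal.ofReal_mul (by positivity)]
        congr 2
        have h1 : (q r)⁻¹ * q r ^ (1 / 2 : ℝ) = q r ^ (-(1 / 2) : ℝ) := by
          rw [← Real.rpow_neg_one, ← Real.rpow_add hq0]; norm_num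
        rw [← h1]
        field_simp
        rw [hI]
    _ = ENNReal.ofReal (D ^ 2 * I) * M ^ 2 * (∫⁻ r in S, u r) ^ 2 := by
        rw [lintegral_const_mul _ hum]; ring
    _ ≤ ENNReal.ofReal (D ^ 2 * I) * M ^ 2 * ENNReal.ofReal J ^ 2 := by gcongr
    _ = _ := by
        rw [ENNReal.ofReal_mul (by positivity : 0 ≤ D * Real.sqrt I), mul_pow, mul_pow,
          ← ENNReal.ofReal_pow (by positivity : 0 ≤ D * Real.sqrt I), mul_pow, Real.sq_sqrt hI0]
        ring

/-! ### The symbols on the contour -/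

theorem measurable_rootBranch : Measurable rootBranch := by
  unfold rootBranch
  exact measurable_id.mul ((measurable_const.add (measurable_id.pow_const 2).inv).pow_const _)

theorem measurable_disp : Measurable disp := measurable_id.mul measurable_rootBranch

theorem measurable_nu : Measurable nu := measurable_const.mul measurable_rootBranch

theorem measurable_DeltaS (ε γ δ : ℝ) : Measurable (DeltaS ε γ δ) := by
  have := measurable_nu
  unfold DeltaS
  fun_prop

/-- The common factor of the spectral densities. -/
def baseCoef (ε γ δ : ℝ) (k : ℂ) : ℂ :=
  1 / (Complex.I * disp k) * (k * (k + ε * nu k) / DeltaS ε γ δ k)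

/-- The coefficient of the transform of `ψ` in the spectral density. -/
def psiCoef (ε γ δ : ℝ) (k : ℂ) : ℂ := baseCoef ε γ δ k * (nu k - ε * Complex.I * γ)

/-- The coefficient of the transform of `φ` in the spectral density. -/
def phiCoef (ε γ δ : ℝ) (k : ℂ) : ℂ :=
  baseCoef ε γ δ k * -(ε * Complex.I * nu k * (nu k - ε * Complex.I * δ))

/-- The spectral densities for `∂D₁` (`ε = 1`) and `∂D₂` (`ε = -1`). -/
def densityS (ε γ δ : ℝ) (Φ Ψ : ℂ → ℂ) (k : ℂ) : ℂ :=
  psiCoef ε γ δ k * Ψ (-(ε * disp k)) + phiCoef ε γ δ k * Φ (-(ε * disp k))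

theorem densityS_one (γ δ T : ℝ) (φ ψ : 𝓢'(ℝ, ℂ)) :
    densityS 1 γ δ (timeFourier T φ) (timeFourier T ψ) = density1 γ δ T φ ψ := by
  ext k
  simp only [densityS, density1, psiCoef, phiCoef, baseCoef, ← DeltaS_one]
  push_cast
  simp only [one_mul]
  ring

theorem densityS_neg_one (γ δ T : ℝ) (φ ψ : 𝓢'(ℝ, ℂ)) :
    densityS (-1) γ δ (timeFourier T φ) (timeFourier T ψ) = density2 γ δ T φ ψ := by
  ext k
  simp only [densityS, density2, psiCoef, phiCoef, baseCoef, ← DeltaS_neg_one]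
  push_cast
  simp only [neg_one_mul, neg_neg]
  ring

theorem measurable_densityS (ε γ δ : ℝ) {Φ Ψ : ℂ → ℂ} (hΦ : Measurable Φ) (hΨ : Measurable Ψ) :
    Measurable (densityS ε γ δ Φ Ψ) := by
  have h1 := measurable_nu
  have h2 := measurable_disp
  have h3 := measurable_DeltaS ε γ δ
  unfold densityS psiCoef phiCoef baseCoef
  fun_prop

theorem differentiableAt_psiCoef {γ δ a : ℝ} (ha : AdmissibleRadius γ δ a) {ε : ℝ}
    (hε : ε = 1 ∨ ε = -1) {k : ℂ} (hk : a ≤ ‖k‖) :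
    DifferentiableAt ℂ (psiCoef ε γ δ) k ∧ DifferentiableAt ℂ (phiCoef ε γ δ) k := by
  rw [admissibleRadius_iff] at ha
  have hk1 : 1 < ‖k‖ := ha.1.trans_le hk
  have h1 := differentiableAt_nu hk1
  have h2 := differentiableAt_disp hk1
  have h3 := differentiableAt_DeltaS ε γ δ hk1
  have h4 := ha.2 k hk ε hε
  have h5 : Complex.I * disp k ≠ 0 := mul_ne_zero Complex.I_ne_zero (disp_ne_zero hk1)
  unfold psiCoef phiCoef baseCoef
  constructor <;> fun_prop (disch := assumption)

theorem differentiableAt_densityS {γ δ a : ℝ} (ha : AdmissibleRadius γ δ a) {ε : ℝ}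
    (hε : ε = 1 ∨ ε = -1) {Φ Ψ : ℂ → ℂ} (hΦ : Differentiable ℂ Φ) (hΨ : Differentiable ℂ Ψ) {k : ℂ}
    (hk : a ≤ ‖k‖) : DifferentiableAt ℂ (densityS ε γ δ Φ Ψ) k := by
  obtain ⟨h1, h2⟩ := differentiableAt_psiCoef ha hε hk
  have h3 := differentiableAt_disp (ha.1.trans_le hk)
  unfold densityS
  fun_prop

theorem norm_disp_bounds {k : ℂ} (hk : 2 ≤ ‖k‖) :
    ‖k‖ ^ 2 / 2 ≤ ‖disp k‖ ∧ ‖disp k‖ ≤ 2 * ‖k‖ ^ 2 := by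
  have h1 := norm_rootBranch_ge hk
  have h2 := norm_rootBranch_le hk
  rw [disp, norm_mul]
  constructor <;> nlinarith [norm_nonneg k]

theorem norm_baseCoef_le {ε : ℝ} (hε : |ε| = 1) (γ δ : ℝ) {k : ℂ} (hk : largeRadius γ δ ≤ ‖k‖) :
    ‖baseCoef ε γ δ k‖ ≤ 48 / ‖k‖ ^ 2 := by
  have h2 : 2 ≤ ‖k‖ := (two_le_largeRadius γ δ).trans hk
  have hk0 : 0 < ‖k‖ := by linarith
  have h3 := (norm_disp_bounds h2).1
  have h4 := norm_DeltaS_ge hε γ δ hk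
  have h5 : ‖k + ε * nu k‖ ≤ 3 * ‖k‖ := by
    refine (norm_add_le _ _).trans ?_
    rw [norm_mul, Complex.norm_real, Real.norm_eq_abs, hε, norm_nu]
    linarith [norm_rootBranch_le h2]
  rw [baseCoef, norm_mul, norm_div, norm_div, norm_mul, norm_mul, norm_one, Complex.norm_I, one_mul]
  calc 1 / ‖disp k‖ * (‖k‖ * ‖k + ε * nu k‖ / ‖DeltaS ε γ δ k‖)
      ≤ 1 / (‖k‖ ^ 2 / 2) * (‖k‖ * (3 * ‖k‖) / (‖k‖ ^ 2 / 8)) := by gcongr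
    _ = 48 / ‖k‖ ^ 2 := by field_simp; norm_num

theorem abs_le_largeRadius (γ δ : ℝ) : |γ| ≤ largeRadius γ δ ∧ |δ| ≤ largeRadius γ δ := by
  unfold largeRadius
  have := abs_nonneg γ; have := abs_nonneg (γ * δ); have := abs_nonneg δ
  constructor <;> linarith

theorem norm_nu_sub_le {ε : ℝ} (hε : |ε| = 1) {b : ℝ} {k : ℂ} (hk : 2 ≤ ‖k‖) (hb : |b| ≤ ‖k‖) :
    ‖nu k - ε * Complex.I * b‖ ≤ 3 * ‖k‖ := by
  refine (norm_sub_le _ _).trans ?_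
  rw [norm_mul, norm_mul, Complex.norm_real, Complex.norm_real, Complex.norm_I, Real.norm_eq_abs,
    Real.norm_eq_abs, hε, norm_nu]
  linarith [norm_rootBranch_le hk]

/-- The common factor has order -2 in k. One factor of size |k| makes the coefficient of ψ of order
-1, while two make that of φ of order 0. This gap of one order in k is the gap of 1/2 between the
two time regularities. -/
theorem norm_psiCoef_le {ε : ℝ} (hε : |ε| = 1) (γ δ : ℝ) {k : ℂ} (hk : largeRadius γ δ ≤ ‖k‖) :
    ‖psiCoef ε γ δ k‖ ≤ 288 / ‖k‖ := by
  have h2 : 2 ≤ ‖k‖ := (two_le_largeRadius γ δ).trans hk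
  have hk0 : 0 < ‖k‖ := by linarith
  rw [psiCoef, norm_mul]
  calc _ ≤ 48 / ‖k‖ ^ 2 * (3 * ‖k‖) := by
        gcongr
        · exact norm_baseCoef_le hε γ δ hk
        · exact norm_nu_sub_le hε h2 ((abs_le_largeRadius γ δ).1.trans hk)
    _ = 144 / ‖k‖ := by field_simp; norm_num
    _ ≤ _ := by gcongr; norm_num

theorem norm_phiCoef_le {ε : ℝ} (hε : |ε| = 1) (γ δ : ℝ) {k : ℂ} (hk : largeRadius γ δ ≤ ‖k‖) :
    ‖phiCoef ε γ δ k‖ ≤ 288 := by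
  have h2 : 2 ≤ ‖k‖ := (two_le_largeRadius γ δ).trans hk
  have hk0 : 0 < ‖k‖ := by linarith
  rw [phiCoef, norm_mul, norm_neg, norm_mul, norm_mul, norm_mul, Complex.norm_real,
    Real.norm_eq_abs, hε, Complex.norm_I, norm_nu, one_mul, one_mul]
  calc _ ≤ 48 / ‖k‖ ^ 2 * (2 * ‖k‖ * (3 * ‖k‖)) := by
        gcongr
        · exact norm_baseCoef_le hε γ δ hk
        · exact norm_rootBranch_le h2
        · exact norm_nu_sub_le hε h2 ((abs_le_largeRadius γ δ).2.trans hk)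
    _ = 288 := by field_simp; norm_num

theorem norm_densityS_le {ε : ℝ} (hε : |ε| = 1) (γ δ : ℝ) (Φ Ψ : ℂ → ℂ) {k : ℂ}
    (hk : largeRadius γ δ ≤ ‖k‖) : ‖densityS ε γ δ Φ Ψ k‖ ≤
      288 * (‖Φ (-(ε * disp k))‖ + ‖Ψ (-(ε * disp k))‖ / ‖k‖) := by
  have h2 : 2 ≤ ‖k‖ := (two_le_largeRadius γ δ).trans hk
  have hk0 : 0 < ‖k‖ := by linarith
  refine (norm_add_le _ _).trans ?_
  rw [norm_mul, norm_mul]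
  have h3 := mul_le_mul_of_nonneg_right (norm_psiCoef_le hε γ δ hk) (norm_nonneg (Ψ (-(ε * disp k))))
  have h4 := mul_le_mul_of_nonneg_right (norm_phiCoef_le hε γ δ hk) (norm_nonneg (Φ (-(ε * disp k))))
  have : 288 / ‖k‖ * ‖Ψ (-(ε * disp k))‖ = 288 * (‖Ψ (-(ε * disp k))‖ / ‖k‖) := by ring
  linarith

/-! ### The dispersion relation on the axes -/

/-- The values of `ω` on the axes: `ω(k) = axisDisp τ r` for `k² = τ r²`, `τ = ±1`. -/
def axisDisp (τ r : ℝ) : ℝ := τ * Real.sqrt (r ^ 4 + τ * r ^ 2)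

theorem axis_pos {τ r : ℝ} (hτ : τ = 1 ∨ τ = -1) (hr : 1 < r) : 0 < r ^ 4 + τ * r ^ 2 := by
  have h1 : 1 < r ^ 2 := one_lt_pow₀ hr two_ne_zero
  rcases hτ with rfl | rfl <;> nlinarith

theorem disp_axis {τ r : ℝ} (hτ : τ = 1 ∨ τ = -1) (hr : 1 < r) {k : ℂ}
    (hk : k ^ 2 = ((τ * r ^ 2 : ℝ) : ℂ)) : disp k = axisDisp τ r := by
  have h1 : 1 < r ^ 2 := one_lt_pow₀ hr two_ne_zero
  have hp : 0 ≤ 1 + (τ * r ^ 2)⁻¹ := by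
    rw [mul_inv]
    have : (r ^ 2)⁻¹ < 1 := inv_lt_one_of_one_lt₀ h1
    rcases hτ with rfl | rfl
    · positivity
    · norm_num; linarith
  have e : disp k = k ^ 2 * (1 + (k ^ 2)⁻¹) ^ (1 / 2 : ℂ) := by rw [disp, rootBranch]; ring
  have e2 : (1 + (((τ * r ^ 2 : ℝ) : ℂ))⁻¹) ^ (1 / 2 : ℂ) = ((Real.sqrt (1 + (τ * r ^ 2)⁻¹) : ℝ) : ℂ) := by
    rw [Real.sqrt_eq_rpow, Complex.ofReal_cpow hp]; push_cast; rfl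
  rw [e, hk, e2, ← Complex.ofReal_mul]
  congr 1
  rw [axisDisp, mul_assoc]
  congr 1
  rw [← Real.sqrt_sq (by positivity : 0 ≤ r ^ 2), ← Real.sqrt_mul (by positivity)]
  congr 1
  rw [Real.sqrt_sq (by positivity : 0 ≤ r ^ 2)]
  rcases hτ with rfl | rfl <;> field_simp

theorem axisDisp_sq {τ r : ℝ} (hτ : τ = 1 ∨ τ = -1) (hr : 1 < r) :
    axisDisp τ r ^ 2 = r ^ 4 + τ * r ^ 2 := by
  rw [axisDisp, mul_pow, Real.sq_sqrt (axis_pos hτ hr).le]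
  rcases hτ with rfl | rfl <;> ring

theorem abs_axisDisp_bounds {τ r : ℝ} (hτ : τ = 1 ∨ τ = -1) (hr : 2 ≤ r) :
    r ^ 2 / 2 ≤ |axisDisp τ r| ∧ |axisDisp τ r| ≤ 2 * r ^ 2 := by
  have h := axisDisp_sq hτ (by linarith : 1 < r)
  have h4 : 4 ≤ r ^ 2 := by nlinarith
  have hb : r ^ 2 / 4 * r ^ 2 ≤ r ^ 4 + τ * r ^ 2 ∧ r ^ 4 + τ * r ^ 2 ≤ 4 * r ^ 4 := by
    rcases hτ with rfl | rfl <;> constructor <;> nlinarith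
  constructor
  · refine abs_le_of_sq_le_sq' (a := r ^ 2 / 2) ?_ (abs_nonneg _) |>.2
    rw [sq_abs, h]; nlinarith
  · refine abs_le_of_sq_le_sq' (a := |axisDisp τ r|) ?_ (by positivity) |>.2
    rw [sq_abs, h]; nlinarith

theorem hasDerivAt_axisDisp {τ r : ℝ} (hτ : τ = 1 ∨ τ = -1) (hr : 1 < r) :
    HasDerivAt (axisDisp τ) (τ * ((4 * r ^ 3 + τ * (2 * r)) / (2 * Real.sqrt (r ^ 4 + τ * r ^ 2)))) r := by
  have h1 : HasDerivAt (fun r : ℝ => r ^ 4 + τ * r ^ 2) (4 * r ^ 3 + τ * (2 * r)) r := by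
    refine ((hasDerivAt_pow 4 r).add ((hasDerivAt_pow 2 r).const_mul τ)).congr_deriv ?_
    norm_num
  exact (h1.sqrt (axis_pos hτ hr).ne').const_mul τ

theorem le_abs_deriv_axisDisp {τ r : ℝ} (hτ : τ = 1 ∨ τ = -1) (hr : 2 ≤ r) :
    r ≤ |τ * ((4 * r ^ 3 + τ * (2 * r)) / (2 * Real.sqrt (r ^ 4 + τ * r ^ 2)))| := by
  have hp := axis_pos hτ (by linarith : 1 < r)
  have hs : 0 < Real.sqrt (r ^ 4 + τ * r ^ 2) := Real.sqrt_pos.mpr hp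
  have hτ1 : |τ| = 1 := by rcases hτ with rfl | rfl <;> simp
  have hle : Real.sqrt (r ^ 4 + τ * r ^ 2) ≤ 5 / 4 * r ^ 2 := by
    refine Real.sqrt_le_iff.mpr ⟨by positivity, ?_⟩
    have h4 : 4 ≤ r ^ 2 := by nlinarith
    rcases hτ with rfl | rfl <;> nlinarith
  rw [abs_mul, hτ1, one_mul]
  refine le_trans ?_ (le_abs_self _)
  rw [le_div_iff₀ (by positivity)]
  have h3 : r * (2 * Real.sqrt (r ^ 4 + τ * r ^ 2)) ≤ r * (2 * (5 / 4 * r ^ 2)) := by gcongr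
  have h4 : 4 * r ≤ r ^ 3 := by nlinarith [mul_self_nonneg (r - 2)]
  rcases hτ with rfl | rfl <;> nlinarith

theorem injOn_axisDisp {τ : ℝ} (hτ : τ = 1 ∨ τ = -1) {a : ℝ} (ha : 1 ≤ a) :
    InjOn (axisDisp τ) (Ioi a) := by
  intro x hx y hy h
  have hx : 1 < x := ha.trans_lt hx
  have hy : 1 < y := ha.trans_lt hy
  have h2 := axisDisp_sq hτ hx
  rw [h, axisDisp_sq hτ hy] at h2
  have hx2 : 1 < x ^ 2 := one_lt_pow₀ hx two_ne_zero
  have hy2 : 1 < y ^ 2 := one_lt_pow₀ hy two_ne_zero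
  have h3 : (x ^ 2 - y ^ 2) * (x ^ 2 + y ^ 2 + τ) = 0 := by linear_combination -h2
  have h4 : x ^ 2 + y ^ 2 + τ ≠ 0 := by rcases hτ with rfl | rfl <;> linarith
  have h5 : x ^ 2 = y ^ 2 := by
    have := (mul_eq_zero.mp h3).resolve_right h4; linarith
  exact (pow_left_inj₀ (by linarith) (by linarith) two_ne_zero).mp h5

theorem exists_rpow_le_axisDisp (σ : ℝ) : ∃ C : ℝ, 0 < C ∧ ∀ τ : ℝ, (τ = 1 ∨ τ = -1) → ∀ r : ℝ,
    2 ≤ r → r ^ (4 * σ) ≤ C * (1 + axisDisp τ r ^ 2) ^ σ := by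
  obtain ⟨C, hC, h⟩ := exists_japanese_le (2 * σ)
  refine ⟨2 ^ |2 * σ| * C, by positivity, fun τ hτ r hr => ?_⟩
  obtain ⟨h1, h2⟩ := abs_axisDisp_bounds hτ hr
  have h4 : 4 ≤ r ^ 2 := by nlinarith
  have hw := (h |axisDisp τ r| (by linarith)).2
  rw [sq_abs, mul_div_cancel_left₀ _ two_ne_zero] at hw
  have hr4 : r ^ (4 * σ) = (r ^ 2) ^ (2 * σ) := by
    rw [← Real.rpow_natCast r 2, ← Real.rpow_mul (by linarith)]; congr 1; push_cast; ring
  have hpos : 0 < |axisDisp τ r| := by linarith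
  have h5 : (r ^ 2) ^ (2 * σ) ≤ 2 ^ |2 * σ| * |axisDisp τ r| ^ (2 * σ) := by
    rcases le_total 0 (2 * σ) with hs | hs
    · rw [abs_of_nonneg hs, ← Real.mul_rpow (by norm_num) hpos.le]
      exact Real.rpow_le_rpow (by positivity) (by linarith) hs
    · have : (2 : ℝ) ^ |2 * σ| = (1 / 2 : ℝ) ^ (2 * σ) := by
        rw [one_div, Real.inv_rpow (by norm_num), ← Real.rpow_neg (by norm_num), abs_of_nonpos hs]
      rw [this, ← Real.mul_rpow (by norm_num) hpos.le]
      exact Real.rpow_le_rpow_of_nonpos (by positivity) (by linarith) hs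
  rw [hr4, mul_assoc]
  exact h5.trans (by gcongr)

/-- Substitute y = ω. Since |ω| ≍ r² and |ω'| ≥ r, the measure r^{4σ+1} dr is at most a constant
times (1+y²)^σ dy. The relation 2σ + 1/2 = s is the source of the exponent (2s-1)/4. -/
theorem exists_lintegral_axis_le (σ : ℝ) : ∃ C : ℝ, 0 < C ∧ ∀ τ κ : ℝ, (τ = 1 ∨ τ = -1) →
    (κ = 1 ∨ κ = -1) → ∀ a : ℝ, 2 ≤ a → ∀ g : ℝ → ℂ, Measurable g →
    ∫⁻ r in Ioi a, (ENNReal.ofReal (r ^ (2 * σ + 1 / 2)) * ‖g (κ * axisDisp τ r)‖ₑ) ^ 2 ≤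
      (ENNReal.ofReal C * eLpNorm (fun ξ => (weight σ ξ : ℂ) * g (2 * Real.pi * ξ)) 2) ^ 2 := by
  obtain ⟨C, hC, h⟩ := exists_rpow_le_axisDisp σ
  refine ⟨Real.sqrt (2 * Real.pi * C), by positivity, fun τ κ hτ hκ a ha g hg => ?_⟩
  set F : ℝ → ℝ≥0∞ := fun y => ENNReal.ofReal (C * (1 + y ^ 2) ^ σ) * ‖g (κ * y)‖ₑ ^ 2 with hF
  have hFm : Measurable F := by
    have : Measurable fun y => ‖g (κ * y)‖ₑ := (hg.comp (measurable_const_mul κ)).enorm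
    rw [hF]; fun_prop
  have hκκ : κ * κ = 1 := by rcases hκ with rfl | rfl <;> norm_num
  have hc : 2 * Real.pi * κ ≠ 0 := by rcases hκ with rfl | rfl <;> simp [Real.pi_ne_zero]
  calc _ ≤ ∫⁻ r in Ioi a, ENNReal.ofReal |τ * ((4 * r ^ 3 + τ * (2 * r)) /
        (2 * Real.sqrt (r ^ 4 + τ * r ^ 2)))| * F (axisDisp τ r) := by
        refine setLIntegral_mono' measurableSet_Ioi fun r hr => ?_
        have hr2 : 2 ≤ r := ha.trans (le_of_lt hr)
        have hr0 : 0 < r := by linarith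
        have hd := le_abs_deriv_axisDisp hτ hr2
        rw [hF, mul_pow, ← mul_assoc, ← ENNReal.ofReal_mul (abs_nonneg _),
          ← ENNReal.ofReal_pow (by positivity)]
        gcongr
        have : (r ^ (2 * σ + 1 / 2)) ^ 2 = r * r ^ (4 * σ) := by
          rw [← Real.rpow_natCast, ← Real.rpow_mul hr0.le]
          nth_rw 2 [← Real.rpow_one r]
          rw [← Real.rpow_add hr0]; congr 1; push_cast; ring
        rw [this]
        exact mul_le_mul hd (h τ hτ r hr2) (by positivity) (abs_nonneg _)
    _ = ∫⁻ y in axisDisp τ '' Ioi a, F y :=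
        (lintegral_image_eq_lintegral_abs_deriv_mul measurableSet_Ioi (fun r hr =>
          (hasDerivAt_axisDisp hτ (by have : a < r := hr; linarith)).hasDerivWithinAt)
          (injOn_axisDisp hτ (by linarith)) F).symm
    _ ≤ ∫⁻ y, F y := setLIntegral_le_lintegral _ _
    _ = ENNReal.ofReal (2 * Real.pi) * ∫⁻ ξ, F (2 * Real.pi * κ * ξ) := by
        have habs : |(2 * Real.pi * κ)⁻¹| = (2 * Real.pi)⁻¹ := by
          rcases hκ with rfl | rfl <;> simp [abs_of_pos Real.pi_pos]
        rw [lintegral_comp_mul_left F hFm hc, habs, ← mul_assoc, ← ENNReal.ofReal_mul (by positivity),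
          mul_inv_cancel₀ (by positivity), ENNReal.ofReal_one, one_mul]
    _ = ENNReal.ofReal (2 * Real.pi * C) *
        ∫⁻ ξ, ‖(weight σ ξ : ℂ) * g (2 * Real.pi * ξ)‖ₑ ^ 2 := by
        rw [ENNReal.ofReal_mul (p := 2 * Real.pi) (q := C) (by positivity),
          mul_assoc (ENNReal.ofReal (2 * Real.pi)), ← lintegral_const_mul' (ENNReal.ofReal C) _ ENNReal.ofReal_ne_top]
        congr 1
        refine lintegral_congr fun ξ => ?_
        have e1 : κ * (2 * Real.pi * κ * ξ) = 2 * Real.pi * ξ := by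
          linear_combination (2 * Real.pi * ξ) * hκκ
        have e2 : (2 * Real.pi * κ * ξ) ^ 2 = (2 * Real.pi * ξ) ^ 2 := by
          linear_combination (2 * Real.pi * ξ) ^ 2 * hκκ
        simp only [hF, e1, e2]
        have e3 : ENNReal.ofReal ((1 + (2 * Real.pi * ξ) ^ 2) ^ σ) = ‖(weight σ ξ : ℂ)‖ₑ ^ 2 := by
          rw [← ofReal_norm, ← ENNReal.ofReal_pow (norm_nonneg _), Complex.norm_real,
            Real.norm_of_nonneg (weight_pos _ _).le, sq (weight σ ξ), weight_mul, weight,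
            add_self_div_two]
        rw [ENNReal.ofReal_mul hC.le, e3, enorm_mul, mul_assoc, mul_pow]
    _ = _ := by
        rw [← eLpNorm_two_sq, mul_pow, ← ENNReal.ofReal_pow (by positivity),
          Real.sq_sqrt (by positivity)]

/-! ### Half-line bounds for the contour integrals -/

/-- The spectral density of the `j`-th time derivative at time `t`. -/
def timeDensity (ε γ δ : ℝ) (Φ Ψ : ℂ → ℂ) (j : ℕ) (t : ℝ) (k : ℂ) : ℂ :=
  (-(ε * Complex.I * disp k)) ^ j * Complex.exp (-(ε * Complex.I * disp k) * t) *
    densityS ε γ δ Φ Ψ k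

theorem measurable_timeDensity (ε γ δ : ℝ) {Φ Ψ : ℂ → ℂ} (hΦ : Measurable Φ) (hΨ : Measurable Ψ)
    (j : ℕ) (t : ℝ) : Measurable (timeDensity ε γ δ Φ Ψ j t) := by
  have h1 := measurable_disp
  have h2 := measurable_densityS ε γ δ hΦ hΨ
  unfold timeDensity
  fun_prop

theorem abs_of_sign {ε : ℝ} (hε : ε = 1 ∨ ε = -1) : |ε| = 1 := by rcases hε with rfl | rfl <;> simp

theorem norm_exp_axis (ε : ℝ) {w t : ℝ} :
    ‖Complex.exp (-(ε * Complex.I * (w : ℂ)) * t)‖ = 1 := by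
  have : -(ε * Complex.I * (w : ℂ)) * t = ((-(ε * w * t) : ℝ) : ℂ) * Complex.I := by push_cast; ring
  rw [this, Complex.norm_exp_ofReal_mul_I]

/-- ω is real on both axes, so the time exponential has modulus 1 and the bound on the rays does not
depend on t. -/
theorem norm_timeDensity_axis_le {ε τ : ℝ} (hε : ε = 1 ∨ ε = -1) (hτ : τ = 1 ∨ τ = -1) (γ δ : ℝ)
    (Φ Ψ : ℂ → ℂ) (j : ℕ) (t : ℝ) {r : ℝ} (hr : largeRadius γ δ ≤ r) {k : ℂ} (hkr : ‖k‖ = r)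
    (hk : k ^ 2 = ((τ * r ^ 2 : ℝ) : ℂ)) :
    ‖timeDensity ε γ δ Φ Ψ j t k‖ ≤ 288 * 2 ^ j * r ^ (2 * j) *
      (‖Φ ((-ε * axisDisp τ r : ℝ))‖ + ‖Ψ ((-ε * axisDisp τ r : ℝ))‖ / r) := by
  have hr2 : 2 ≤ r := (two_le_largeRadius γ δ).trans hr
  have hd := disp_axis hτ (by linarith) hk
  have h1 := norm_densityS_le (abs_of_sign hε) γ δ Φ Ψ (k := k) (hkr ▸ hr)
  rw [hd, hkr] at h1
  have h2 : -((ε : ℂ) * axisDisp τ r) = ((-ε * axisDisp τ r : ℝ) : ℂ) := by push_cast; ring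
  rw [h2] at h1
  rw [timeDensity, norm_mul, norm_mul, hd, norm_exp_axis, mul_one, norm_pow, norm_neg, norm_mul,
    norm_mul, Complex.norm_real, Complex.norm_real, Complex.norm_I, Real.norm_eq_abs,
    Real.norm_eq_abs, abs_of_sign hε, one_mul, one_mul]
  calc _ ≤ (2 * r ^ 2) ^ j * (288 * (‖Φ ((-ε * axisDisp τ r : ℝ))‖ +
        ‖Ψ ((-ε * axisDisp τ r : ℝ))‖ / r)) := by
        gcongr; exact (abs_axisDisp_bounds hτ hr2).2
    _ = _ := by rw [mul_pow, ← pow_mul]; ring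

theorem add_sq_le_four_mul (a b : ℝ≥0∞) : (a + b) ^ 2 ≤ 4 * (a ^ 2 + b ^ 2) := by
  rcases le_total a b with h | h
  · calc (a + b) ^ 2 ≤ (b + b) ^ 2 := by gcongr
      _ = 4 * b ^ 2 := by ring
      _ ≤ _ := by gcongr; exact le_add_self
  · calc (a + b) ^ 2 ≤ (a + a) ^ 2 := by gcongr
      _ = 4 * a ^ 2 := by ring
      _ ≤ _ := by gcongr; exact le_self_add

/-- The j factors ω, each of size r², are paid for by the weight r^{-2j}. What remains is r^s
against φ and r^{s-1} against ψ, which the change of variable turns into the norms of the data. -/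
theorem exists_lintegral_timeDensity_le (γ δ s : ℝ) (j : ℕ) : ∃ M : ℝ, 0 ≤ M ∧
    ∀ ε τ : ℝ, (ε = 1 ∨ ε = -1) → (τ = 1 ∨ τ = -1) → ∀ Φ Ψ : ℂ → ℂ, Measurable Φ → Measurable Ψ →
    ∀ n : ℝ≥0∞, eLpNorm (fun ξ => (weight ((2 * s - 1) / 4) ξ : ℂ) *
      Φ ((2 * Real.pi * ξ : ℝ) : ℂ)) 2 ≤ n →
    eLpNorm (fun ξ => (weight ((2 * s - 3) / 4) ξ : ℂ) * Ψ ((2 * Real.pi * ξ : ℝ) : ℂ)) 2 ≤ n →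
    ∀ t : ℝ, ∀ κ : ℝ → ℂ, (∀ r, largeRadius γ δ ≤ r → ‖κ r‖ = r ∧ κ r ^ 2 = ((τ * r ^ 2 : ℝ) : ℂ)) →
    ∫⁻ r in Ioi (largeRadius γ δ), (ENNReal.ofReal (r ^ (s - 2 * j)) *
      ‖timeDensity ε γ δ Φ Ψ j t (κ r)‖ₑ) ^ 2 ≤ (ENNReal.ofReal M * n) ^ 2 := by
  obtain ⟨C, hC, h⟩ := exists_lintegral_axis_le ((2 * s - 1) / 4)
  obtain ⟨D, hD, h'⟩ := exists_lintegral_axis_le ((2 * s - 3) / 4)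
  have e1 : 2 * ((2 * s - 1) / 4) + 1 / 2 = s := by ring
  have e2 : 2 * ((2 * s - 3) / 4) + 1 / 2 = s - 1 := by ring
  rw [e1] at h
  rw [e2] at h'
  set L : ℝ := 288 * 2 ^ j with hL
  refine ⟨2 * L * (C + D), by positivity, fun ε τ hε hτ Φ Ψ hΦ hΨ n hn hn' t κ hκ => ?_⟩
  have hR := two_le_largeRadius γ δ
  have hε' : -ε = 1 ∨ -ε = -1 := by rcases hε with rfl | rfl <;> simp
  set u : ℝ → ℝ≥0∞ := fun r => ENNReal.ofReal (r ^ s) * ‖Φ ((-ε * axisDisp τ r : ℝ))‖ₑ with hu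
  set v : ℝ → ℝ≥0∞ := fun r => ENNReal.ofReal (r ^ (s - 1)) * ‖Ψ ((-ε * axisDisp τ r : ℝ))‖ₑ with hv
  have hum : Measurable u := by
    have : Measurable fun r : ℝ => ‖Φ ((-ε * axisDisp τ r : ℝ))‖ₑ := by
      refine (hΦ.comp ?_).enorm
      unfold axisDisp; fun_prop
    rw [hu]; fun_prop
  have hA := (h τ (-ε) hτ hε' _ hR (fun y => Φ y) (hΦ.comp Complex.measurable_ofReal))
  have hB := (h' τ (-ε) hτ hε' _ hR (fun y => Ψ y) (hΨ.comp Complex.measurable_ofReal))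
  calc _ ≤ ∫⁻ r in Ioi (largeRadius γ δ), ENNReal.ofReal L ^ 2 * (4 * (u r ^ 2 + v r ^ 2)) := by
        refine setLIntegral_mono' measurableSet_Ioi fun r hr => ?_
        have hr : largeRadius γ δ ≤ r := le_of_lt hr
        have hr0 : 0 < r := by linarith
        refine le_trans ?_ (mul_le_mul_right (add_sq_le_four_mul (u r) (v r)) _)
        rw [← mul_pow]
        refine pow_le_pow_left₀ zero_le ?_ 2
        have h3 := norm_timeDensity_axis_le hε hτ γ δ Φ Ψ j t hr (hκ r hr).1 (hκ r hr).2
        rw [hu, hv]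
        simp only
        rw [← ofReal_norm, ← ofReal_norm, ← ofReal_norm, ← ENNReal.ofReal_mul (by positivity),
          ← ENNReal.ofReal_mul (by positivity), ← ENNReal.ofReal_mul (by positivity),
          ← ENNReal.ofReal_add (by positivity) (by positivity), ← ENNReal.ofReal_mul (by positivity)]
        refine ENNReal.ofReal_le_ofReal ?_
        have h4 : r ^ (s - 2 * j) * r ^ (2 * j) = r ^ s := by
          rw [← Real.rpow_natCast, ← Real.rpow_add hr0]; congr 1; push_cast; ring
        have h5 : r ^ (s - 1) = r ^ s / r := by rw [Real.rpow_sub hr0, Real.rpow_one]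
        calc _ ≤ r ^ (s - 2 * j) * (288 * 2 ^ j * r ^ (2 * j) *
              (‖Φ ((-ε * axisDisp τ r : ℝ))‖ + ‖Ψ ((-ε * axisDisp τ r : ℝ))‖ / r)) := by gcongr
          _ = (r ^ (s - 2 * j) * r ^ (2 * j)) * (288 * 2 ^ j) *
              (‖Φ ((-ε * axisDisp τ r : ℝ))‖ + ‖Ψ ((-ε * axisDisp τ r : ℝ))‖ / r) := by ring
          _ = _ := by rw [h4, h5, hL]; ring
    _ = ENNReal.ofReal L ^ 2 * (4 * ((∫⁻ r in Ioi (largeRadius γ δ), u r ^ 2) +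
          ∫⁻ r in Ioi (largeRadius γ δ), v r ^ 2)) := by
        rw [lintegral_const_mul' _ _ (ENNReal.pow_ne_top ENNReal.ofReal_ne_top),
          lintegral_const_mul' _ _ (by norm_num), lintegral_add_left (hum.pow_const 2)]
    _ ≤ ENNReal.ofReal L ^ 2 * (4 * ((ENNReal.ofReal C * n) ^ 2 + (ENNReal.ofReal D * n) ^ 2)) := by
        gcongr
        · refine hA.trans ?_
          gcongr
        · refine hB.trans ?_
          gcongr
    _ ≤ ENNReal.ofReal L ^ 2 * (4 * (ENNReal.ofReal C * n + ENNReal.ofReal D * n) ^ 2) := by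
        gcongr
        rw [add_sq]
        exact add_le_add_left le_self_add _
    _ = _ := by
        rw [ENNReal.ofReal_mul (p := 2 * L) (by positivity),
          ENNReal.ofReal_mul (p := 2) (q := L) (by norm_num),
          ENNReal.ofReal_add hC.le hD.le, ENNReal.ofReal_ofNat]
        ring

/-- The singularities at the two ends of the half-circle are of order -1/2. By Jordan's inequality
and R ≥ 2, R sin ϑ is at least the distance of ϑ to the nearer end. -/
theorem exists_lintegral_arc : ∃ J : ℝ, ∀ R : ℝ, 2 ≤ R →
    ∫⁻ ϑ in Ioo 0 Real.pi, ENNReal.ofReal ((R * Real.sin ϑ) ^ (-(1 / 2) : ℝ)) ≤ ENNReal.ofReal J := by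
  have hi : IntegrableOn (fun x : ℝ => x ^ (-(1 / 2) : ℝ)) (Ioo 0 Real.pi) :=
    ((intervalIntegrable_iff_integrableOn_Ioc_of_le Real.pi_pos.le).mp
      (intervalIntegral.intervalIntegrable_rpow' (by norm_num))).mono_set Ioo_subset_Ioc_self
  have hi' : IntegrableOn (fun x : ℝ => (Real.pi - x) ^ (-(1 / 2) : ℝ)) (Ioo 0 Real.pi) := by
    have h1 := (intervalIntegral.intervalIntegrable_rpow' (a := 0) (b := Real.pi) (r := -(1 / 2))
      (by norm_num)).comp_sub_left Real.pi
    simp only [sub_zero, sub_self] at h1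
    exact ((intervalIntegrable_iff_integrableOn_Ioc_of_le Real.pi_pos.le).mp h1.symm).mono_set
      Ioo_subset_Ioc_self
  have hs : IntegrableOn (fun x : ℝ => x ^ (-(1 / 2) : ℝ) + (Real.pi - x) ^ (-(1 / 2) : ℝ))
    (Ioo 0 Real.pi) := hi.add hi'
  refine ⟨_, fun R hR => (?_ : _ ≤ ENNReal.ofReal (∫ x in Ioo 0 Real.pi,
    (x ^ (-(1 / 2) : ℝ) + (Real.pi - x) ^ (-(1 / 2) : ℝ))))⟩
  rw [ofReal_integral_eq_lintegral_ofReal hs]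
  · refine setLIntegral_mono' measurableSet_Ioo fun x hx => ENNReal.ofReal_le_ofReal ?_
    have hx0 := hx.1
    have hx1 : 0 < Real.pi - x := sub_pos.mpr hx.2
    have h1 : 0 ≤ x ^ (-(1 / 2) : ℝ) := by positivity
    have h2 : 0 ≤ (Real.pi - x) ^ (-(1 / 2) : ℝ) := by positivity
    have aux : ∀ y, 0 < y → y ≤ Real.pi / 2 → y ≤ R * Real.sin y := by
      intro y hy0 hy
      have h3 := Real.mul_le_sin hy0.le hy
      have h4 : y ≤ 2 * (2 / Real.pi * y) := by
        have : 1 ≤ 2 * (2 / Real.pi) := by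
          rw [← mul_div_assoc, le_div_iff₀ Real.pi_pos]; linarith [Real.pi_le_four]
        nlinarith
      have h5 : 0 ≤ Real.sin y := le_trans (by positivity) h3
      nlinarith
    rcases le_total x (Real.pi / 2) with h | h
    · have := Real.rpow_le_rpow_of_nonpos hx0 (aux x hx0 h) (by norm_num : (-(1 / 2) : ℝ) ≤ 0)
      linarith
    · have h3 := aux (Real.pi - x) hx1 (by linarith)
      rw [Real.sin_pi_sub] at h3
      have := Real.rpow_le_rpow_of_nonpos hx1 h3 (by norm_num : (-(1 / 2) : ℝ) ≤ 0)
      linarith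
  · refine (ae_restrict_mem measurableSet_Ioo).mono fun x hx => ?_
    exact add_nonneg (Real.rpow_nonneg hx.1.le _) (Real.rpow_nonneg (sub_nonneg.mpr hx.2.le) _)

/-- On the arc ω is complex but bounded by 2R², so the exponential is at most e^{2R²N} and the data
enter through their bound on a disc. The dependence on the length of the time interval arises here.
-/
theorem norm_timeDensity_arc_le {ε : ℝ} (hε : ε = 1 ∨ ε = -1) (γ δ : ℝ) (Φ Ψ : ℂ → ℂ) (j : ℕ)
    {t N : ℝ} (ht : t ∈ Icc 0 N) {k : ℂ} (hk : ‖k‖ = largeRadius γ δ) {n : ℝ≥0∞} {K : ℝ}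
    (h : ∀ w, ‖w‖ ≤ 2 * largeRadius γ δ ^ 2 → ‖Φ w‖ₑ ≤ ENNReal.ofReal K * n ∧
      ‖Ψ w‖ₑ ≤ ENNReal.ofReal K * n) :
    ‖timeDensity ε γ δ Φ Ψ j t k‖ₑ ≤ ENNReal.ofReal ((2 * largeRadius γ δ ^ 2) ^ j *
      Real.exp (2 * largeRadius γ δ ^ 2 * N) * 576 * K) * n := by
  set R := largeRadius γ δ with hRdef
  have hR : 2 ≤ R := two_le_largeRadius γ δ
  have hd : ‖disp k‖ ≤ 2 * R ^ 2 := by have := (norm_disp_bounds (hk ▸ hR)).2; rwa [hk] at this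
  have hc : ‖(-(ε * Complex.I * disp k) : ℂ)‖ ≤ 2 * R ^ 2 := by
    rw [norm_neg, norm_mul, norm_mul, Complex.norm_real, Complex.norm_I, Real.norm_eq_abs,
      abs_of_sign hε]
    simpa using hd
  have hexp : ‖Complex.exp (-(ε * Complex.I * disp k) * t)‖ ≤ Real.exp (2 * R ^ 2 * N) := by
    rw [Complex.norm_exp]
    refine Real.exp_le_exp.mpr ((Complex.re_le_norm _).trans ?_)
    rw [norm_mul, Complex.norm_real, Real.norm_of_nonneg ht.1]
    exact mul_le_mul hc ht.2 ht.1 (by positivity)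
  have hw : ‖(-(ε * disp k) : ℂ)‖ ≤ 2 * R ^ 2 := by
    rw [norm_neg, norm_mul, Complex.norm_real, Real.norm_eq_abs, abs_of_sign hε, one_mul]
    exact hd
  obtain ⟨h1, h2⟩ := h _ hw
  have hdens : ‖densityS ε γ δ Φ Ψ k‖ₑ ≤ ENNReal.ofReal (576 * K) * n := by
    have h3 : ‖densityS ε γ δ Φ Ψ k‖ ≤
        288 * (‖Φ (-(ε * disp k))‖ + ‖Ψ (-(ε * disp k))‖) := by
      refine (norm_densityS_le (abs_of_sign hε) γ δ Φ Ψ (k := k) hk.ge).trans ?_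
      gcongr
      exact div_le_self (norm_nonneg _) (by rw [hk]; linarith)
    rw [← ofReal_norm]
    refine (ENNReal.ofReal_le_ofReal h3).trans ?_
    rw [ENNReal.ofReal_mul (by norm_num), ENNReal.ofReal_add (norm_nonneg _) (norm_nonneg _),
      ofReal_norm, ofReal_norm, ENNReal.ofReal_ofNat]
    refine (mul_le_mul_right (add_le_add h1 h2) _).trans (le_of_eq ?_)
    rw [ENNReal.ofReal_mul (by norm_num), ENNReal.ofReal_ofNat]
    ring
  rw [timeDensity, enorm_mul, enorm_mul, enorm_pow, ← ofReal_norm, ← ofReal_norm,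
    ← ENNReal.ofReal_pow (norm_nonneg _), ← ENNReal.ofReal_mul (by positivity)]
  have h4 : ENNReal.ofReal (‖(-(ε * Complex.I * disp k) : ℂ)‖ ^ j *
      ‖Complex.exp (-(ε * Complex.I * disp k) * t)‖) ≤
      ENNReal.ofReal ((2 * R ^ 2) ^ j * Real.exp (2 * R ^ 2 * N)) := by
    refine ENNReal.ofReal_le_ofReal ?_
    gcongr
  refine (mul_le_mul' h4 hdens).trans (le_of_eq ?_)
  rw [← mul_assoc, ← ENNReal.ofReal_mul (by positivity)]
  congr 2; ring

theorem ray_sq {ε : ℝ} (hε : ε = 1 ∨ ε = -1) (r : ℝ) :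
    ((ε : ℂ) * r) ^ 2 = (((1 : ℝ) * r ^ 2 : ℝ) : ℂ) := by
  rcases hε with rfl | rfl <;> push_cast <;> ring

theorem norm_ray {ε : ℝ} (hε : ε = 1 ∨ ε = -1) {r : ℝ} (hr : 0 ≤ r) : ‖(ε : ℂ) * r‖ = r := by
  rw [norm_mul, Complex.norm_real, Complex.norm_real, Real.norm_eq_abs, abs_of_sign hε, one_mul,
    Real.norm_of_nonneg hr]

theorem imag_sq (r : ℝ) : (Complex.I * r) ^ 2 = (((-1 : ℝ) * r ^ 2 : ℝ) : ℂ) := by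
  rw [mul_pow, Complex.I_sq]; push_cast; ring

theorem norm_imag {r : ℝ} (hr : 0 ≤ r) : ‖Complex.I * r‖ = r := by
  rw [norm_mul, Complex.norm_I, Complex.norm_real, one_mul, Real.norm_of_nonneg hr]

theorem circleMap_eq_cos_sin (R ϑ : ℝ) : circleMap 0 R ϑ =
    ((R * Real.cos ϑ : ℝ) : ℂ) + Complex.I * ((R * Real.sin ϑ : ℝ) : ℂ) := by
  rw [circleMap_zero, Complex.exp_mul_I]
  push_cast; ring

/-- The densities of the two rays and of the arc are added. The constant sees the data only through
n, so it is uniform over all data and over t in [0,N]. -/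
theorem exists_halfBound_contour (γ δ s : ℝ) (j : ℕ) (N K : ℝ) : ∃ M : ℝ, 0 ≤ M ∧
    ∀ ε : ℝ, (ε = 1 ∨ ε = -1) → ∀ Φ Ψ : ℂ → ℂ, Measurable Φ → Measurable Ψ →
    ∀ n : ℝ≥0∞, n ≠ ⊤ → eLpNorm (fun ξ => (weight ((2 * s - 1) / 4) ξ : ℂ) *
      Φ ((2 * Real.pi * ξ : ℝ) : ℂ)) 2 ≤ n →
    eLpNorm (fun ξ => (weight ((2 * s - 3) / 4) ξ : ℂ) * Ψ ((2 * Real.pi * ξ : ℝ) : ℂ)) 2 ≤ n →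
    (∀ w, ‖w‖ ≤ 2 * largeRadius γ δ ^ 2 → ‖Φ w‖ₑ ≤ ENNReal.ofReal K * n ∧
      ‖Ψ w‖ₑ ≤ ENNReal.ofReal K * n) → ∀ t ∈ Icc 0 N,
    HalfBound (s - 2 * j) (fun θ => contourS ε (largeRadius γ δ) (fun k =>
      expPairing θ k * timeDensity ε γ δ Φ Ψ j t k)) (ENNReal.ofReal M * n) := by
  obtain ⟨L, hL0, hL⟩ := exists_lintegral_timeDensity_le γ δ s j
  obtain ⟨C₁, h₁⟩ := HalfBound.real_ray (s - 2 * j)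
  obtain ⟨C₂, h₂⟩ := HalfBound.imag_ray (s - 2 * j)
  obtain ⟨C₃, h₃⟩ := HalfBound.arc (s - 2 * j) (largeRadius γ δ)
  obtain ⟨J, hJ⟩ := exists_lintegral_arc
  set R := largeRadius γ δ with hRdef
  have hR : 2 ≤ R := two_le_largeRadius γ δ
  set Q := (2 * R ^ 2) ^ j * Real.exp (2 * R ^ 2 * N) * 576 * K with hQ
  refine ⟨|C₁| * L + |C₃ * J| * (R * |Q|) + |C₂| * L, by positivity, ?_⟩
  intro ε hε Φ Ψ hΦ hΨ n hn0 hn hn' hK t ht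
  have hm := measurable_timeDensity ε γ δ hΦ hΨ j t
  have hLn : ENNReal.ofReal L * n ≠ ⊤ := ENNReal.mul_ne_top ENNReal.ofReal_ne_top hn0
  have b₁ := h₁ ε hε R (by linarith) (fun r => timeDensity ε γ δ Φ Ψ j t (ε * r))
    (hm.comp (by fun_prop)) (ENNReal.ofReal L * n)
    (hL ε 1 hε (.inl rfl) Φ Ψ hΦ hΨ n hn hn' t (fun r => ε * r) fun r hr =>
      ⟨norm_ray hε (by linarith), ray_sq hε r⟩)
  have b₂ := h₂ R (by linarith) (fun r => timeDensity ε γ δ Φ Ψ j t (Complex.I * r))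
    (hm.comp (by fun_prop)) (ENNReal.ofReal L * n) hLn
    (hL ε (-1) hε (.inr rfl) Φ Ψ hΦ hΨ n hn hn' t (fun r => Complex.I * r) fun r hr =>
      ⟨norm_imag (by linarith), imag_sq r⟩)
  set S := Ioo (Real.pi / 4 * (1 - ε)) (Real.pi / 4 * (1 - ε) + Real.pi / 2) with hS
  have hSsub : S ⊆ Ioo 0 Real.pi := by
    have := Real.pi_pos
    rcases hε with rfl | rfl <;> refine Ioo_subset_Ioo ?_ ?_ <;> linarith
  have hcm : Measurable fun ϑ : ℝ => circleMap 0 R ϑ := (continuous_circleMap 0 R).measurable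
  have hkn : ∀ ϑ : ℝ, ‖circleMap 0 R ϑ‖ = R := fun ϑ => by
    rw [norm_circleMap_zero, abs_of_pos (by linarith)]
  have b₃ := h₃ (fun ϑ => R * Real.cos ϑ) (fun ϑ => R * Real.sin ϑ) (by fun_prop) (by fun_prop) S
    measurableSet_Ioo (fun ϑ hϑ => by
      have := Real.sin_pos_of_mem_Ioo (hSsub hϑ)
      refine ⟨by positivity, by nlinarith [Real.sin_le_one ϑ], ?_⟩
      rw [abs_mul, abs_of_pos (by linarith : 0 < R)]
      nlinarith [Real.abs_cos_le_one ϑ]) J ((lintegral_mono_set hSsub).trans (hJ R hR))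
    (fun ϑ => timeDensity ε γ δ Φ Ψ j t (circleMap 0 R ϑ) * (Complex.I * circleMap 0 R ϑ))
    ((hm.comp hcm).mul (hcm.const_mul _)) (ENNReal.ofReal (R * |Q|) * n)
    (ENNReal.mul_ne_top ENNReal.ofReal_ne_top hn0) (fun ϑ hϑ => by
      have h4 := norm_timeDensity_arc_le hε γ δ Φ Ψ j ht (hkn ϑ) hK
      rw [enorm_mul, enorm_mul, ← ofReal_norm Complex.I, Complex.norm_I, ENNReal.ofReal_one, one_mul,
        ← ofReal_norm (circleMap 0 R ϑ), hkn]
      calc _ ≤ ENNReal.ofReal |Q| * n * ENNReal.ofReal R := by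
            gcongr
            exact h4.trans (by gcongr; exact le_abs_self _)
        _ = _ := by rw [ENNReal.ofReal_mul (by linarith)]; ring)
  have t₁ : ENNReal.ofReal C₁ * (ENNReal.ofReal L * n) ≠ ⊤ :=
    ENNReal.mul_ne_top ENNReal.ofReal_ne_top hLn
  have t₂ : ENNReal.ofReal C₂ * (ENNReal.ofReal L * n) ≠ ⊤ :=
    ENNReal.mul_ne_top ENNReal.ofReal_ne_top hLn
  have t₃ : ENNReal.ofReal (C₃ * J) * (ENNReal.ofReal (R * |Q|) * n) ≠ ⊤ :=
    ENNReal.mul_ne_top ENNReal.ofReal_ne_top (ENNReal.mul_ne_top ENNReal.ofReal_ne_top hn0)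
  have n1 : ‖(-1 : ℂ)‖ₑ = 1 := by rw [← ofReal_norm]; simp
  have n2 : ‖-((ε : ℂ) * Complex.I)‖ₑ = 1 := by
    rw [← ofReal_norm, norm_neg, norm_mul, Complex.norm_real, Complex.norm_I, Real.norm_eq_abs,
      abs_of_sign hε]
    simp
  have c₃ := b₃.const_mul (-1)
  have c₂ := b₂.const_mul (-((ε : ℂ) * Complex.I))
  rw [n1, one_mul] at c₃
  rw [n2, one_mul] at c₂
  have key := ((b₁.add c₃ t₁ t₃).add c₂ (ENNReal.add_ne_top.mpr ⟨t₁, t₃⟩) t₂).mono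
    (B := ENNReal.ofReal (|C₁| * L + |C₃ * J| * (R * |Q|) + |C₂| * L) * n) ?_
  · convert key using 2 with θ
    rw [contourS, intervalIntegral.integral_of_le (by linarith [Real.pi_pos]),
      integral_Ioc_eq_integral_Ioo]
    simp only [circleMap_eq_cos_sin, mul_assoc]
    rw [← hS]
    simp only [← mul_assoc, integral_mul_const]
    ring
  · rw [ENNReal.ofReal_add (by positivity) (by positivity),
      ENNReal.ofReal_add (by positivity) (by positivity), ENNReal.ofReal_mul (abs_nonneg _),
      ENNReal.ofReal_mul (abs_nonneg (C₃ * J)), ENNReal.ofReal_mul (abs_nonneg C₂), add_mul, add_mul,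
      mul_assoc, mul_assoc, mul_assoc]
    gcongr <;> exact le_abs_self _

/-! ### Fourier–Laplace transforms of smooth compactly supported functions -/

/-- The Fourier–Laplace transform `∫ e^{ikx} c(x) dx`. -/
def fourierLaplace (c : ℝ → ℂ) (k : ℂ) : ℂ := ∫ x : ℝ, Complex.exp (Complex.I * k * x) * c x

theorem expPairing_eq_fourierLaplace (θ : 𝓓(halfLine, ℂ)) : expPairing θ = fourierLaplace θ := rfl

theorem differentiable_fourierLaplace {c : ℝ → ℂ} (hc : Continuous c) (hcs : HasCompactSupport c) :
    Differentiable ℂ (fourierLaplace c) := by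
  have h := (differentiable_integral_mul_exp hc hcs).comp (differentiable_id (𝕜 := ℂ)).neg
  have e : fourierLaplace c = (fun w => ∫ t : ℝ, c t * Complex.exp (-Complex.I * w * t)) ∘ (-id) := by
    ext k
    refine integral_congr_ae (.of_forall fun x => ?_)
    simp [mul_comm]
  rw [e]
  exact h

theorem fourierLaplace_deriv {c : ℝ → ℂ} (hc : ContDiff ℝ 1 c) (hcs : HasCompactSupport c) (k : ℂ) :
    fourierLaplace (deriv c) k = -(Complex.I * k) * fourierLaplace c k := by
  have he : ∀ x : ℝ, HasDerivAt (fun x : ℝ => Complex.exp (Complex.I * k * x))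
      (Complex.I * k * Complex.exp (Complex.I * k * x)) x := by
    intro x
    have h1 : HasDerivAt (fun x : ℝ => Complex.I * k * (x : ℂ)) (Complex.I * k) x := by
      simpa using (Complex.ofRealCLM.hasDerivAt (x := x)).const_mul (Complex.I * k)
    simpa [mul_comm] using h1.cexp
  have hce : Continuous fun x : ℝ => Complex.exp (Complex.I * k * x) := by fun_prop
  have hcd := hc.continuous_deriv le_rfl
  have h := integral_mul_deriv_eq_deriv_mul_of_integrable (u := fun x : ℝ =>
    Complex.exp (Complex.I * k * x)) (v := c) (fun x _ => he x)
    (fun x _ => (hc.differentiable one_ne_zero x).hasDerivAt)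
    ((hce.mul hcd).integrable_of_hasCompactSupport hcs.deriv.mul_left)
    (((continuous_const.mul hce).mul hc.continuous).integrable_of_hasCompactSupport hcs.mul_left)
    ((hce.mul hc.continuous).integrable_of_hasCompactSupport hcs.mul_left)
  rw [fourierLaplace, h, fourierLaplace, ← integral_const_mul, ← integral_neg]
  refine integral_congr_ae (.of_forall fun x => ?_)
  simp only
  ring

theorem fourierLaplace_iteratedDeriv {c : ℝ → ℂ} (hc : ContDiff ℝ ∞ c) (hcs : HasCompactSupport c)
    (n : ℕ) (k : ℂ) :
    fourierLaplace (iteratedDeriv n c) k = (-(Complex.I * k)) ^ n * fourierLaplace c k := by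
  have hsupp : ∀ n, HasCompactSupport (iteratedDeriv n c) := fun n => by
    induction n with
    | zero => simpa using hcs
    | succ n ih => rw [iteratedDeriv_succ]; exact ih.deriv
  induction n with
  | zero => simp
  | succ n ih =>
    rw [iteratedDeriv_succ, fourierLaplace_deriv _ (hsupp n), ih, pow_succ]
    · ring
    · rw [iteratedDeriv_eq_iterate]
      exact (ContDiff.iterate_deriv n hc).of_le (by exact_mod_cast le_top)

/-- Repeated integration by parts. Only the size of the exponential on the support of c enters, so
the estimate serves both complex k in the upper half-plane and frequencies ω of bounded imaginary
part. -/
theorem exists_pow_mul_fourierLaplace_le {c : ℝ → ℂ} (hc : ContDiff ℝ ∞ c)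
    (hcs : HasCompactSupport c) (n : ℕ) : ∃ C, 0 ≤ C ∧ ∀ (k : ℂ) (B : ℝ),
      (∀ x ∈ tsupport c, ‖Complex.exp (Complex.I * k * x)‖ ≤ B) →
      ‖k‖ ^ n * ‖fourierLaplace c k‖ ≤ C * B := by
  have hts : tsupport (iteratedDeriv n c) ⊆ tsupport c := by
    rw [iteratedDeriv_eq_equiv_comp]
    refine (tsupport_comp_subset (by simp) _).trans (tsupport_iteratedFDeriv_subset n)
  have hcn : Continuous (iteratedDeriv n c) := hc.continuous_iteratedDeriv n (by exact_mod_cast le_top)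
  have hcsn : HasCompactSupport (iteratedDeriv n c) :=
    hcs.of_isClosed_subset (isClosed_tsupport _) hts
  refine ⟨∫ x, ‖iteratedDeriv n c x‖, integral_nonneg fun x => norm_nonneg _, fun k B hB => ?_⟩
  have e : ‖k‖ ^ n * ‖fourierLaplace c k‖ = ‖fourierLaplace (iteratedDeriv n c) k‖ := by
    rw [fourierLaplace_iteratedDeriv hc hcs, norm_mul, norm_pow, norm_neg, norm_mul, Complex.norm_I,
      one_mul]
  rw [e, fourierLaplace, ← integral_mul_const]
  refine norm_integral_le_of_norm_le ((hcn.integrable_of_hasCompactSupport hcsn).norm.mul_const B)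
    (.of_forall fun x => ?_)
  by_cases hx : x ∈ tsupport (iteratedDeriv n c)
  · rw [norm_mul, mul_comm]
    gcongr
    exact hB x (hts hx)
  · simp [image_eq_zero_of_notMem_tsupport hx]

theorem test_lineDeriv_apply {Ω : Opens ℝ} (θ : 𝓓(Ω, ℂ)) : ⇑(∂_{(1 : ℝ)} θ : 𝓓(Ω, ℂ)) = deriv θ := by
  ext x
  rw [TestFunction.lineDerivOp_eq_lineDerivCLM ℝ, TestFunction.lineDerivCLM_apply_of_le (by simp),
    lineDeriv]
  simp only [smul_eq_mul, mul_one]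
  have := deriv_comp_const_add (θ : ℝ → ℂ) x 0
  simpa using this

theorem expPairing_lineDeriv (θ : 𝓓(halfLine, ℂ)) (k : ℂ) :
    expPairing (∂_{(1 : ℝ)} θ) k = -(Complex.I * k) * expPairing θ k := by
  rw [expPairing_eq_fourierLaplace, test_lineDeriv_apply, expPairing_eq_fourierLaplace]
  exact fourierLaplace_deriv (θ.contDiff.of_le (by exact_mod_cast le_top)) θ.hasCompactSupport k

theorem differentiable_expPairing (θ : 𝓓(halfLine, ℂ)) : Differentiable ℂ (expPairing θ) :=
  differentiable_fourierLaplace θ.contDiff.continuous θ.hasCompactSupport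

theorem norm_exp_mul_le_one {k : ℂ} (hk : 0 ≤ k.im) {x : ℝ} (hx : 0 ≤ x) :
    ‖Complex.exp (Complex.I * k * x)‖ ≤ 1 := by
  rw [Complex.norm_exp]
  refine Real.exp_le_one_iff.mpr ?_
  have : (Complex.I * k * x).re = -(k.im * x) := by simp
  rw [this]
  nlinarith [mul_nonneg hk hx]

theorem exists_pow_mul_expPairing_le (θ : 𝓓(halfLine, ℂ)) (n : ℕ) : ∃ C, 0 ≤ C ∧
    ∀ k : ℂ, 0 ≤ k.im → ‖k‖ ^ n * ‖expPairing θ k‖ ≤ C := by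
  obtain ⟨C, hC, h⟩ := exists_pow_mul_fourierLaplace_le θ.contDiff θ.hasCompactSupport n
  refine ⟨C, hC, fun k hk => ?_⟩
  have := h k 1 fun x hx => norm_exp_mul_le_one hk (le_of_lt (θ.tsupport_subset hx))
  rwa [mul_one] at this

/-! ### Families of exponential integrals -/

theorem hasDerivAt_exp_mul (c : ℂ) (x : ℝ) :
    HasDerivAt (fun x : ℝ => Complex.exp (c * x)) (c * Complex.exp (c * x)) x := by
  have h1 : HasDerivAt (fun x : ℝ => c * (x : ℂ)) c x := by
    simpa using (Complex.ofRealCLM.hasDerivAt (x := x)).const_mul c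
  simpa [mul_comm] using h1.cexp

theorem norm_exp_sub_exp_le {S : Set ℝ} (hS : Convex ℝ S) {c : ℂ} {M : ℝ}
    (hM : ∀ x ∈ S, ‖Complex.exp (c * x)‖ ≤ M) {x y : ℝ} (hx : x ∈ S) (hy : y ∈ S) :
    ‖Complex.exp (c * y) - Complex.exp (c * x)‖ ≤ ‖c‖ * M * |y - x| := by
  refine hS.norm_image_sub_le_of_norm_hasDerivWithin_le (f := fun x : ℝ => Complex.exp (c * x))
    (fun z _ => (hasDerivAt_exp_mul c z).hasDerivWithinAt) (fun z hz => ?_) hx hy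
  rw [norm_mul]
  exact mul_le_mul_of_nonneg_left (hM z hz) (norm_nonneg _)

/-- The mean value inequality, applied first to the derivative and then to the remainder on the
segment from x to y. Staying on the segment allows one-sided derivatives at the ends of S, where the
exponential is bounded only on one side. -/
theorem norm_exp_taylor_le {S : Set ℝ} (hS : Convex ℝ S) {c : ℂ} {M : ℝ}
    (hM : ∀ x ∈ S, ‖Complex.exp (c * x)‖ ≤ M) {x y : ℝ} (hx : x ∈ S) (hy : y ∈ S) :
    ‖Complex.exp (c * y) - Complex.exp (c * x) - (y - x) * (c * Complex.exp (c * x))‖ ≤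
      ‖c‖ ^ 2 * M * |y - x| ^ 2 := by
  have hM0 : 0 ≤ M := (norm_nonneg _).trans (hM x hx)
  have hseg : segment ℝ x y ⊆ S := hS.segment_subset hx hy
  have hd : ∀ z ∈ segment ℝ x y, |z - x| ≤ |y - x| := fun z hz => by
    obtain ⟨t, ⟨h0, h1⟩, rfl⟩ := (segment_eq_image' ℝ x y ▸ hz)
    simp only [smul_eq_mul, add_sub_cancel_left, abs_mul, abs_of_nonneg h0]
    exact mul_le_of_le_one_left (abs_nonneg _) h1
  have := (convex_segment x y).norm_image_sub_le_of_norm_hasDerivWithin_le (𝕜 := ℝ)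
    (f := fun z : ℝ => Complex.exp (c * z) - z * (c * Complex.exp (c * x)))
    (f' := fun z => c * Complex.exp (c * z) - 1 * (c * Complex.exp (c * x)))
    (C := ‖c‖ ^ 2 * M * |y - x|)
    (fun z _ => ((hasDerivAt_exp_mul c z).sub
      ((Complex.ofRealCLM.hasDerivAt (x := z)).mul_const _)).hasDerivWithinAt) (fun z hz => ?_)
    (left_mem_segment ℝ x y) (right_mem_segment ℝ x y)
  · refine le_trans (le_of_eq ?_) (this.trans (le_of_eq ?_))
    · congr 1; ring
    · rw [Real.norm_eq_abs]; ring
  · rw [one_mul, ← mul_sub, norm_mul]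
    calc _ ≤ ‖c‖ * (‖c‖ * M * |z - x|) := by
          gcongr; exact norm_exp_sub_exp_le hS hM hx (hseg hz)
      _ ≤ ‖c‖ * (‖c‖ * M * |y - x|) := mul_le_mul_of_nonneg_left
          (mul_le_mul_of_nonneg_left (hd z hz) (by positivity)) (norm_nonneg _)
      _ = _ := by ring

theorem iteratedDerivWithin_of_hasDerivWithinAt {F : ℕ → ℝ → ℂ} {S : Set ℝ} (hu : UniqueDiffOn ℝ S)
    (h : ∀ n, ∀ x ∈ S, HasDerivWithinAt (F n) (F (n + 1) x) S x) (n : ℕ) {x : ℝ} (hx : x ∈ S) :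
    iteratedDerivWithin n (F 0) S x = F n x := by
  induction n generalizing x with
  | zero => rw [iteratedDerivWithin_zero]
  | succ n ih =>
    rw [iteratedDerivWithin_succ, derivWithin_congr (fun y hy => ih hy) (ih hx)]
    exact (h n x hx).derivWithin (hu x hx)

theorem contDiffOn_of_hasDerivWithinAt {F : ℕ → ℝ → ℂ} {S : Set ℝ} (hu : UniqueDiffOn ℝ S)
    (h : ∀ n, ∀ x ∈ S, HasDerivWithinAt (F n) (F (n + 1) x) S x) : ContDiffOn ℝ ∞ (F 0) S := by
  refine contDiffOn_of_differentiableOn_deriv fun m _ => ?_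
  refine DifferentiableOn.congr (f := F m) (fun x hx => (h m x hx).differentiableWithinAt)
    fun x hx => iteratedDerivWithin_of_hasDerivWithinAt hu h m hx

/-- The `n`-th derivative of the exponential integral `∫ e^{c x} B`. -/
def expIntegral {α : Type*} [MeasurableSpace α] (μ : Measure α) (c B : α → ℂ) (n : ℕ) (x : ℝ) : ℂ :=
  ∫ p, c p ^ n * Complex.exp (c p * x) * B p ∂μ

section expIntegral

variable {α : Type*} [MeasurableSpace α] {μ : Measure α} {c B : α → ℂ} {S : Set ℝ} {M : ℝ}

theorem integrable_expIntegral (hc : Measurable c) (hB : Measurable B)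
    (hM : ∀ᵐ p ∂μ, ∀ x ∈ S, ‖Complex.exp (c p * x)‖ ≤ M)
    (hint : ∀ n : ℕ, Integrable (fun p => c p ^ n * B p) μ) (n : ℕ) {x : ℝ} (hx : x ∈ S) :
    Integrable (fun p => c p ^ n * Complex.exp (c p * x) * B p) μ := by
  refine ((hint n).norm.const_mul M).mono' (by fun_prop) (hM.mono fun p hp => ?_)
  rw [norm_mul, norm_mul, norm_mul]
  have := mul_le_mul_of_nonneg_left (hp x hx) (mul_nonneg (norm_nonneg (c p ^ n)) (norm_nonneg (B p)))
  linarith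

/-- The Taylor remainder is integrated against B: the exponentials are bounded on S and the moment
of order n + 2 is finite, so the error is quadratic in y - x. -/
theorem hasDerivWithinAt_expIntegral (hS : Convex ℝ S) (hc : Measurable c) (hB : Measurable B)
    (hM : ∀ᵐ p ∂μ, ∀ x ∈ S, ‖Complex.exp (c p * x)‖ ≤ M)
    (hint : ∀ n : ℕ, Integrable (fun p => c p ^ n * B p) μ) (n : ℕ) {x : ℝ} (hx : x ∈ S) :
    HasDerivWithinAt (expIntegral μ c B n) (expIntegral μ c B (n + 1) x) S x := by
  have hi := fun m {y} (hy : y ∈ S) => integrable_expIntegral hc hB hM hint m hy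
  set L := ∫ p, M * ‖c p ^ (n + 2) * B p‖ ∂μ with hL
  have key : ∀ y ∈ S, ‖expIntegral μ c B n y - expIntegral μ c B n x -
      (y - x) • expIntegral μ c B (n + 1) x‖ ≤ L * |y - x| ^ 2 := by
    intro y hy
    have hsub : expIntegral μ c B n y - expIntegral μ c B n x -
        (y - x) • expIntegral μ c B (n + 1) x = ∫ p, (c p ^ n * Complex.exp (c p * y) * B p -
          c p ^ n * Complex.exp (c p * x) * B p -
          (y - x) • (c p ^ (n + 1) * Complex.exp (c p * x) * B p)) ∂μ := by
      rw [integral_sub, integral_sub, integral_smul]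
      · rfl
      · exact hi n hy
      · exact hi n hx
      · exact (hi n hy).sub (hi n hx)
      · exact (hi (n + 1) hx).smul (y - x)
    rw [hsub, hL, ← integral_mul_const]
    refine norm_integral_le_of_norm_le ((((hint (n + 2)).norm.const_mul M)).mul_const _)
      (hM.mono fun p hp => ?_)
    have h1 := norm_exp_taylor_le hS hp hx hy
    have e : c p ^ n * Complex.exp (c p * y) * B p - c p ^ n * Complex.exp (c p * x) * B p -
        (y - x) • (c p ^ (n + 1) * Complex.exp (c p * x) * B p) = (c p ^ n * B p) *
        (Complex.exp (c p * y) - Complex.exp (c p * x) - (y - x) * (c p * Complex.exp (c p * x))) := by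
      rw [Complex.real_smul]; push_cast; ring
    rw [e, norm_mul]
    refine (mul_le_mul_of_nonneg_left h1 (norm_nonneg _)).trans (le_of_eq ?_)
    rw [norm_mul, norm_mul, norm_pow, norm_pow]; ring
  rw [hasDerivWithinAt_iff_isLittleO]
  have h1 : (fun y => expIntegral μ c B n y - expIntegral μ c B n x -
      (y - x) • expIntegral μ c B (n + 1) x) =O[𝓝[S] x] fun y => |y - x| ^ 2 := by
    refine Asymptotics.IsBigO.of_bound L ?_
    filter_upwards [self_mem_nhdsWithin] with y hy
    simpa using key y hy
  refine h1.trans_isLittleO ?_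
  have h2 : (fun y : ℝ => (y - x) ^ 2) =o[𝓝 x] fun y => y - x := by
    have := (Asymptotics.isLittleO_pow_id (𝕜 := ℝ) (n := 2) one_lt_two).comp_tendsto
      (k := fun y : ℝ => y - x) (l' := 𝓝 x) (by simpa using (continuous_sub_right x).tendsto x)
    simpa [Function.comp_def] using this
  simpa using h2.mono nhdsWithin_le_nhds

end expIntegral

/-! ### Growth and decay on the contours -/

/-- The closed sector to the right of (`ε = 1`) or to the left of (`ε = -1`) the upper imaginary axis,
outside the circle of radius `R`. -/
def sector (ε R : ℝ) : Set ℂ := {k | R ≤ ‖k‖ ∧ 0 ≤ ε * k.re ∧ 0 ≤ k.im}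

/-- The set of points of the contour. -/
def contourSet (ε R : ℝ) : Set ℂ := {k | k ∈ sector ε R ∧ (k.re = 0 ∨ k.im = 0 ∨ ‖k‖ = R)}

theorem contourSet_subset (ε R : ℝ) : contourSet ε R ⊆ sector ε R := fun _ hk => hk.1

/-- Polynomial growth on a set. -/
def PolyGrowth (S : Set ℂ) (f : ℂ → ℂ) : Prop :=
  ∃ (N : ℕ) (C : ℝ), 0 ≤ C ∧ ∀ k ∈ S, ‖f k‖ ≤ C * ‖k‖ ^ N

/-- Decay faster than any power on a set. -/
def RapidDecay (S : Set ℂ) (f : ℂ → ℂ) : Prop := ∀ n : ℕ, ∃ C : ℝ, 0 ≤ C ∧ ∀ k ∈ S, ‖k‖ ^ n * ‖f k‖ ≤ C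

theorem PolyGrowth.mono {S S' : Set ℂ} {f : ℂ → ℂ} (h : PolyGrowth S f) (hS : S' ⊆ S) :
    PolyGrowth S' f := by
  obtain ⟨N, C, hC, h⟩ := h
  exact ⟨N, C, hC, fun k hk => h k (hS hk)⟩

theorem RapidDecay.mono {S S' : Set ℂ} {f : ℂ → ℂ} (h : RapidDecay S f) (hS : S' ⊆ S) :
    RapidDecay S' f := fun n => by
  obtain ⟨C, hC, h⟩ := h n
  exact ⟨C, hC, fun k hk => h k (hS hk)⟩

theorem PolyGrowth.of_le {S : Set ℂ} {f g : ℂ → ℂ} (h : PolyGrowth S f) {C : ℝ} (hC : 0 ≤ C)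
    (hg : ∀ k ∈ S, ‖g k‖ ≤ C * ‖f k‖) : PolyGrowth S g := by
  obtain ⟨N, D, hD, h⟩ := h
  refine ⟨N, C * D, by positivity, fun k hk => (hg k hk).trans ?_⟩
  rw [mul_assoc]
  exact mul_le_mul_of_nonneg_left (h k hk) hC

theorem PolyGrowth.mul {S : Set ℂ} {f g : ℂ → ℂ} (hf : PolyGrowth S f) (hg : PolyGrowth S g) :
    PolyGrowth S fun k => f k * g k := by
  obtain ⟨N, C, hC, hf⟩ := hf
  obtain ⟨M, D, hD, hg⟩ := hg
  refine ⟨N + M, C * D, by positivity, fun k hk => ?_⟩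
  rw [norm_mul]
  refine (mul_le_mul (hf k hk) (hg k hk) (norm_nonneg _) (by positivity)).trans (le_of_eq ?_)
  ring

theorem PolyGrowth.const (S : Set ℂ) (c : ℂ) : PolyGrowth S fun _ => c :=
  ⟨0, ‖c‖, norm_nonneg _, fun k _ => by simp⟩

theorem PolyGrowth.id (S : Set ℂ) : PolyGrowth S fun k => k := ⟨1, 1, zero_le_one, fun k _ => by simp⟩

theorem PolyGrowth.pow {S : Set ℂ} {f : ℂ → ℂ} (hf : PolyGrowth S f) (n : ℕ) :
    PolyGrowth S fun k => f k ^ n := by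
  induction n with
  | zero => simpa using PolyGrowth.const S 1
  | succ n ih => simpa [pow_succ] using ih.mul hf

theorem PolyGrowth.add {S : Set ℂ} (hS : ∀ k ∈ S, 1 ≤ ‖k‖) {f g : ℂ → ℂ} (hf : PolyGrowth S f)
    (hg : PolyGrowth S g) : PolyGrowth S fun k => f k + g k := by
  obtain ⟨N, C, hC, hf⟩ := hf
  obtain ⟨M, D, hD, hg⟩ := hg
  refine ⟨N + M, C + D, by positivity, fun k hk => (norm_add_le _ _).trans ?_⟩
  have h1 : ‖k‖ ^ N ≤ ‖k‖ ^ (N + M) := pow_le_pow_right₀ (hS k hk) (by omega)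
  have h2 : ‖k‖ ^ M ≤ ‖k‖ ^ (N + M) := pow_le_pow_right₀ (hS k hk) (by omega)
  nlinarith [hf k hk, hg k hk, mul_le_mul_of_nonneg_left h1 hC, mul_le_mul_of_nonneg_left h2 hD]

theorem RapidDecay.mul {S : Set ℂ} {f g : ℂ → ℂ} (hf : RapidDecay S f) (hg : PolyGrowth S g) :
    RapidDecay S fun k => f k * g k := fun n => by
  obtain ⟨N, D, hD, hg⟩ := hg
  obtain ⟨C, hC, hf⟩ := hf (n + N)
  refine ⟨C * D, by positivity, fun k hk => ?_⟩
  rw [norm_mul]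
  calc ‖k‖ ^ n * (‖f k‖ * ‖g k‖) ≤ ‖k‖ ^ n * (‖f k‖ * (D * ‖k‖ ^ N)) := by
        gcongr; exact hg k hk
    _ = ‖k‖ ^ (n + N) * ‖f k‖ * D := by ring
    _ ≤ C * D := by gcongr; exact hf k hk

theorem RapidDecay.le_div_sq {S : Set ℂ} (hS : ∀ k ∈ S, 1 ≤ ‖k‖) {f : ℂ → ℂ} (hf : RapidDecay S f) :
    ∃ C : ℝ, 0 ≤ C ∧ ∀ k ∈ S, ‖f k‖ ≤ C / ‖k‖ ^ 2 := by
  obtain ⟨C, hC, h⟩ := hf 2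
  refine ⟨C, hC, fun k hk => ?_⟩
  have := hS k hk
  rw [le_div_iff₀ (by positivity), mul_comm]
  exact h k hk

theorem one_le_norm_of_mem_sector {ε γ δ : ℝ} : ∀ k ∈ sector ε (largeRadius γ δ), 1 ≤ ‖k‖ :=
  fun _ hk => by linarith [two_le_largeRadius γ δ, hk.1]

theorem rapidDecay_expPairing (θ : 𝓓(halfLine, ℂ)) (ε R : ℝ) :
    RapidDecay (sector ε R) (expPairing θ) := fun n => by
  obtain ⟨C, hC, h⟩ := exists_pow_mul_expPairing_le θ n
  exact ⟨C, hC, fun k hk => h k hk.2.2⟩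

/-- Im ω has the sign of Im k² = 2 Re k Im k, which is that of ε in the sector. -/
theorem im_disp_nonneg {ε R : ℝ} (hR : 1 < R) {k : ℂ} (hk : k ∈ sector ε R) :
    0 ≤ ε * (disp k).im := by
  obtain ⟨c, hc, h⟩ := exists_disp_im (hR.trans_le hk.1)
  have : (k ^ 2).im = 2 * (k.re * k.im) := by rw [sq, Complex.mul_im]; ring
  rw [h, this]
  have h2 := mul_nonneg hk.2.1 hk.2.2
  nlinarith [mul_nonneg hc.le h2]

theorem polyGrowth_disp {ε R : ℝ} (hR : 2 ≤ R) : PolyGrowth (sector ε R) disp :=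
  ⟨2, 2, by norm_num, fun _ hk => (norm_disp_bounds (hR.trans hk.1)).2⟩

/-- The argument -εω lies in the lower half-plane throughout the sector, which is where the
transform is polynomially bounded; 1 + 2|k|² ≤ |k|⁴ converts the powers. -/
theorem polyGrowth_comp_disp {ε R : ℝ} (hε : ε = 1 ∨ ε = -1) (hR : 2 ≤ R) {Φ : ℂ → ℂ}
    (hΦ : ∃ (K : ℝ) (n : ℕ), 0 ≤ K ∧ ∀ w : ℂ, w.im ≤ 0 → ‖Φ w‖ ≤ K * (1 + ‖w‖) ^ n) :
    PolyGrowth (sector ε R) fun k => Φ (-(ε * disp k)) := by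
  obtain ⟨K, n, hK, h⟩ := hΦ
  refine ⟨4 * n, K, hK, fun k hk => (h _ ?_).trans ?_⟩
  · have := im_disp_nonneg (by linarith) hk
    simpa using this
  · have h2 : 2 ≤ ‖k‖ := hR.trans hk.1
    rw [pow_mul]
    gcongr
    rw [norm_neg, norm_mul, Complex.norm_real, Real.norm_eq_abs, abs_of_sign hε, one_mul]
    have h3 := (norm_disp_bounds h2).2
    have h4 : 4 ≤ ‖k‖ ^ 2 := by nlinarith
    nlinarith

theorem polyGrowth_densityS {ε γ δ σ σ' : ℝ} (hε : ε = 1 ∨ ε = -1) {φ ψ : 𝓢'(ℝ, ℂ)} {Φ Ψ : ℂ → ℂ}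
    (hΦ : IsTimeTransform σ φ Φ) (hΨ : IsTimeTransform σ' ψ Ψ) :
    PolyGrowth (sector ε (largeRadius γ δ)) (densityS ε γ δ Φ Ψ) := by
  have hR := two_le_largeRadius γ δ
  have h1 : PolyGrowth (sector ε (largeRadius γ δ)) (psiCoef ε γ δ) :=
    ⟨0, 288, by norm_num, fun k hk => (norm_psiCoef_le (abs_of_sign hε) γ δ hk.1).trans (by
      rw [pow_zero, mul_one]; exact div_le_self (by norm_num) (one_le_norm_of_mem_sector k hk))⟩
  have h2 : PolyGrowth (sector ε (largeRadius γ δ)) (phiCoef ε γ δ) :=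
    ⟨0, 288, by norm_num, fun k hk => by simpa using norm_phiCoef_le (abs_of_sign hε) γ δ hk.1⟩
  exact (h1.mul (polyGrowth_comp_disp hε hR hΨ.growth)).add one_le_norm_of_mem_sector
    (h2.mul (polyGrowth_comp_disp hε hR hΦ.growth))

/-- The imaginary part vanishes on the axes and is bounded by |ω| on the arc. Inside the sector it
is unbounded, so for t > 0 the time exponential is controlled only on the contour. -/
theorem abs_im_disp_le {ε R : ℝ} (hR : 2 ≤ R) {k : ℂ} (hk : k ∈ contourSet ε R) :
    |(disp k).im| ≤ 2 * R ^ 2 := by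
  have hk2 : 2 ≤ ‖k‖ := hR.trans hk.1.1
  have hax : (k ^ 2).im = 0 → |(disp k).im| ≤ 2 * R ^ 2 := fun h => by
    obtain ⟨c, hc, h'⟩ := exists_disp_im (by linarith : 1 < ‖k‖)
    rw [h', h, mul_zero, abs_zero]; positivity
  have hsq : (k ^ 2).im = 2 * (k.re * k.im) := by rw [sq, Complex.mul_im]; ring
  rcases hk.2 with h | h | h
  · exact hax (by rw [hsq, h]; ring)
  · exact hax (by rw [hsq, h]; ring)
  · refine (Complex.abs_im_le_norm _).trans ((norm_disp_bounds hk2).2.trans_eq ?_)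
    rw [h]

theorem norm_exp_disp_le {ε R : ℝ} (hε : ε = 1 ∨ ε = -1) (hR : 2 ≤ R) {k : ℂ}
    (hk : k ∈ contourSet ε R) {T t : ℝ} (ht : t ∈ Icc 0 T) :
    ‖Complex.exp (-(ε * Complex.I * disp k) * t)‖ ≤ Real.exp (2 * R ^ 2 * T) := by
  rw [Complex.norm_exp]
  refine Real.exp_le_exp.mpr ?_
  have e : (-(ε * Complex.I * disp k) * t).re = ε * (disp k).im * t := by simp
  rw [e]
  have h1 := abs_im_disp_le hR hk
  have h2 : ε * (disp k).im ≤ 2 * R ^ 2 := by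
    refine (le_abs_self _).trans ?_
    rwa [abs_mul, abs_of_sign hε, one_mul]
  exact mul_le_mul h2 ht.2 ht.1 (by positivity)

/-! ### The contour as a measure -/

/-- The contour, as a measure on pairs (point, tangent vector). -/
def contourMeasure (ε R : ℝ) : Measure (ℂ × ℂ) :=
  (volume.restrict (Ioi R)).map (fun r : ℝ => ((ε : ℂ) * r, (1 : ℂ))) +
  (volume.restrict (Ioc (Real.pi / 4 * (1 - ε)) (Real.pi / 4 * (1 - ε) + Real.pi / 2))).map
    (fun ϑ : ℝ => (circleMap 0 R ϑ, -(Complex.I * circleMap 0 R ϑ))) +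
  (volume.restrict (Ioi R)).map (fun r : ℝ => (Complex.I * r, -(ε * Complex.I)))

theorem measurable_rayMap (ε : ℝ) : Measurable fun r : ℝ => ((ε : ℂ) * r, (1 : ℂ)) := by fun_prop

theorem measurable_arcMap (R : ℝ) :
    Measurable fun ϑ : ℝ => (circleMap 0 R ϑ, -(Complex.I * circleMap 0 R ϑ)) := by
  have := (continuous_circleMap 0 R).measurable
  fun_prop

theorem measurable_imagMap (ε : ℝ) : Measurable fun r : ℝ => (Complex.I * (r : ℂ), -(ε * Complex.I)) := by
  fun_prop

instance (ε R : ℝ) : SFinite (contourMeasure ε R) := by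
  unfold contourMeasure; infer_instance

theorem ae_contourMeasure {ε R : ℝ} (hε : ε = 1 ∨ ε = -1) (hR : 1 ≤ R) :
    ∀ᵐ p ∂contourMeasure ε R, p.1 ∈ contourSet ε R ∧ ‖p.2‖ ≤ R := by
  have hmeas : MeasurableSet {p : ℂ × ℂ | p.1 ∈ contourSet ε R ∧ ‖p.2‖ ≤ R} := by
    have h1 : MeasurableSet {p : ℂ × ℂ | R ≤ ‖p.1‖} := measurableSet_le (by fun_prop) (by fun_prop)
    have h2 : MeasurableSet {p : ℂ × ℂ | 0 ≤ ε * p.1.re} :=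
      measurableSet_le (by fun_prop) (by fun_prop)
    have h3 : MeasurableSet {p : ℂ × ℂ | 0 ≤ p.1.im} := measurableSet_le (by fun_prop) (by fun_prop)
    have h4 : MeasurableSet {p : ℂ × ℂ | p.1.re = 0} := measurableSet_eq_fun (by fun_prop) (by fun_prop)
    have h5 : MeasurableSet {p : ℂ × ℂ | p.1.im = 0} := measurableSet_eq_fun (by fun_prop) (by fun_prop)
    have h6 : MeasurableSet {p : ℂ × ℂ | ‖p.1‖ = R} := measurableSet_eq_fun (by fun_prop) (by fun_prop)
    have h7 : MeasurableSet {p : ℂ × ℂ | ‖p.2‖ ≤ R} := measurableSet_le (by fun_prop) (by fun_prop)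
    exact ((h1.inter (h2.inter h3)).inter (h4.union (h5.union h6))).inter h7
  have hεε : ε * ε = 1 := by rcases hε with rfl | rfl <;> norm_num
  rw [contourMeasure, ae_add_measure_iff, ae_add_measure_iff,
    ae_map_iff (measurable_rayMap ε).aemeasurable hmeas,
    ae_map_iff (measurable_arcMap R).aemeasurable hmeas,
    ae_map_iff (measurable_imagMap ε).aemeasurable hmeas]
  refine ⟨⟨(ae_restrict_mem measurableSet_Ioi).mono fun r hr => ?_,
    (ae_restrict_mem measurableSet_Ioc).mono fun ϑ hϑ => ?_⟩,
    (ae_restrict_mem measurableSet_Ioi).mono fun r hr => ?_⟩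
  · have hr : R < r := hr
    refine ⟨⟨⟨?_, ?_, ?_⟩, .inr (.inl ?_)⟩, by simpa using hR⟩
    · rw [norm_ray hε (by linarith)]; exact hr.le
    · simp only [Complex.re_ofReal_mul, Complex.ofReal_re]
      rw [← mul_assoc, hεε, one_mul]; linarith
    · simp
    · simp
  · have hn : ‖circleMap 0 R ϑ‖ = R := by rw [norm_circleMap_zero, abs_of_pos (by linarith)]
    refine ⟨⟨⟨hn.ge, ?_, ?_⟩, .inr (.inr hn)⟩, ?_⟩
    · rw [circleMap_eq_cos_sin]
      simp only [Complex.add_re, Complex.ofReal_re, Complex.mul_re, Complex.I_re, Complex.I_im,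
        Complex.ofReal_im]
      have : 0 ≤ ε * Real.cos ϑ := by
        rcases hε with rfl | rfl
        · rw [one_mul]
          exact Real.cos_nonneg_of_mem_Icc ⟨by linarith [hϑ.1, Real.pi_pos], by linarith [hϑ.2]⟩
        · have := Real.cos_nonpos_of_pi_div_two_le_of_le (x := ϑ) (by linarith [hϑ.1])
            (by linarith [hϑ.2, Real.pi_pos])
          linarith
      nlinarith
    · rw [circleMap_eq_cos_sin]
      simp only [Complex.add_im, Complex.ofReal_re, Complex.mul_im, Complex.I_re, Complex.I_im,
        Complex.ofReal_im]
      have : 0 ≤ Real.sin ϑ := by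
        have := Real.pi_pos
        refine Real.sin_nonneg_of_mem_Icc ⟨?_, ?_⟩ <;> rcases hε with rfl | rfl <;>
          linarith [hϑ.1, hϑ.2]
      nlinarith
    · simp only [norm_neg, norm_mul, Complex.norm_I, one_mul]; exact hn.le
  · have hr : R < r := hr
    refine ⟨⟨⟨?_, ?_, ?_⟩, .inl ?_⟩, ?_⟩
    · rw [norm_imag (by linarith)]; exact hr.le
    · simp
    · simp; linarith
    · simp
    · simpa [abs_of_sign hε] using hR

theorem integrable_contourMeasure {ε R : ℝ} (hε : ε = 1 ∨ ε = -1) (hR : 1 ≤ R) {f : ℂ → ℂ}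
    (hf : Measurable f) {C : ℝ} (h : ∀ k ∈ contourSet ε R, ‖f k‖ ≤ C / ‖k‖ ^ 2) :
    Integrable (fun p : ℂ × ℂ => f p.1 * p.2) (contourMeasure ε R) := by
  have h0 : Integrable (fun p : ℂ × ℂ => C * R / ‖p.1‖ ^ 2) (contourMeasure ε R) := by
    have hm : Measurable fun p : ℂ × ℂ => C * R / ‖p.1‖ ^ 2 := by fun_prop
    rw [contourMeasure, integrable_add_measure, integrable_add_measure,
      integrable_map_measure hm.aestronglyMeasurable (measurable_rayMap ε).aemeasurable,
      integrable_map_measure hm.aestronglyMeasurable (measurable_arcMap R).aemeasurable,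
      integrable_map_measure hm.aestronglyMeasurable (measurable_imagMap ε).aemeasurable]
    have hray := integrableOn_div_sq (by linarith : 0 < R) (C * R)
    refine ⟨⟨hray.congr_fun (fun r hr => ?_) measurableSet_Ioi, ?_⟩,
      hray.congr_fun (fun r hr => ?_) measurableSet_Ioi⟩
    · have hr : R < r := hr
      simp only [Function.comp_apply]
      rw [norm_ray hε (by linarith)]
    · have : ((fun p : ℂ × ℂ => C * R / ‖p.1‖ ^ 2) ∘ fun ϑ : ℝ =>
          (circleMap 0 R ϑ, -(Complex.I * circleMap 0 R ϑ))) = fun _ => C * R / R ^ 2 := by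
        ext ϑ
        simp only [Function.comp_apply]
        rw [norm_circleMap_zero, abs_of_pos (by linarith)]
      rw [this]
      exact integrable_const _
    · have hr : R < r := hr
      simp only [Function.comp_apply]
      rw [norm_imag (by linarith)]
  refine h0.mono' (by fun_prop) ((ae_contourMeasure hε hR).mono fun p hp => ?_)
  rw [norm_mul, mul_div_right_comm]
  exact mul_le_mul (h _ hp.1) hp.2 (norm_nonneg _) ((norm_nonneg _).trans (h _ hp.1))

/-- As a single integral over points with tangent vectors, the contour needs differentiation under
the integral and Fubini only once instead of piece by piece. -/
theorem contourS_eq_integral {ε R : ℝ} (hε : ε = 1 ∨ ε = -1) (hR : 1 ≤ R) {f : ℂ → ℂ}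
    (hf : Measurable f) {C : ℝ} (h : ∀ k ∈ contourSet ε R, ‖f k‖ ≤ C / ‖k‖ ^ 2) :
    contourS ε R f = ∫ p, f p.1 * p.2 ∂contourMeasure ε R := by
  have hm : Measurable fun p : ℂ × ℂ => f p.1 * p.2 := by fun_prop
  have hi := integrable_contourMeasure hε hR hf h
  rw [contourMeasure] at hi ⊢
  rw [integral_add_measure hi.left_of_add_measure hi.right_of_add_measure,
    integral_add_measure hi.left_of_add_measure.left_of_add_measure
      hi.left_of_add_measure.right_of_add_measure,
    integral_map (measurable_rayMap ε).aemeasurable hm.aestronglyMeasurable,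
    integral_map (measurable_arcMap R).aemeasurable hm.aestronglyMeasurable,
    integral_map (measurable_imagMap ε).aemeasurable hm.aestronglyMeasurable]
  rw [contourS, intervalIntegral.integral_of_le (by linarith [Real.pi_pos])]
  simp only [mul_one, mul_neg, integral_neg, integral_mul_const]
  ring

/-! ### The unified transform solution -/

/-- The `j`-th time derivative of the unified transform solution, on the contour of radius
`largeRadius γ δ`. -/
def utmDeriv (γ δ : ℝ) (Φ Ψ : ℂ → ℂ) (j : ℕ) (t : ℝ) (θ : 𝓓(halfLine, ℂ)) : ℂ :=
  -(1 / (2 * Real.pi)) *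
    (contourS 1 (largeRadius γ δ) (fun k => expPairing θ k * timeDensity 1 γ δ Φ Ψ j t k) +
      contourS (-1) (largeRadius γ δ) (fun k => expPairing θ k * timeDensity (-1) γ δ Φ Ψ j t k))

/-- Between the two radii each ray is a compact segment on which f is bounded; the constant is
enlarged accordingly. -/
theorem AxisDecay.extend {ε a' a b : ℝ} (hε : ε = 1 ∨ ε = -1) (ha' : 0 < a') (haa : a' < a)
    {f : ℂ → ℂ} (hf : ContinuousOn f {k | a' < ‖k‖}) (h : AxisDecay ε b f) : AxisDecay ε a f := by
  obtain ⟨C, hC⟩ := h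
  have hc : ∀ c : ℂ, ‖c‖ = 1 → ∃ D, ∀ r ∈ Icc a b, ‖f (c * r) * r ^ 2‖ ≤ D := fun c hc => by
    refine isCompact_Icc.exists_bound_of_continuousOn (f := fun r : ℝ => f (c * r) * (r : ℂ) ^ 2) ?_
    refine ContinuousOn.mul (hf.comp (by fun_prop) fun r hr => ?_) (by fun_prop)
    have : 0 < r := by linarith [hr.1]
    simp only [mem_ofPred_eq, norm_mul, hc, one_mul, Complex.norm_real, Real.norm_of_nonneg this.le]
    linarith [hr.1]
  obtain ⟨D₁, h₁⟩ := hc ε (by simp [abs_of_sign hε])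
  obtain ⟨D₂, h₂⟩ := hc Complex.I Complex.norm_I
  refine ⟨max C (max D₁ D₂), fun r hr => ?_⟩
  have hr0 : 0 < r := by linarith
  rcases le_total b r with hbr | hbr
  · have := hC r hbr
    exact ⟨this.1.trans (by gcongr; exact le_max_left _ _),
      this.2.trans (by gcongr; exact le_max_left _ _)⟩
  · have k₁ := h₁ r ⟨hr, hbr⟩
    have k₂ := h₂ r ⟨hr, hbr⟩
    rw [norm_mul, norm_pow, Complex.norm_real, Real.norm_of_nonneg hr0.le] at k₁ k₂
    rw [le_div_iff₀ (by positivity), le_div_iff₀ (by positivity)]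
    exact ⟨k₁.trans ((le_max_left _ _).trans (le_max_right _ _)),
      k₂.trans ((le_max_right _ _).trans (le_max_right _ _))⟩

theorem axisDecay_of_contourSet {ε R : ℝ} (hε : ε = 1 ∨ ε = -1) (hR : 0 ≤ R) {f : ℂ → ℂ} {C : ℝ}
    (h : ∀ k ∈ contourSet ε R, ‖f k‖ ≤ C / ‖k‖ ^ 2) : AxisDecay ε R f := by
  have hεε : ε * ε = 1 := by rcases hε with rfl | rfl <;> norm_num
  refine ⟨C, fun r hr => ⟨?_, ?_⟩⟩
  · have hn := norm_ray hε (hR.trans hr)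
    have := h (ε * r) ⟨⟨by rw [hn]; exact hr, by
      simp only [Complex.re_ofReal_mul, Complex.ofReal_re]
      rw [← mul_assoc, hεε, one_mul]; linarith, by simp⟩, .inr (.inl (by simp))⟩
    rwa [hn] at this
  · have hn := norm_imag (hR.trans hr)
    have := h (Complex.I * r) ⟨⟨by rw [hn]; exact hr, by simp, by simp; linarith⟩, .inl (by simp)⟩
    rwa [hn] at this

/-! ### Time derivatives, independence of the radius, initial conditions and the equation. -/

section Solution

variable {γ δ σ σ' : ℝ} {φ ψ : 𝓢'(ℝ, ℂ)} {Φ Ψ : ℂ → ℂ}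

theorem rapidDecay_solution (hΦ : IsTimeTransform σ φ Φ) (hΨ : IsTimeTransform σ' ψ Ψ) {ε : ℝ}
    (hε : ε = 1 ∨ ε = -1) (θ : 𝓓(halfLine, ℂ)) (j : ℕ) :
    RapidDecay (sector ε (largeRadius γ δ)) (fun k => expPairing θ k *
      ((-(ε * Complex.I * disp k)) ^ j * densityS ε γ δ Φ Ψ k)) := by
  have hR := two_le_largeRadius γ δ
  have h1 : PolyGrowth (sector ε (largeRadius γ δ)) fun k => -(ε * Complex.I * disp k) :=
    (polyGrowth_disp hR).of_le zero_le_one fun k _ => by simp [abs_of_sign hε]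
  exact (rapidDecay_expPairing θ ε _).mul ((h1.pow j).mul (polyGrowth_densityS hε hΦ hΨ))

theorem exists_timeDensity_bound (hΦ : IsTimeTransform σ φ Φ) (hΨ : IsTimeTransform σ' ψ Ψ) {ε : ℝ}
    (hε : ε = 1 ∨ ε = -1) (θ : 𝓓(halfLine, ℂ)) (j : ℕ) {t : ℝ} (ht : 0 ≤ t) :
    ∃ C, ∀ k ∈ contourSet ε (largeRadius γ δ),
      ‖expPairing θ k * timeDensity ε γ δ Φ Ψ j t k‖ ≤ C / ‖k‖ ^ 2 := by
  have hR := two_le_largeRadius γ δ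
  obtain ⟨C, hC, h⟩ := (rapidDecay_solution (γ := γ) (δ := δ) hΦ hΨ hε θ j).le_div_sq
    one_le_norm_of_mem_sector
  refine ⟨C * Real.exp (2 * largeRadius γ δ ^ 2 * t), fun k hk => ?_⟩
  have h1 := h k hk.1
  have h2 := norm_exp_disp_le hε hR hk (T := t) (t := t) ⟨ht, le_rfl⟩
  have e : expPairing θ k * timeDensity ε γ δ Φ Ψ j t k = expPairing θ k *
      ((-(ε * Complex.I * disp k)) ^ j * densityS ε γ δ Φ Ψ k) *
      Complex.exp (-(ε * Complex.I * disp k) * t) := by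
    rw [timeDensity]; ring
  rw [e, norm_mul, mul_div_right_comm]
  exact mul_le_mul h1 h2 (norm_nonneg _) ((norm_nonneg _).trans h1)

theorem measurable_expPairing_mul (hΦ : IsTimeTransform σ φ Φ) (hΨ : IsTimeTransform σ' ψ Ψ)
    (ε : ℝ) (θ : 𝓓(halfLine, ℂ)) (j : ℕ) (t : ℝ) :
    Measurable fun k => expPairing θ k * timeDensity ε γ δ Φ Ψ j t k :=
  (differentiable_expPairing θ).continuous.measurable.mul
    (measurable_timeDensity ε γ δ hΦ.differentiable.continuous.measurable
      hΨ.differentiable.continuous.measurable j t)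

theorem contourS_timeDensity_eq (hΦ : IsTimeTransform σ φ Φ) (hΨ : IsTimeTransform σ' ψ Ψ) {ε : ℝ}
    (hε : ε = 1 ∨ ε = -1) (θ : 𝓓(halfLine, ℂ)) (j : ℕ) {t : ℝ} (ht : 0 ≤ t) :
    contourS ε (largeRadius γ δ) (fun k => expPairing θ k * timeDensity ε γ δ Φ Ψ j t k) =
      expIntegral (contourMeasure ε (largeRadius γ δ)) (fun p => -(ε * Complex.I * disp p.1))
        (fun p => expPairing θ p.1 * densityS ε γ δ Φ Ψ p.1 * p.2) j t := by
  have hR := two_le_largeRadius γ δ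
  obtain ⟨C, h⟩ := exists_timeDensity_bound (γ := γ) (δ := δ) hΦ hΨ hε θ j ht
  rw [contourS_eq_integral hε (by linarith) (measurable_expPairing_mul hΦ hΨ ε θ j t) h, expIntegral]
  refine integral_congr_ae (.of_forall fun p => ?_)
  simp only [timeDensity]
  ring

theorem hasDerivWithinAt_contourS (hΦ : IsTimeTransform σ φ Φ) (hΨ : IsTimeTransform σ' ψ Ψ) {ε : ℝ}
    (hε : ε = 1 ∨ ε = -1) (θ : 𝓓(halfLine, ℂ)) (j : ℕ) {T t : ℝ} (ht : t ∈ Icc 0 T) :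
    HasDerivWithinAt (fun t => contourS ε (largeRadius γ δ) fun k =>
      expPairing θ k * timeDensity ε γ δ Φ Ψ j t k) (contourS ε (largeRadius γ δ) fun k =>
      expPairing θ k * timeDensity ε γ δ Φ Ψ (j + 1) t k) (Icc 0 T) t := by
  have hR := two_le_largeRadius γ δ
  have hd := measurable_disp
  have hE := (differentiable_expPairing θ).continuous.measurable
  have hD := measurable_densityS ε γ δ hΦ.differentiable.continuous.measurable
    hΨ.differentiable.continuous.measurable
  rw [contourS_timeDensity_eq hΦ hΨ hε θ (j + 1) ht.1]
  refine (hasDerivWithinAt_expIntegral (convex_Icc 0 T) (by fun_prop) (by fun_prop)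
    (M := Real.exp (2 * largeRadius γ δ ^ 2 * T))
    ((ae_contourMeasure hε (by linarith)).mono fun p hp x hx => norm_exp_disp_le hε hR hp.1 hx)
    (fun n => ?_) j ht).congr
    (fun s hs => contourS_timeDensity_eq hΦ hΨ hε θ j hs.1) (contourS_timeDensity_eq hΦ hΨ hε θ j ht.1)
  obtain ⟨C, -, h⟩ := ((rapidDecay_solution (γ := γ) (δ := δ) hΦ hΨ hε θ n).mono
    (contourSet_subset _ _)).le_div_sq fun k hk => one_le_norm_of_mem_sector k hk.1
  refine (integrable_contourMeasure hε (by linarith) (by fun_prop) h).congr (.of_forall fun p => ?_)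
  simp only
  ring

theorem hasDerivWithinAt_utmDeriv (hΦ : IsTimeTransform σ φ Φ) (hΨ : IsTimeTransform σ' ψ Ψ)
    (θ : 𝓓(halfLine, ℂ)) (j : ℕ) {T t : ℝ} (ht : t ∈ Icc 0 T) :
    HasDerivWithinAt (fun t => utmDeriv γ δ Φ Ψ j t θ) (utmDeriv γ δ Φ Ψ (j + 1) t θ) (Icc 0 T) t := by
  have h1 := hasDerivWithinAt_contourS (γ := γ) (δ := δ) hΦ hΨ (.inl rfl) θ j ht
  have h2 := hasDerivWithinAt_contourS (γ := γ) (δ := δ) hΦ hΨ (.inr rfl) θ j ht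
  exact (h1.add h2).const_mul _

theorem differentiableOn_solution {a : ℝ} (ha : AdmissibleRadius γ δ a)
    (hΦ : IsTimeTransform σ φ Φ) (hΨ : IsTimeTransform σ' ψ Ψ) {ε : ℝ}
    (hε : ε = 1 ∨ ε = -1) (θ : 𝓓(halfLine, ℂ)) (j : ℕ) (t : ℝ) :
    DifferentiableOn ℂ (fun k => expPairing θ k * timeDensity ε γ δ Φ Ψ j t k) {k | a < ‖k‖} := by
  intro k hk
  have hk : a < ‖k‖ := hk
  have h1 := differentiable_expPairing θ k
  have h2 := differentiableAt_densityS ha hε hΦ.differentiable hΨ.differentiable hk.le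
  have h3 := differentiableAt_disp (ha.1.trans hk)
  refine DifferentiableAt.differentiableWithinAt ?_
  unfold timeDensity
  fun_prop

/-- Deforming near the arc changes nothing at infinity, so no decay inside the sector is needed. All
estimates can thus be made at one radius determined by γ and δ, whence constants independent of a.
-/
theorem contourS_solution_radius {a : ℝ} (ha : AdmissibleRadius γ δ a)
    (hΦ : IsTimeTransform σ φ Φ) (hΨ : IsTimeTransform σ' ψ Ψ) {ε : ℝ}
    (hε : ε = 1 ∨ ε = -1) (θ : 𝓓(halfLine, ℂ)) (j : ℕ) {t : ℝ} (ht : 0 ≤ t) :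
    contourS ε a (fun k => expPairing θ k * timeDensity ε γ δ Φ Ψ j t k) =
      contourS ε (largeRadius γ δ) (fun k => expPairing θ k * timeDensity ε γ δ Φ Ψ j t k) := by
  have hR := two_le_largeRadius γ δ
  obtain ⟨C, h⟩ := exists_timeDensity_bound (γ := γ) (δ := δ) hΦ hΨ hε θ j ht
  have hdec := axisDecay_of_contourSet hε (by linarith) h
  rcases le_or_gt (largeRadius γ δ) a with hle | hlt
  · obtain ⟨a', ha'lt, ha'⟩ := (admissibleRadius_largeRadius γ δ).exists_lt
    exact contourS_eq_of_decay hε (by linarith [ha'.1]) (ha'lt.trans_le hle) ha'lt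
      (differentiableOn_solution ha' hΦ hΨ hε θ j t) (hdec.mono hle) hdec
  · obtain ⟨a', ha'lt, ha'⟩ := ha.exists_lt
    have hdiff := differentiableOn_solution ha' hΦ hΨ hε θ j t
    exact contourS_eq_of_decay hε (by linarith [ha'.1]) ha'lt (ha'lt.trans hlt) hdiff
      (hdec.extend hε (by linarith [ha'.1]) ha'lt hdiff.continuousOn) hdec

/-- At t = 0 the growing factor is absent. The pairing with a test function beats the polynomial
growth of the density in the whole sector, and Cauchy's theorem gives zero. -/
theorem contourS_initial (hΦ : IsTimeTransform σ φ Φ) (hΨ : IsTimeTransform σ' ψ Ψ) {ε : ℝ}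
    (hε : ε = 1 ∨ ε = -1) (θ : 𝓓(halfLine, ℂ)) (j : ℕ) :
    contourS ε (largeRadius γ δ) (fun k => expPairing θ k * timeDensity ε γ δ Φ Ψ j 0 k) = 0 := by
  obtain ⟨a', ha'lt, ha'⟩ := (admissibleRadius_largeRadius γ δ).exists_lt
  obtain ⟨C, hC, h⟩ := (rapidDecay_solution (γ := γ) (δ := δ) hΦ hΨ hε θ j).le_div_sq
    one_le_norm_of_mem_sector
  refine contourS_eq_zero hε (by linarith [ha'.1]) ha'lt
    (differentiableOn_solution ha' hΦ hΨ hε θ j 0) (C := C) fun k h1 h2 h3 => ?_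
  refine le_trans (le_of_eq ?_) (h k ⟨h1, h2, h3⟩)
  simp [timeDensity]

theorem utmDeriv_zero (hΦ : IsTimeTransform σ φ Φ) (hΨ : IsTimeTransform σ' ψ Ψ)
    (θ : 𝓓(halfLine, ℂ)) (j : ℕ) : utmDeriv γ δ Φ Ψ j 0 θ = 0 := by
  have h1 := contourS_initial (γ := γ) (δ := δ) hΦ hΨ (.inl rfl) θ j
  have h2 := contourS_initial (γ := γ) (δ := δ) hΦ hΨ (.inr rfl) θ j
  rw [utmDeriv, h1, h2, add_zero, mul_zero]

/-- Under the integral, ∂_t² multiplies by -ω² and transposing -∂_x² + ∂_x⁴ multiplies by k² + k⁴;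
these cancel by the dispersion relation. -/
theorem contourS_equation (hΦ : IsTimeTransform σ φ Φ) (hΨ : IsTimeTransform σ' ψ Ψ) {ε : ℝ}
    (hε : ε = 1 ∨ ε = -1) (θ : 𝓓(halfLine, ℂ)) {t : ℝ} (ht : 0 ≤ t) :
    contourS ε (largeRadius γ δ) (fun k => expPairing θ k * timeDensity ε γ δ Φ Ψ 2 t k) -
    contourS ε (largeRadius γ δ) (fun k => expPairing (∂_{(1 : ℝ)} (∂_{(1 : ℝ)} θ)) k *
      timeDensity ε γ δ Φ Ψ 0 t k) +
    contourS ε (largeRadius γ δ) (fun k =>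
      expPairing (∂_{(1 : ℝ)} (∂_{(1 : ℝ)} (∂_{(1 : ℝ)} (∂_{(1 : ℝ)} θ)))) k *
      timeDensity ε γ δ Φ Ψ 0 t k) = 0 := by
  have hR := two_le_largeRadius γ δ
  have hc := fun θ j => exists_timeDensity_bound (γ := γ) (δ := δ) hΦ hΨ hε θ j ht
  obtain ⟨C₁, h₁⟩ := hc θ 2
  obtain ⟨C₂, h₂⟩ := hc (∂_{(1 : ℝ)} (∂_{(1 : ℝ)} θ)) 0
  obtain ⟨C₃, h₃⟩ := hc (∂_{(1 : ℝ)} (∂_{(1 : ℝ)} (∂_{(1 : ℝ)} (∂_{(1 : ℝ)} θ)))) 0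
  have hm := fun θ j => measurable_expPairing_mul (γ := γ) (δ := δ) hΦ hΨ ε θ j t
  have hR1 : 1 ≤ largeRadius γ δ := by linarith
  have i₁ := integrable_contourMeasure hε hR1 (hm _ _) h₁
  have i₂ := integrable_contourMeasure hε hR1 (hm _ _) h₂
  have i₃ := integrable_contourMeasure hε hR1 (hm _ _) h₃
  rw [contourS_eq_integral hε hR1 (hm _ _) h₁, contourS_eq_integral hε hR1 (hm _ _) h₂,
    contourS_eq_integral hε hR1 (hm _ _) h₃, ← integral_sub i₁ i₂]
  have i₁₂ := i₁.sub i₂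
  rw [← integral_add (f := fun p : ℂ × ℂ => _ - _) i₁₂ i₃]
  rw [integral_eq_zero_of_ae]
  refine (ae_contourMeasure hε hR1).mono fun p hp => ?_
  have hεε : (ε : ℂ) ^ 2 = 1 := by rcases hε with rfl | rfl <;> norm_num
  have hk : 1 < ‖p.1‖ := by linarith [hp.1.1.1]
  simp only [expPairing_lineDeriv, timeDensity, Pi.zero_apply]
  linear_combination (expPairing θ p.1 * Complex.exp (-(ε * Complex.I * disp p.1) * t) *
    densityS ε γ δ Φ Ψ p.1 * p.2) * (Complex.I ^ 2 * disp p.1 ^ 2 * hεε + Complex.I ^ 2 * disp_sq hk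
      + p.1 ^ 4 * Complex.I ^ 2 * Complex.I_sq)

end Solution

/-! ### The involution exchanging the two contours -/

theorem nu_sq {k : ℂ} (hk : 1 < ‖k‖) : nu k ^ 2 = -1 - k ^ 2 := by
  rw [nu, mul_pow, Complex.I_sq, rootBranch_sq hk]; ring

theorem disp_eq_mul_nu (k : ℂ) : disp k = -(Complex.I * k * nu k) := by
  rw [disp, nu]; linear_combination (k * rootBranch k) * Complex.I_sq

theorem nu_ne_zero {k : ℂ} (hk : 1 < ‖k‖) : nu k ≠ 0 :=
  mul_ne_zero Complex.I_ne_zero (rootBranch_ne_zero hk)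

/-- Since ν² = -1 - k², one has 1 + ν^{-2} = (1 + k^{-2})^{-1}, and the principal power commutes
with inversion off the negative axis. -/
theorem rootBranch_nu {k : ℂ} (hk : 1 < ‖k‖) : rootBranch (nu k) = Complex.I * k := by
  have hk0 := ne_zero_of_one_lt_norm hk
  have hν := nu_ne_zero hk
  set z : ℂ := (k ^ 2)⁻¹ with hz
  have hz1 := norm_inv_sq_lt_one hk
  have hslit := one_add_mem_slitPlane hz1
  have h0 : (1 + z) ≠ 0 := Complex.slitPlane_ne_zero hslit
  have e1 : 1 + (nu k ^ 2)⁻¹ = (1 + z)⁻¹ := by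
    have h2 : nu k ^ 2 = -(k ^ 2 * (1 + z)) := by
      rw [nu_sq hk, hz]; field_simp; ring
    rw [h2, hz]
    rw [hz] at h0
    have : k ^ 2 * (1 + (k ^ 2)⁻¹) = k ^ 2 + 1 := by field_simp
    rw [this]
    have h3 : k ^ 2 + 1 ≠ 0 := by
      rw [← this]; exact mul_ne_zero (pow_ne_zero 2 hk0) h0
    have h4 : (1 + (k ^ 2)⁻¹ : ℂ) = (k ^ 2 + 1) / k ^ 2 := by field_simp
    rw [h4]
    field_simp
    ring
  have hne : (1 + z) ^ (1 / 2 : ℂ) ≠ 0 := by rw [Complex.cpow_ne_zero_iff]; exact .inl h0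
  rw [rootBranch, e1, Complex.inv_cpow _ _ (Complex.slitPlane_arg_ne_pi hslit), nu, rootBranch, ← hz]
  field_simp

/-- On squares ν is the involution z ↦ -1 - z, which exchanges the two values of k² belonging to the
same ω²; on k itself it has order four. -/
theorem nu_nu {k : ℂ} (hk : 1 < ‖k‖) : nu (nu k) = -k := by
  rw [nu, rootBranch_nu hk, ← mul_assoc, Complex.I_mul_I, neg_one_mul]

theorem disp_nu {k : ℂ} (hk : 1 < ‖k‖) : disp (nu k) = -disp k := by
  rw [disp, rootBranch_nu hk, disp_eq_mul_nu]; ring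

theorem hasDerivAt_nu {k : ℂ} (hk : 1 < ‖k‖) : HasDerivAt nu (-(k / nu k)) k := by
  have h := (differentiableAt_nu hk).hasDerivAt
  have h1 := h.pow 2
  have h2 : HasDerivAt (fun z : ℂ => -1 - z ^ 2) (-(2 * k)) k := by
    simpa using (hasDerivAt_pow 2 k).const_sub (-1)
  have h3 : (nu ^ 2) =ᶠ[𝓝 k] fun z : ℂ => -1 - z ^ 2 := by
    filter_upwards [(norm_lt_open 1).mem_nhds hk] with z hz using nu_sq hz
  have h4 := h1.unique (h2.congr_of_eventuallyEq h3)
  have hν := nu_ne_zero hk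
  have : deriv nu k = -(k / nu k) := by
    field_simp
    simp only [Nat.cast_ofNat, Nat.add_one_sub_one, pow_one] at h4
    linear_combination h4 / 2
  rwa [← this]

theorem hasDerivAt_disp {k : ℂ} (hk : 1 < ‖k‖) : HasDerivAt disp ((k + 2 * k ^ 3) / disp k) k := by
  have h := (differentiableAt_disp hk).hasDerivAt
  have h1 := h.pow 2
  have h2 : HasDerivAt (fun z : ℂ => z ^ 2 + z ^ 4) (2 * k + 4 * k ^ 3) k := by
    exact ((hasDerivAt_pow 2 k).add (hasDerivAt_pow 4 k)).congr_deriv (by norm_num)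
  have h3 : (disp ^ 2) =ᶠ[𝓝 k] fun z : ℂ => z ^ 2 + z ^ 4 := by
    filter_upwards [(norm_lt_open 1).mem_nhds hk] with z hz using disp_sq hz
  have h4 := h1.unique (h2.congr_of_eventuallyEq h3)
  have hν := disp_ne_zero hk
  have : deriv disp k = (k + 2 * k ^ 3) / disp k := by
    field_simp
    simp only [Nat.cast_ofNat, Nat.add_one_sub_one, pow_one] at h4
    linear_combination h4 / 2
  rwa [← this]

/-- The lift of `ν` to the logarithmic variable. -/
def logNu (u : ℂ) : ℂ :=
  u + (Real.pi / 2 : ℝ) * Complex.I + 1 / 2 * Complex.log (1 + (Complex.exp u ^ 2)⁻¹)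

theorem exp_logNu {u : ℂ} (hu : 1 < ‖Complex.exp u‖) : Complex.exp (logNu u) = nu (Complex.exp u) := by
  have h0 : (1 + (Complex.exp u ^ 2)⁻¹) ≠ 0 :=
    Complex.slitPlane_ne_zero (one_add_mem_slitPlane (norm_inv_sq_lt_one hu))
  rw [logNu, Complex.exp_add, Complex.exp_add, exp_half_pi, nu, rootBranch,
    Complex.cpow_def_of_ne_zero h0, mul_comm (1 / 2 : ℂ)]
  ring

theorem differentiableAt_logNu {u : ℂ} (hu : 1 < ‖Complex.exp u‖) : DifferentiableAt ℂ logNu u := by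
  have h1 := one_add_mem_slitPlane (norm_inv_sq_lt_one hu)
  have h2 : Complex.exp u ^ 2 ≠ 0 := pow_ne_zero 2 (Complex.exp_ne_zero u)
  unfold logNu
  fun_prop (disch := assumption)

/-- ν maps the axes to axes, turning them by a quarter: the real ray of ∂D₁ goes to the imaginary
ray of ∂D₂, and the imaginary ray to the negative real one. This matches the limits of primitives on
the two contours. -/
theorem logNu_axis {τ r : ℝ} (hτ : τ = 1 ∨ τ = -1) (hr : 1 < r) {u : ℂ} {ϑ : ℝ}
    (hu : u = Real.log r + ϑ * Complex.I) (hsq : Complex.exp u ^ 2 = ((τ * r ^ 2 : ℝ) : ℂ)) :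
    logNu u = Real.log (Real.sqrt (r ^ 2 + τ)) + ((ϑ + Real.pi / 2 : ℝ) : ℂ) * Complex.I := by
  have h1 : 1 < r ^ 2 := one_lt_pow₀ hr two_ne_zero
  have hpos : 0 < r ^ 2 + τ := by rcases hτ with rfl | rfl <;> linarith
  have e : (1 + (Complex.exp u ^ 2)⁻¹ : ℂ) = (((r ^ 2 + τ) / r ^ 2 : ℝ) : ℂ) := by
    rw [hsq]
    have hr0 : (r : ℂ) ≠ 0 := by exact_mod_cast (by linarith : r ≠ 0)
    rcases hτ with rfl | rfl <;> push_cast <;> field_simp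
  rw [logNu, e, ← Complex.ofReal_log (by positivity), Real.log_div hpos.ne' (by positivity), hu,
    Real.log_sqrt hpos.le, Real.log_pow]
  push_cast
  ring

theorem deriv_logNu {u : ℂ} (hu : 1 < ‖Complex.exp u‖) :
    nu (Complex.exp u) * deriv logNu u =
      -(Complex.exp u / nu (Complex.exp u)) * Complex.exp u := by
  have h1 := (differentiableAt_logNu hu).hasDerivAt.cexp
  have h2 := (hasDerivAt_nu hu).comp u (Complex.hasDerivAt_exp u)
  have h3 : (fun u => Complex.exp (logNu u)) =ᶠ[𝓝 u] (nu ∘ Complex.exp) := by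
    have ho : IsOpen {u : ℂ | 1 < ‖Complex.exp u‖} :=
      isOpen_lt continuous_const (by fun_prop)
    filter_upwards [ho.mem_nhds hu] with z hz using exp_logNu hz
  have := h1.unique (h2.congr_of_eventuallyEq h3)
  rwa [exp_logNu hu] at this

/-- Two contour integrals whose integrands are exchanged by the involution `ν`, up to a multiple of
`F(ω) dω`, add up to an integral over the real line. -/
theorem contourS_add_contourS_eq {a' R : ℝ} (ha' : 1 < a') (haR : a' < R)
    {f₁ f₂ F : ℂ → ℂ} (hf₁ : DifferentiableOn ℂ f₁ {k | a' < ‖k‖})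
    (hf₂ : DifferentiableOn ℂ f₂ {k | a' < ‖k‖}) (hd₁ : AxisDecay 1 R f₁) (hd₂ : AxisDecay (-1) R f₂)
    (hF : Differentiable ℂ F) (hFi : Integrable fun x : ℝ => F x)
    (hid : ∀ k, 2 * R < ‖k‖ → f₁ k + f₂ (nu k) * -(k / nu k) =
      -(F (disp k) * ((k + 2 * k ^ 3) / disp k))) :
    contourS 1 R f₁ + contourS (-1) R f₂ = -∫ x : ℝ, F x := by
  have ha0 : 0 < a' := by linarith
  obtain ⟨P₁, hP₁⟩ := exists_isLogPrimitive ha0 hf₁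
  obtain ⟨P₂, hP₂⟩ := exists_isLogPrimitive ha0 hf₂
  obtain ⟨P₃, hP₃⟩ : ∃ P, ∀ z, HasDerivAt P (F z) z := by
    obtain ⟨P, hP⟩ := convex_univ.exists_forall_hasDerivWithinAt hF.differentiableOn
    exact ⟨P, fun z => hasDerivWithinAt_univ.mp (hP z (mem_univ z))⟩
  obtain ⟨L₁, L₂, hL₁, hL₂, hL⟩ := hP₁.exists_limits (.inl rfl) ha0 haR hf₁.continuousOn hd₁
  obtain ⟨M₁, M₂, hM₁, hM₂, hM⟩ := hP₂.exists_limits (.inr rfl) ha0 haR hf₂.continuousOn hd₂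
  -- The identity between f₁, f₂ and F says precisely that Q' = 0. Taking |k| > 2R ensures |ν(k)| ≥
  -- |k|/2 > a', so that the primitive of f₂ is available at `logNu`.
  set Q : ℂ → ℂ := fun u => P₁ u + P₂ (logNu u) + P₃ (disp (Complex.exp u)) with hQ
  have hHP : Convex ℝ {u : ℂ | Real.log (2 * R) < u.re} := convex_halfSpace_re_gt _
  have hHo : IsOpen {u : ℂ | Real.log (2 * R) < u.re} :=
    isOpen_lt continuous_const Complex.continuous_re
  have hQ' : ∀ u ∈ {u : ℂ | Real.log (2 * R) < u.re}, HasDerivAt Q 0 u := by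
    intro u hu
    have hk := lt_norm_exp (by linarith : 0 < 2 * R) hu
    have hk1 : 1 < ‖Complex.exp u‖ := by linarith
    have hν : a' < ‖nu (Complex.exp u)‖ := by
      rw [norm_nu]; linarith [norm_rootBranch_ge (by linarith : 2 ≤ ‖Complex.exp u‖)]
    have h1 := hP₁ u (by
      have : Real.log a' < Real.log (2 * R) := Real.log_lt_log ha0 (by linarith)
      exact this.trans hu)
    have h2 := (hP₂ (logNu u) (by
      rw [Real.log_lt_iff_lt_exp ha0, ← Complex.norm_exp, exp_logNu hk1]; exact hν)).comp u
      (differentiableAt_logNu hk1).hasDerivAt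
    have h3 := (hP₃ (disp (Complex.exp u))).comp u
      ((hasDerivAt_disp hk1).comp u (Complex.hasDerivAt_exp u))
    refine ((h1.add h2).add h3).congr_deriv ?_
    rw [exp_logNu hk1, mul_assoc (f₂ _), deriv_logNu hk1]
    linear_combination Complex.exp u * hid _ hk
  have hconst : ∀ u ∈ {u : ℂ | Real.log (2 * R) < u.re}, ∀ v ∈ {u : ℂ | Real.log (2 * R) < u.re},
      Q u = Q v := fun u hu v hv => by
    have := hHP.norm_image_sub_le_of_norm_hasDerivWithin_le (𝕜 := ℂ) (C := 0)
      (fun z hz => (hQ' z hz).hasDerivWithinAt) (fun z _ => by simp) hv hu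
    rw [zero_mul] at this
    exact sub_eq_zero.mp (norm_le_zero_iff.mp this)
  have hlog : ∀ ϑ r : ℝ, 2 * R < r →
      ((Real.log r : ℂ) + ϑ * Complex.I) ∈ {u : ℂ | Real.log (2 * R) < u.re} :=
    fun ϑ r hr => log_lt_re (by linarith) hr ϑ
  -- Constancy of Q compared on the real and imaginary rays. There ω takes real values tending to +∞
  -- and -∞, so the P₃ terms become an integral over an interval exhausting the line.
  have hrel : ∀ r : ℝ, 2 * R < r →
      (P₁ (Real.log r + ((0 : ℝ) : ℂ) * Complex.I) +
        P₂ (Real.log (Real.sqrt (r ^ 2 + 1)) + ((Real.pi / 2 : ℝ) : ℂ) * Complex.I)) -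
      (P₁ (Real.log r + ((Real.pi / 2 : ℝ) : ℂ) * Complex.I) +
        P₂ (Real.log (Real.sqrt (r ^ 2 + -1)) + ((Real.pi : ℝ) : ℂ) * Complex.I)) =
      -∫ x in (axisDisp (-1) r)..(axisDisp 1 r), F x := by
    intro r hr
    have hr0 : 0 < r := by linarith
    have hr1 : 1 < r := by linarith
    have q := hconst _ (hlog 0 r hr) _ (hlog (Real.pi / 2) r hr)
    have s₁ : Complex.exp ((Real.log r : ℂ) + ((0 : ℝ) : ℂ) * Complex.I) ^ 2 =
        (((1 : ℝ) * r ^ 2 : ℝ) : ℂ) := by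
      rw [exp_log_add hr0]; simp
    have s₂ : Complex.exp ((Real.log r : ℂ) + ((Real.pi / 2 : ℝ) : ℂ) * Complex.I) ^ 2 =
        (((-1 : ℝ) * r ^ 2 : ℝ) : ℂ) := by
      rw [exp_log_add hr0, exp_half_pi, mul_comm, imag_sq]
    simp only [hQ] at q
    rw [logNu_axis (.inl rfl) hr1 rfl s₁, logNu_axis (.inr rfl) hr1 rfl s₂,
      disp_axis (.inl rfl) hr1 s₁, disp_axis (.inr rfl) hr1 s₂, zero_add, add_halves] at q
    have hFTC : ∫ x in (axisDisp (-1) r)..(axisDisp 1 r), F x =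
        P₃ (axisDisp 1 r) - P₃ (axisDisp (-1) r) :=
      intervalIntegral.integral_eq_sub_of_hasDerivAt (f := fun x : ℝ => P₃ x)
        (fun x _ => (hP₃ x).comp_ofReal)
        (Continuous.intervalIntegrable (hF.continuous.comp Complex.continuous_ofReal :
          Continuous fun x : ℝ => F x) _ _)
    rw [hFTC]
    linear_combination q
  have ht₁ : Tendsto (axisDisp 1) atTop atTop := by
    refine tendsto_atTop_mono' _ ?_ (tendsto_id (α := ℝ))
    filter_upwards [eventually_ge_atTop 2] with r hr
    have h1 := (abs_axisDisp_bounds (.inl rfl) hr).1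
    have h2 : 0 ≤ axisDisp 1 r := by rw [axisDisp]; positivity
    rw [abs_of_nonneg h2] at h1
    simp only [id]
    nlinarith
  have ht₂ : Tendsto (axisDisp (-1)) atTop atBot := by
    rw [← tendsto_neg_atTop_iff]
    refine tendsto_atTop_mono' _ ?_ (tendsto_id (α := ℝ))
    filter_upwards [eventually_ge_atTop 2] with r hr
    have h1 := (abs_axisDisp_bounds (.inr rfl) hr).1
    have h2 : axisDisp (-1) r ≤ 0 := by
      rw [axisDisp]; nlinarith [Real.sqrt_nonneg (r ^ 4 + -1 * r ^ 2)]
    rw [abs_of_nonpos h2] at h1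
    simp only [id]
    nlinarith
  have hlim := (intervalIntegral_tendsto_integral hFi ht₂ ht₁).neg
  have hsq : ∀ c : ℝ, Tendsto (fun r : ℝ => Real.sqrt (r ^ 2 + c)) atTop atTop := fun c =>
    Real.tendsto_sqrt_atTop.comp (tendsto_atTop_add_const_right _ c (tendsto_pow_atTop two_ne_zero))
  have e0 : Real.pi / 2 * (1 - 1) = 0 := by ring
  have e1 : Real.pi / 2 * (1 - -1) = Real.pi := by ring
  rw [e0] at hL₁
  rw [e1] at hM₁
  have hlim' := (hL₁.add (hM₂.comp (hsq 1))).sub (hL₂.add (hM₁.comp (hsq (-1))))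
  have huniq := tendsto_nhds_unique (hlim'.congr' (by
    filter_upwards [eventually_gt_atTop (2 * R)] with r hr using hrel r hr)) hlim
  rw [hL, hM, ← huniq]
  push_cast
  ring

/-- Δ₂ at ν(k) equals Δ₁ at k, and ω changes sign; the factor -k/ν is the derivative of ν. -/
theorem baseCoef_nu {γ δ : ℝ} {k : ℂ} (hk : 1 < ‖k‖) :
    baseCoef (-1) γ δ (nu k) * -(k / nu k) = baseCoef 1 γ δ k := by
  have hν := nu_ne_zero hk
  have hD : DeltaS (-1) γ δ (nu k) = DeltaS 1 γ δ k := by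
    rw [DeltaS, DeltaS, nu_nu hk]; push_cast; ring
  rw [baseCoef, baseCoef, hD, nu_nu hk, disp_nu hk]
  have hω := disp_ne_zero hk
  push_cast
  by_cases h : DeltaS 1 γ δ k = 0
  · simp [h]
  · field_simp
    ring

/-- Because (k+ν)(k-ν) = 2k² + 1, clearing Δ₁ produces the derivative of ω. This normalizes the
boundary values to exactly 1. -/
theorem baseCoef_mul {γ δ : ℝ} {k : ℂ} (hk : 1 < ‖k‖) (h : DeltaS 1 γ δ k ≠ 0) :
    Complex.I * baseCoef 1 γ δ k * ((k - nu k) * DeltaS 1 γ δ k) = (k + 2 * k ^ 3) / disp k := by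
  have hω := disp_ne_zero hk
  have := nu_sq hk
  rw [baseCoef]
  push_cast
  field_simp
  linear_combination -k * this

/-! ### The boundary symbols acting on the spectral coefficients. -/

section Identities

variable {γ δ : ℝ} {k : ℂ}

theorem psiCoef_nu (hk : 1 < ‖k‖) : psiCoef (-1) γ δ (nu k) * -(k / nu k) =
    baseCoef 1 γ δ k * (-k + Complex.I * γ) := by
  rw [psiCoef, ← baseCoef_nu hk, nu_nu hk]; push_cast; ring

theorem phiCoef_nu (hk : 1 < ‖k‖) : phiCoef (-1) γ δ (nu k) * -(k / nu k) =
    baseCoef 1 γ δ k * (Complex.I * k * (k - Complex.I * δ)) := by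
  rw [phiCoef, ← baseCoef_nu hk, nu_nu hk]; push_cast; ring

/-- The four identities of this section form a 2 × 2 system: the symbols ik+γ and -k²+iδk of the two
boundary operators, summed over the branches k and ν(k), act on the coefficients of φ and ψ as the
identity matrix times -ω'(k). -/
theorem psiCoef_first (hk : 1 < ‖k‖) : (Complex.I * k + γ) * psiCoef 1 γ δ k +
    (Complex.I * nu k + γ) * (psiCoef (-1) γ δ (nu k) * -(k / nu k)) = 0 := by
  rw [psiCoef_nu hk, psiCoef]
  push_cast
  linear_combination (baseCoef 1 γ δ k * γ * (nu k - k)) * Complex.I_sq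

theorem phiCoef_first (hk : 1 < ‖k‖) (h : DeltaS 1 γ δ k ≠ 0) :
    (Complex.I * k + γ) * phiCoef 1 γ δ k +
    (Complex.I * nu k + γ) * (phiCoef (-1) γ δ (nu k) * -(k / nu k)) =
      -((k + 2 * k ^ 3) / disp k) := by
  rw [phiCoef_nu hk, phiCoef, ← baseCoef_mul hk h]
  have : DeltaS 1 γ δ k = -γ * (k + nu k) + Complex.I * (γ * δ - k * nu k) := by
    rw [DeltaS]; push_cast; ring
  rw [this]
  push_cast
  ring

theorem psiCoef_second (hk : 1 < ‖k‖) (h : DeltaS 1 γ δ k ≠ 0) :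
    (-k ^ 2 + δ * (Complex.I * k)) * psiCoef 1 γ δ k +
    (-nu k ^ 2 + δ * (Complex.I * nu k)) * (psiCoef (-1) γ δ (nu k) * -(k / nu k)) =
      -((k + 2 * k ^ 3) / disp k) := by
  rw [psiCoef_nu hk, psiCoef, ← baseCoef_mul hk h]
  have : DeltaS 1 γ δ k = -γ * (k + nu k) + Complex.I * (γ * δ - k * nu k) := by
    rw [DeltaS]; push_cast; ring
  rw [this]
  push_cast
  linear_combination (-(baseCoef 1 γ δ k * k * nu k * (k - nu k))) * Complex.I_sq

theorem phiCoef_second (hk : 1 < ‖k‖) :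
    (-k ^ 2 + δ * (Complex.I * k)) * phiCoef 1 γ δ k +
    (-nu k ^ 2 + δ * (Complex.I * nu k)) * (phiCoef (-1) γ δ (nu k) * -(k / nu k)) = 0 := by
  rw [phiCoef_nu hk, phiCoef]
  push_cast
  ring

end Identities

/-! ### Averages in time -/

theorem integral_mul_expIntegral {α : Type*} [MeasurableSpace α] {μ : Measure α} [SFinite μ]
    {c B : α → ℂ} {S : Set ℝ} (hS : MeasurableSet S) {M : ℝ} (hc : Measurable c) (hB : Measurable B)
    (hM : ∀ᵐ p ∂μ, ∀ x ∈ S, ‖Complex.exp (c p * x)‖ ≤ M) (hBi : Integrable B μ) {g : ℝ → ℂ}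
    (hg : Measurable g) (hgi : IntegrableOn g S) :
    ∫ x in S, g x * expIntegral μ c B 0 x =
      ∫ p, (∫ x in S, Complex.exp (c p * x) * g x) * B p ∂μ := by
  have hint : Integrable (Function.uncurry fun (x : ℝ) p => Complex.exp (c p * x) * g x * B p)
      ((volume.restrict S).prod μ) := by
    have h1 : Integrable (fun z : ℝ × α => g z.1 * B z.2) ((volume.restrict S).prod μ) :=
      hgi.mul_prod hBi
    refine (h1.norm.const_mul M).mono' ?_ ?_
    · refine Measurable.aestronglyMeasurable ?_
      unfold Function.uncurry
      fun_prop
    · have h2 : ∀ᵐ z ∂((volume.restrict S).prod μ), z.1 ∈ S := 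
        Measure.quasiMeasurePreserving_fst.ae (ae_restrict_mem hS)
      have h3 : ∀ᵐ z ∂((volume.restrict S).prod μ), ∀ x ∈ S, ‖Complex.exp (c z.2 * x)‖ ≤ M :=
        Measure.quasiMeasurePreserving_snd.ae hM
      filter_upwards [h2, h3] with z hz hz'
      simp only [Function.uncurry, norm_mul]
      rw [mul_assoc]
      exact mul_le_mul_of_nonneg_right (hz' _ hz) (by positivity)
  have hswap := integral_integral_swap hint
  calc ∫ x in S, g x * expIntegral μ c B 0 x
      = ∫ x in S, ∫ p, Complex.exp (c p * x) * g x * B p ∂μ := by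
        refine integral_congr_ae (.of_forall fun x => ?_)
        simp only [expIntegral, ← integral_const_mul]
        refine integral_congr_ae (.of_forall fun p => ?_)
        simp only [pow_zero]
        ring
    _ = _ := hswap
    _ = _ := by
        refine integral_congr_ae (.of_forall fun p => ?_)
        simp only [integral_mul_const]

theorem setIntegral_exp_mul_test {Ω : Opens ℝ} (χ : 𝓓(Ω, ℂ)) (c : ℂ) :
    ∫ x in (Ω : Set ℝ), Complex.exp (c * x) * χ x = ∫ x : ℝ, Complex.exp (c * x) * χ x := by
  refine setIntegral_eq_integral_of_forall_compl_eq_zero fun x hx => ?_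
  rw [image_eq_zero_of_notMem_tsupport fun h => hx (χ.tsupport_subset h), mul_zero]

theorem integrable_test {Ω : Opens ℝ} (χ : 𝓓(Ω, ℂ)) : Integrable χ :=
  χ.contDiff.continuous.integrable_of_hasCompactSupport χ.hasCompactSupport

/-- The spectral density of the average against `χ`. -/
def averageDensity (ε γ δ : ℝ) (Φ Ψ : ℂ → ℂ) (χ : ℝ → ℂ) (k : ℂ) : ℂ :=
  fourierLaplace χ (-(ε * disp k)) * densityS ε γ δ Φ Ψ k

section Average

variable {γ δ σ σ' T : ℝ} {φ ψ : 𝓢'(ℝ, ℂ)} {Φ Ψ : ℂ → ℂ} {ε : ℝ}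

/-- Im ω is bounded on the contour, so the transform of χ decays there faster than any power of ω,
hence of k, and outweighs the polynomial growth of the density. -/
theorem rapidDecay_averageDensity (hΦ : IsTimeTransform σ φ Φ) (hΨ : IsTimeTransform σ' ψ Ψ)
    (hε : ε = 1 ∨ ε = -1) (χ : 𝓓(timeInterval T, ℂ)) :
    RapidDecay (contourSet ε (largeRadius γ δ)) (averageDensity ε γ δ Φ Ψ χ) := by
  have hR := two_le_largeRadius γ δ
  refine RapidDecay.mul (fun n => ?_) ((polyGrowth_densityS hε hΦ hΨ).mono (contourSet_subset _ _))
  obtain ⟨C, hC, h⟩ := exists_pow_mul_fourierLaplace_le χ.contDiff χ.hasCompactSupport n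
  refine ⟨2 ^ n * (C * Real.exp (2 * largeRadius γ δ ^ 2 * T)), by positivity, fun k hk => ?_⟩
  have h1 := h (-(ε * disp k)) (Real.exp (2 * largeRadius γ δ ^ 2 * T)) fun x hx => by
    have hx' : x ∈ Ioo 0 T := χ.tsupport_subset hx
    have := norm_exp_disp_le hε hR hk (Ioo_subset_Icc_self hx')
    rwa [show Complex.I * -(ε * disp k) * x = -(ε * Complex.I * disp k) * x by ring]
  rw [norm_neg, norm_mul, Complex.norm_real, Real.norm_eq_abs, abs_of_sign hε, one_mul] at h1
  have hk2 : 2 ≤ ‖k‖ := hR.trans hk.1.1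
  have h2 : ‖k‖ ≤ 2 * ‖disp k‖ := by
    have := (norm_disp_bounds hk2).1
    nlinarith
  calc _ ≤ (2 * ‖disp k‖) ^ n * ‖fourierLaplace χ (-(ε * disp k))‖ := by gcongr
    _ = 2 ^ n * (‖disp k‖ ^ n * ‖fourierLaplace χ (-(ε * disp k))‖) := by rw [mul_pow]; ring
    _ ≤ _ := by gcongr

theorem measurable_averageDensity (hΦ : IsTimeTransform σ φ Φ) (hΨ : IsTimeTransform σ' ψ Ψ)
    (χ : 𝓓(timeInterval T, ℂ)) : Measurable (averageDensity ε γ δ Φ Ψ χ) := by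
  have h1 := (differentiable_fourierLaplace χ.contDiff.continuous
    χ.hasCompactSupport).continuous.measurable
  have h2 := measurable_densityS ε γ δ hΦ.differentiable.continuous.measurable
    hΨ.differentiable.continuous.measurable
  have h3 := measurable_disp
  unfold averageDensity
  fun_prop

/-- The average in time of one of the two contour integrals, as a function of `x`. -/
def averageSolution (ε γ δ : ℝ) (Φ Ψ : ℂ → ℂ) (χ : ℝ → ℂ) (n : ℕ) (x : ℝ) : ℂ :=
  expIntegral (contourMeasure ε (largeRadius γ δ)) (fun p => Complex.I * p.1)
    (fun p => averageDensity ε γ δ Φ Ψ χ p.1 * p.2) n x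

theorem integrable_averageDensity (hΦ : IsTimeTransform σ φ Φ) (hΨ : IsTimeTransform σ' ψ Ψ)
    (hε : ε = 1 ∨ ε = -1) (χ : 𝓓(timeInterval T, ℂ)) {m : ℂ → ℂ} (hm : Measurable m)
    (hmg : PolyGrowth (contourSet ε (largeRadius γ δ)) m) :
    Integrable (fun p : ℂ × ℂ => averageDensity ε γ δ Φ Ψ χ p.1 * m p.1 * p.2)
      (contourMeasure ε (largeRadius γ δ)) ∧
    contourS ε (largeRadius γ δ) (fun k => averageDensity ε γ δ Φ Ψ χ k * m k) =
      ∫ p, averageDensity ε γ δ Φ Ψ χ p.1 * m p.1 * p.2 ∂contourMeasure ε (largeRadius γ δ) := by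
  have hR := two_le_largeRadius γ δ
  have hmeas := measurable_averageDensity (ε := ε) (γ := γ) (δ := δ) hΦ hΨ χ
  have hdecay := rapidDecay_averageDensity (γ := γ) (δ := δ) hΦ hΨ hε χ
  generalize averageDensity ε γ δ Φ Ψ χ = f at hmeas hdecay ⊢
  obtain ⟨C, -, h⟩ := (hdecay.mul hmg).le_div_sq fun k hk => one_le_norm_of_mem_sector k hk.1
  have hfm : Measurable fun k => f k * m k := hmeas.mul hm
  have hR1 : 1 ≤ largeRadius γ δ := one_le_two.trans hR
  exact ⟨integrable_contourMeasure (f := fun k => f k * m k) hε hR1 hfm h,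
    contourS_eq_integral (f := fun k => f k * m k) hε hR1 hfm h⟩

theorem polyGrowth_I_mul (S : Set ℂ) (n : ℕ) : PolyGrowth S fun k => (Complex.I * k) ^ n :=
  ((PolyGrowth.const S Complex.I).mul (PolyGrowth.id S)).pow n

theorem integrable_averageDensity_pow (hΦ : IsTimeTransform σ φ Φ) (hΨ : IsTimeTransform σ' ψ Ψ)
    (hε : ε = 1 ∨ ε = -1) (χ : 𝓓(timeInterval T, ℂ)) (n : ℕ) :
    Integrable (fun p : ℂ × ℂ => (Complex.I * p.1) ^ n * (averageDensity ε γ δ Φ Ψ χ p.1 * p.2))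
      (contourMeasure ε (largeRadius γ δ)) := by
  refine (integrable_averageDensity (γ := γ) (δ := δ) hΦ hΨ hε χ (m := fun k => (Complex.I * k) ^ n)
    (by fun_prop) (polyGrowth_I_mul _ n)).1.congr (.of_forall fun p => ?_)
  simp only
  ring

theorem ae_norm_exp_le_one (hε : ε = 1 ∨ ε = -1) :
    ∀ᵐ p ∂contourMeasure ε (largeRadius γ δ), ∀ x ∈ Ici (0 : ℝ),
      ‖Complex.exp (Complex.I * p.1 * x)‖ ≤ 1 := by
  have hR := two_le_largeRadius γ δ
  exact (ae_contourMeasure hε (by linarith)).mono fun p hp x hx => norm_exp_mul_le_one hp.1.1.2.2 hx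

theorem hasDerivWithinAt_averageSolution (hΦ : IsTimeTransform σ φ Φ) (hΨ : IsTimeTransform σ' ψ Ψ)
    (hε : ε = 1 ∨ ε = -1) (χ : 𝓓(timeInterval T, ℂ)) (n : ℕ) {x : ℝ} (hx : x ∈ Ici (0 : ℝ)) :
    HasDerivWithinAt (averageSolution ε γ δ Φ Ψ χ n) (averageSolution ε γ δ Φ Ψ χ (n + 1) x)
      (Ici 0) x := by
  have hmeas := measurable_averageDensity (ε := ε) (γ := γ) (δ := δ) hΦ hΨ χ
  exact hasDerivWithinAt_expIntegral (convex_Ici 0) (by fun_prop) (by fun_prop)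
    (ae_norm_exp_le_one hε) (integrable_averageDensity_pow hΦ hΨ hε χ) n hx

theorem averageSolution_zero (hΦ : IsTimeTransform σ φ Φ) (hΨ : IsTimeTransform σ' ψ Ψ)
    (hε : ε = 1 ∨ ε = -1) (χ : 𝓓(timeInterval T, ℂ)) (n : ℕ) :
    averageSolution ε γ δ Φ Ψ χ n 0 = contourS ε (largeRadius γ δ) (fun k =>
      averageDensity ε γ δ Φ Ψ χ k * (Complex.I * k) ^ n) := by
  rw [(integrable_averageDensity (γ := γ) (δ := δ) hΦ hΨ hε χ (m := fun k => (Complex.I * k) ^ n)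
    (by fun_prop) (polyGrowth_I_mul _ n)).2, averageSolution, expIntegral]
  refine integral_congr_ae (.of_forall fun p => ?_)
  simp only [Complex.ofReal_zero, mul_zero, Complex.exp_zero]
  ring

/-- Fubini is applied on both sides. In time it uses the decay of the test function θ, in space the
decay gained from χ; both sides become the same integral over the contour. -/
theorem integral_average_contourS (hΦ : IsTimeTransform σ φ Φ) (hΨ : IsTimeTransform σ' ψ Ψ)
    (hε : ε = 1 ∨ ε = -1) (χ : 𝓓(timeInterval T, ℂ)) (θ : 𝓓(halfLine, ℂ)) :
    ∫ t in Ioo 0 T, χ t * contourS ε (largeRadius γ δ) (fun k =>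
      expPairing θ k * timeDensity ε γ δ Φ Ψ 0 t k) =
    ∫ x in Ioi 0, averageSolution ε γ δ Φ Ψ χ 0 x * θ x := by
  have hR := two_le_largeRadius γ δ
  have hd := measurable_disp
  have hE := (differentiable_expPairing θ).continuous.measurable
  have hD := measurable_densityS ε γ δ hΦ.differentiable.continuous.measurable
    hΨ.differentiable.continuous.measurable
  have hmeas := measurable_averageDensity (ε := ε) (γ := γ) (δ := δ) hΦ hΨ χ
  have hχm : Measurable χ := χ.contDiff.continuous.measurable
  have hθm : Measurable θ := θ.contDiff.continuous.measurable
  have hBi : Integrable (fun p : ℂ × ℂ => expPairing θ p.1 * densityS ε γ δ Φ Ψ p.1 * p.2)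
      (contourMeasure ε (largeRadius γ δ)) := by
    obtain ⟨C, -, h⟩ := ((rapidDecay_solution (γ := γ) (δ := δ) hΦ hΨ hε θ 0).mono
      (contourSet_subset _ _)).le_div_sq fun k hk => one_le_norm_of_mem_sector k hk.1
    refine (integrable_contourMeasure hε (by linarith) (by fun_prop) h).congr (.of_forall fun p => ?_)
    simp
  have h1 := integral_mul_expIntegral (μ := contourMeasure ε (largeRadius γ δ)) (S := Ioo 0 T)
    measurableSet_Ioo (c := fun p => -(ε * Complex.I * disp p.1))
    (B := fun p => expPairing θ p.1 * densityS ε γ δ Φ Ψ p.1 * p.2)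
    (M := Real.exp (2 * largeRadius γ δ ^ 2 * T)) (by fun_prop) (by fun_prop)
    ((ae_contourMeasure hε (by linarith)).mono fun p hp x hx =>
      norm_exp_disp_le hε hR hp.1 (Ioo_subset_Icc_self hx)) hBi hχm (integrable_test χ).integrableOn
  have h2 := integral_mul_expIntegral (μ := contourMeasure ε (largeRadius γ δ)) (S := Ioi 0)
    measurableSet_Ioi (c := fun p => Complex.I * p.1)
    (B := fun p => averageDensity ε γ δ Φ Ψ χ p.1 * p.2)
    (M := 1) (by fun_prop) (by fun_prop)
    ((ae_norm_exp_le_one hε).mono fun p hp x hx => hp x (Ioi_subset_Ici_self hx))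
    (by simpa using integrable_averageDensity_pow (γ := γ) (δ := δ) hΦ hΨ hε χ 0) hθm
    (integrable_test θ).integrableOn
  calc _ = ∫ t in Ioo 0 T, χ t * expIntegral (contourMeasure ε (largeRadius γ δ))
        (fun p => -(ε * Complex.I * disp p.1))
        (fun p => expPairing θ p.1 * densityS ε γ δ Φ Ψ p.1 * p.2) 0 t := by
        refine setIntegral_congr_fun measurableSet_Ioo fun t ht => ?_
        rw [contourS_timeDensity_eq hΦ hΨ hε θ 0 ht.1.le]
    _ = _ := h1
    _ = ∫ p, (∫ x in Ioi (0 : ℝ), Complex.exp (Complex.I * p.1 * x) * θ x) *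
        (averageDensity ε γ δ Φ Ψ χ p.1 * p.2) ∂contourMeasure ε (largeRadius γ δ) := by
        refine integral_congr_ae (.of_forall fun p => ?_)
        have e1 := setIntegral_exp_mul_test χ (-(ε * Complex.I * disp p.1))
        have e2 := setIntegral_exp_mul_test θ (Complex.I * p.1)
        have e3 : ∫ x : ℝ, Complex.exp (-(ε * Complex.I * disp p.1) * x) * χ x =
            fourierLaplace χ (-(ε * disp p.1)) := by
          rw [fourierLaplace]
          refine integral_congr_ae (.of_forall fun x => ?_)
          simp only
          congr 2; ring
        change (∫ x in Ioo 0 T, _) * _ = (∫ x in Ioi (0 : ℝ), _) * _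
        change ∫ x in Ioo 0 T, _ = _ at e1
        change ∫ x in Ioi (0 : ℝ), _ = _ at e2
        rw [e1, e2, e3, averageDensity]
        change _ = expPairing θ p.1 * _
        ring
    _ = _ := h2.symm
    _ = _ := by simp only [averageSolution, mul_comm]

end Average

/-! ### Boundary values -/

theorem fourierInv_testToSchwartz_eq {Ω : Opens ℝ} (χ : 𝓓(Ω, ℂ)) (ξ : ℝ) :
    (𝓕⁻ (testToSchwartz χ)) ξ = fourierLaplace χ ((2 * Real.pi * ξ : ℝ) : ℂ) := by
  rw [SchwartzMap.fourierInv_coe, Real.fourierInv_eq', fourierLaplace]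
  refine integral_congr_ae (.of_forall fun x => ?_)
  change _ • χ x = _
  rw [smul_eq_mul]
  congr 2
  simp; ring

section Boundary

variable {γ δ σ σ' T : ℝ} {φ ψ : 𝓢'(ℝ, ℂ)} {Φ Ψ : ℂ → ℂ}

theorem IsTimeTransform.integrable_mul_fourierLaplace (hΦ : IsTimeTransform σ φ Φ) {Ω : Opens ℝ}
    (χ : 𝓓(Ω, ℂ)) : Integrable fun x : ℝ => fourierLaplace χ (-(x : ℂ)) * Φ (-(x : ℂ)) := by
  obtain ⟨K, n, hK, hgr⟩ := hΦ.growth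
  obtain ⟨C₀, hC₀, h₀⟩ := exists_pow_mul_fourierLaplace_le χ.contDiff χ.hasCompactSupport 0
  obtain ⟨C₁, hC₁, h₁⟩ := exists_pow_mul_fourierLaplace_le χ.contDiff χ.hasCompactSupport (n + 2)
  have hm1 := (differentiable_fourierLaplace χ.contDiff.continuous χ.hasCompactSupport).continuous
  have hm2 := hΦ.differentiable.continuous
  refine (integrable_inv_one_add_sq.const_mul (2 ^ (n + 1) * (C₀ + C₁) * K)).mono'
    (by fun_prop : Continuous _).aestronglyMeasurable (.of_forall fun x => ?_)
  have hB : ∀ y ∈ tsupport χ, ‖Complex.exp (Complex.I * -(x : ℂ) * y)‖ ≤ 1 := fun y _ => by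
    rw [Complex.norm_exp]; simp
  have e₀ := h₀ _ 1 hB
  have e₁ := h₁ _ 1 hB
  have e₂ := hgr (-(x : ℂ)) (by simp)
  rw [norm_neg, Complex.norm_real, Real.norm_eq_abs] at e₀ e₁ e₂
  rw [norm_mul, ← div_eq_mul_inv, le_div_iff₀ (by positivity)]
  have e₃ : (1 + |x|) ^ (n + 2) ≤ 2 ^ (n + 1) * (1 + |x| ^ (n + 2)) := by
    simpa using add_pow_le zero_le_one (abs_nonneg x) (n + 2)
  have e₄ : 1 + x ^ 2 ≤ (1 + |x|) ^ 2 := by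
    have := abs_nonneg x
    nlinarith [sq_abs x]
  set q := ‖fourierLaplace χ (-(x : ℂ))‖
  have hq : 0 ≤ q := norm_nonneg _
  calc q * ‖Φ (-(x : ℂ))‖ * (1 + x ^ 2) ≤ q * (K * (1 + |x|) ^ n) * (1 + |x|) ^ 2 := by gcongr
    _ = q * K * (1 + |x|) ^ (n + 2) := by ring
    _ ≤ q * K * (2 ^ (n + 1) * (1 + |x| ^ (n + 2))) := by gcongr
    _ = 2 ^ (n + 1) * (|x| ^ 0 * q + |x| ^ (n + 2) * q) * K := by ring
    _ ≤ _ := by gcongr <;> linarith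

/-- Parseval's identity for the density of φ; the factor 2π comes from w = 2πξ. -/
theorem IsTimeTransform.integral_mul_fourierLaplace (hΦ : IsTimeTransform σ φ Φ) {Ω : Opens ℝ}
    (χ : 𝓓(Ω, ℂ)) : ∫ x : ℝ, fourierLaplace χ (-(x : ℂ)) * Φ (-(x : ℂ)) =
      2 * Real.pi * φ (testToSchwartz χ) := by
  rw [hΦ.density (testToSchwartz χ)]
  simp only [fourierInv_testToSchwartz_eq]
  have h1 := integral_neg_eq_self (fun x : ℝ => fourierLaplace χ (x : ℂ) * Φ (x : ℂ)) volume
  have h2 := Measure.integral_comp_mul_left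
    (fun x : ℝ => fourierLaplace χ (x : ℂ) * Φ (x : ℂ)) (2 * Real.pi)
  simp only [Complex.ofReal_neg] at h1
  rw [h1]
  have h3 : (∫ ξ : ℝ, Φ ((2 * Real.pi * ξ : ℝ) : ℂ) * fourierLaplace χ ((2 * Real.pi * ξ : ℝ) : ℂ)) =
      ∫ ξ : ℝ, fourierLaplace χ ((2 * Real.pi * ξ : ℝ) : ℂ) * Φ ((2 * Real.pi * ξ : ℝ) : ℂ) := by
    simp only [mul_comm]
  rw [h3, h2, abs_of_pos (by positivity), Complex.real_smul]
  have : (Real.pi : ℂ) ≠ 0 := by simp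
  push_cast
  field_simp

/-- After transport by ν both contours evaluate the transforms of χ, φ and ψ at the same point
-ω(k), so only the coefficients have to match. The multiplier m is the symbol of a boundary
operator, and (p, q) selects the datum it returns. -/
theorem sum_contourS_averageDensity (hΦ : IsTimeTransform σ φ Φ) (hΨ : IsTimeTransform σ' ψ Ψ)
    (χ : 𝓓(timeInterval T, ℂ)) {m : ℂ → ℂ} (hm : Differentiable ℂ m)
    (hmg : ∀ ε, PolyGrowth (contourSet ε (largeRadius γ δ)) m) {p q : ℂ}
    (hφ : ∀ k, 1 < ‖k‖ → DeltaS 1 γ δ k ≠ 0 → m k * phiCoef 1 γ δ k +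
      m (nu k) * (phiCoef (-1) γ δ (nu k) * -(k / nu k)) = p * -((k + 2 * k ^ 3) / disp k))
    (hψ : ∀ k, 1 < ‖k‖ → DeltaS 1 γ δ k ≠ 0 → m k * psiCoef 1 γ δ k +
      m (nu k) * (psiCoef (-1) γ δ (nu k) * -(k / nu k)) = q * -((k + 2 * k ^ 3) / disp k)) :
    contourS 1 (largeRadius γ δ) (fun k => averageDensity 1 γ δ Φ Ψ χ k * m k) +
      contourS (-1) (largeRadius γ δ) (fun k => averageDensity (-1) γ δ Φ Ψ χ k * m k) =
    -(2 * Real.pi * (p * φ (testToSchwartz χ) + q * ψ (testToSchwartz χ))) := by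
  have hR := two_le_largeRadius γ δ
  have hadm := admissibleRadius_largeRadius γ δ
  obtain ⟨a', ha'R, ha'⟩ := hadm.exists_lt
  have hL := differentiable_fourierLaplace χ.contDiff.continuous χ.hasCompactSupport
  have hdiff : ∀ ε : ℝ, ε = 1 ∨ ε = -1 →
      DifferentiableOn ℂ (fun k => averageDensity ε γ δ Φ Ψ χ k * m k) {k | a' < ‖k‖} :=
    fun ε hε k hk => by
      have hk' : a' < ‖k‖ := hk
      have h1 := differentiableAt_densityS ha' hε hΦ.differentiable hΨ.differentiable hk'.le
      have h2 := differentiableAt_disp (ha'.1.trans hk')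
      have h3 : DifferentiableAt ℂ (fun k => fourierLaplace χ (-(ε * disp k))) k :=
        (hL _).comp k (h2.const_mul _).neg
      exact ((h3.mul h1).mul (hm k)).differentiableWithinAt
  have hdec : ∀ ε : ℝ, ε = 1 ∨ ε = -1 →
      AxisDecay ε (largeRadius γ δ) (fun k => averageDensity ε γ δ Φ Ψ χ k * m k) := fun ε hε => by
    obtain ⟨C, -, h⟩ := ((rapidDecay_averageDensity (γ := γ) (δ := δ) hΦ hΨ hε χ).mul
      (hmg ε)).le_div_sq fun k hk => one_le_norm_of_mem_sector k hk.1
    exact axisDecay_of_contourSet hε (by linarith) h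
  have iΦ := hΦ.integrable_mul_fourierLaplace χ
  have iΨ := hΨ.integrable_mul_fourierLaplace χ
  have hFeq : (fun x : ℝ => fourierLaplace χ (-(x : ℂ)) * (p * Φ (-(x : ℂ)) + q * Ψ (-(x : ℂ)))) =
      fun x : ℝ => p * (fourierLaplace χ (-(x : ℂ)) * Φ (-(x : ℂ))) +
        q * (fourierLaplace χ (-(x : ℂ)) * Ψ (-(x : ℂ))) := by ext x; ring
  have hF : Differentiable ℂ fun z => fourierLaplace χ (-z) * (p * Φ (-z) + q * Ψ (-z)) := by
    have := hΦ.differentiable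
    have := hΨ.differentiable
    fun_prop
  rw [contourS_add_contourS_eq ha'.1 ha'R (hdiff 1 (.inl rfl)) (hdiff (-1) (.inr rfl))
    (hdec 1 (.inl rfl)) (hdec (-1) (.inr rfl)) hF (hFeq ▸ (iΦ.const_mul p).add (iΨ.const_mul q)), hFeq,
    integral_add (iΦ.const_mul p) (iΨ.const_mul q), integral_const_mul, integral_const_mul,
    hΦ.integral_mul_fourierLaplace, hΨ.integral_mul_fourierLaplace]
  · ring
  · intro k hk
    have hk1 : 1 < ‖k‖ := by linarith
    have hD : DeltaS 1 γ δ k ≠ 0 := by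
      rw [DeltaS_one]
      exact (hadm.2 k (by linarith)).1
    have e1 := hφ k hk1 hD
    have e2 := hψ k hk1 hD
    simp only [averageDensity, densityS, disp_nu hk1]
    push_cast
    simp only [neg_mul, one_mul, neg_neg, mul_neg] at e1 e2 ⊢
    linear_combination fourierLaplace χ (-disp k) * Φ (-disp k) * e1 +
      fourierLaplace χ (-disp k) * Ψ (-disp k) * e2

/-- The average in time of the solution. -/
def averageTotal (γ δ : ℝ) (Φ Ψ : ℂ → ℂ) (χ : ℝ → ℂ) (n : ℕ) (x : ℝ) : ℂ :=
  -(1 / (2 * Real.pi)) * (averageSolution 1 γ δ Φ Ψ χ n x + averageSolution (-1) γ δ Φ Ψ χ n x)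

theorem hasDerivWithinAt_averageTotal (hΦ : IsTimeTransform σ φ Φ) (hΨ : IsTimeTransform σ' ψ Ψ)
    (χ : 𝓓(timeInterval T, ℂ)) (n : ℕ) {x : ℝ} (hx : x ∈ Ici (0 : ℝ)) :
    HasDerivWithinAt (averageTotal γ δ Φ Ψ χ n) (averageTotal γ δ Φ Ψ χ (n + 1) x) (Ici 0) x :=
  ((hasDerivWithinAt_averageSolution hΦ hΨ (.inl rfl) χ n hx).add
    (hasDerivWithinAt_averageSolution hΦ hΨ (.inr rfl) χ n hx)).const_mul _

theorem averageSolution_combination (hΦ : IsTimeTransform σ φ Φ) (hΨ : IsTimeTransform σ' ψ Ψ)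
    {ε : ℝ} (hε : ε = 1 ∨ ε = -1) (χ : 𝓓(timeInterval T, ℂ)) (n : ℕ) (c : ℂ) :
    averageSolution ε γ δ Φ Ψ χ (n + 1) 0 + c * averageSolution ε γ δ Φ Ψ χ n 0 =
      contourS ε (largeRadius γ δ) (fun k => averageDensity ε γ δ Φ Ψ χ k *
        ((Complex.I * k) ^ (n + 1) + c * (Complex.I * k) ^ n)) := by
  have hg := polyGrowth_I_mul (contourSet ε (largeRadius γ δ))
  obtain ⟨i1, e1⟩ := integrable_averageDensity (γ := γ) (δ := δ) hΦ hΨ hε χ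
    (m := fun k => (Complex.I * k) ^ (n + 1)) (by fun_prop) (hg _)
  obtain ⟨i2, e2⟩ := integrable_averageDensity (γ := γ) (δ := δ) hΦ hΨ hε χ
    (m := fun k => (Complex.I * k) ^ n) (by fun_prop) (hg _)
  obtain ⟨-, e3⟩ := integrable_averageDensity (γ := γ) (δ := δ) hΦ hΨ hε χ
    (m := fun k => (Complex.I * k) ^ (n + 1) + c * (Complex.I * k) ^ n) (by fun_prop)
    ((hg _).add (fun k hk => one_le_norm_of_mem_sector k hk.1) ((PolyGrowth.const _ c).mul (hg n)))
  rw [averageSolution_zero hΦ hΨ hε, averageSolution_zero hΦ hΨ hε, e1, e2, e3, ← integral_const_mul,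
    ← integral_add i1 (i2.const_mul c)]
  refine integral_congr_ae (.of_forall fun x => ?_)
  simp only
  ring

/-- Both Robin operators have the form ∂_x^{n+1} + c ∂_x^n, with n = 0, c = γ and n = 1, c = δ, so
one statement covers them. The prefactor -1/(2π) cancels the -2π from Parseval. -/
theorem averageTotal_boundary (hΦ : IsTimeTransform σ φ Φ) (hΨ : IsTimeTransform σ' ψ Ψ)
    (χ : 𝓓(timeInterval T, ℂ)) (n : ℕ) (c : ℂ) {p q : ℂ}
    (hφ : ∀ k, 1 < ‖k‖ → DeltaS 1 γ δ k ≠ 0 →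
      ((Complex.I * k) ^ (n + 1) + c * (Complex.I * k) ^ n) * phiCoef 1 γ δ k +
      ((Complex.I * nu k) ^ (n + 1) + c * (Complex.I * nu k) ^ n) *
        (phiCoef (-1) γ δ (nu k) * -(k / nu k)) = p * -((k + 2 * k ^ 3) / disp k))
    (hψ : ∀ k, 1 < ‖k‖ → DeltaS 1 γ δ k ≠ 0 →
      ((Complex.I * k) ^ (n + 1) + c * (Complex.I * k) ^ n) * psiCoef 1 γ δ k +
      ((Complex.I * nu k) ^ (n + 1) + c * (Complex.I * nu k) ^ n) *
        (psiCoef (-1) γ δ (nu k) * -(k / nu k)) = q * -((k + 2 * k ^ 3) / disp k)) :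
    averageTotal γ δ Φ Ψ χ (n + 1) 0 + c * averageTotal γ δ Φ Ψ χ n 0 =
      p * φ (testToSchwartz χ) + q * ψ (testToSchwartz χ) := by
  have h := sum_contourS_averageDensity (γ := γ) (δ := δ) hΦ hΨ χ
    (m := fun k => (Complex.I * k) ^ (n + 1) + c * (Complex.I * k) ^ n) (by fun_prop)
    (fun ε => (polyGrowth_I_mul _ _).add (fun k hk => one_le_norm_of_mem_sector k hk.1)
      ((PolyGrowth.const _ c).mul (polyGrowth_I_mul _ n))) hφ hψ
  rw [← averageSolution_combination hΦ hΨ (.inl rfl), ← averageSolution_combination hΦ hΨ (.inr rfl)] at h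
  have : (Real.pi : ℂ) ≠ 0 := by simp
  simp only [averageTotal]
  field_simp
  linear_combination -h

theorem averageTotal_first (hΦ : IsTimeTransform σ φ Φ) (hΨ : IsTimeTransform σ' ψ Ψ)
    (χ : 𝓓(timeInterval T, ℂ)) : averageTotal γ δ Φ Ψ χ 1 0 + γ * averageTotal γ δ Φ Ψ χ 0 0 =
      φ (testToSchwartz χ) := by
  rw [averageTotal_boundary hΦ hΨ χ 0 γ (p := 1) (q := 0)]
  · ring
  · intro k hk hD
    simpa using phiCoef_first hk hD
  · intro k hk _
    simpa using psiCoef_first hk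

theorem averageTotal_second (hΦ : IsTimeTransform σ φ Φ) (hΨ : IsTimeTransform σ' ψ Ψ)
    (χ : 𝓓(timeInterval T, ℂ)) : averageTotal γ δ Φ Ψ χ 2 0 + δ * averageTotal γ δ Φ Ψ χ 1 0 =
      ψ (testToSchwartz χ) := by
  rw [averageTotal_boundary hΦ hΨ χ 1 δ (p := 0) (q := 1)]
  · ring
  · intro k hk hD
    simpa [mul_pow] using phiCoef_second hk
  · intro k hk hD
    simpa [mul_pow] using psiCoef_second hk hD

theorem integrableOn_mul_test {Ω : Opens ℝ} (χ : 𝓓(Ω, ℂ)) {S : Set ℝ} (hS : MeasurableSet S)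
    {f : ℝ → ℂ} (hf : ContinuousOn f S) (hΩ : (Ω : Set ℝ) ⊆ S) : IntegrableOn (fun x => f x * χ x) S := by
  have h1 : IntegrableOn (fun x => f x * χ x) (tsupport χ) :=
    ((hf.mono (χ.tsupport_subset.trans hΩ)).mul χ.contDiff.continuous.continuousOn).integrableOn_compact
      χ.hasCompactSupport
  refine IntegrableOn.of_forall_sdiff_eq_zero h1 hS fun x hx => ?_
  rw [image_eq_zero_of_notMem_tsupport hx.2, mul_zero]

end Boundary

/-! ### The reduced problem -/

section Reduced

variable {γ δ σ σ' T : ℝ} {φ ψ : 𝓢'(ℝ, ℂ)} {Φ Ψ : ℂ → ℂ}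

theorem integral_average_utmDeriv (hΦ : IsTimeTransform σ φ Φ) (hΨ : IsTimeTransform σ' ψ Ψ)
    (χ : 𝓓(timeInterval T, ℂ)) (θ : 𝓓(halfLine, ℂ)) :
    ∫ t in Ioo 0 T, χ t * utmDeriv γ δ Φ Ψ 0 t θ =
      ∫ x in Ioi 0, averageTotal γ δ Φ Ψ χ 0 x * θ x := by
  have hL : ∀ ε : ℝ, ε = 1 ∨ ε = -1 → IntegrableOn (fun t => χ t *
      contourS ε (largeRadius γ δ) (fun k => expPairing θ k * timeDensity ε γ δ Φ Ψ 0 t k))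
      (Ioo 0 T) := fun ε hε => by
    have h := integrableOn_mul_test χ measurableSet_Icc
      (fun t ht => (hasDerivWithinAt_contourS (γ := γ) (δ := δ) hΦ hΨ hε θ 0
        (T := T) ht).continuousWithinAt) Ioo_subset_Icc_self
    simpa only [mul_comm] using h.mono_set Ioo_subset_Icc_self
  have hR : ∀ ε : ℝ, ε = 1 ∨ ε = -1 →
      IntegrableOn (fun x => averageSolution ε γ δ Φ Ψ χ 0 x * θ x) (Ioi 0) := fun ε hε =>
    (integrableOn_mul_test θ measurableSet_Ici (fun x hx =>
      (hasDerivWithinAt_averageSolution (γ := γ) (δ := δ) hΦ hΨ hε χ 0 hx).continuousWithinAt)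
      Ioi_subset_Ici_self).mono_set Ioi_subset_Ici_self
  have e1 := integral_average_contourS (γ := γ) (δ := δ) hΦ hΨ (.inl rfl) χ θ
  have e2 := integral_average_contourS (γ := γ) (δ := δ) hΦ hΨ (.inr rfl) χ θ
  have l := integral_add (hL 1 (.inl rfl)) (hL (-1) (.inr rfl))
  have r := integral_add (hR 1 (.inl rfl)) (hR (-1) (.inr rfl))
  calc _ = ∫ t in Ioo 0 T, -(1 / (2 * Real.pi) : ℂ) * (χ t *
        contourS 1 (largeRadius γ δ) (fun k => expPairing θ k * timeDensity 1 γ δ Φ Ψ 0 t k) + χ t *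
        contourS (-1) (largeRadius γ δ)
          (fun k => expPairing θ k * timeDensity (-1) γ δ Φ Ψ 0 t k)) := by
        refine integral_congr_ae (.of_forall fun t => ?_)
        simp only [utmDeriv]
        ring
    _ = ∫ x in Ioi 0, -(1 / (2 * Real.pi) : ℂ) *
        (averageSolution 1 γ δ Φ Ψ χ 0 x * θ x + averageSolution (-1) γ δ Φ Ψ χ 0 x * θ x) := by
        rw [integral_const_mul, integral_const_mul, l, r, e1, e2]
    _ = _ := by
        refine integral_congr_ae (.of_forall fun t => ?_)
        simp only [averageTotal]
        ring

theorem utmDeriv_boundary (hΦ : IsTimeTransform σ φ Φ) (hΨ : IsTimeTransform σ' ψ Ψ)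
    (χ : 𝓓(timeInterval T, ℂ)) : ∃ W : ℝ → ℂ, ContDiffOn ℝ 2 W (Ici 0) ∧
      (∀ θ : 𝓓(halfLine, ℂ), ∫ t in Ioo 0 T, χ t * utmDeriv γ δ Φ Ψ 0 t θ =
        ∫ x in Ioi 0, W x * θ x) ∧
      derivWithin W (Ici 0) 0 + γ * W 0 = φ (testToSchwartz χ) ∧
      iteratedDerivWithin 2 W (Ici 0) 0 + δ * derivWithin W (Ici 0) 0 = ψ (testToSchwartz χ) := by
  have h : ∀ n, ∀ x ∈ Ici (0 : ℝ), HasDerivWithinAt (averageTotal γ δ Φ Ψ χ n)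
      (averageTotal γ δ Φ Ψ χ (n + 1) x) (Ici 0) x :=
    fun n x hx => hasDerivWithinAt_averageTotal hΦ hΨ χ n hx
  have hu := uniqueDiffOn_Ici (0 : ℝ)
  have h1 : derivWithin (averageTotal γ δ Φ Ψ χ 0) (Ici 0) 0 = averageTotal γ δ Φ Ψ χ 1 0 :=
    (h 0 0 self_mem_Ici).derivWithin (hu 0 self_mem_Ici)
  have h2 := iteratedDerivWithin_of_hasDerivWithinAt hu h 2 self_mem_Ici
  refine ⟨averageTotal γ δ Φ Ψ χ 0, mod_cast contDiffOn_infty.mp (contDiffOn_of_hasDerivWithinAt hu h) 2,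
    integral_average_utmDeriv hΦ hΨ χ, ?_, ?_⟩
  · rw [h1, averageTotal_first hΦ hΨ]
  · rw [h1, h2, averageTotal_second hΦ hΨ]

/-- Passing to the fixed radius removes a from every later statement. -/
theorem utmSolution_eq {a : ℝ} (ha : AdmissibleRadius γ δ a)
    (hΦ : IsTimeTransform σ φ (timeFourier T φ)) (hΨ : IsTimeTransform σ' ψ (timeFourier T ψ))
    {t : ℝ} (ht : 0 ≤ t) (θ : 𝓓(halfLine, ℂ)) :
    utmSolution γ δ a T φ ψ t θ = utmDeriv γ δ (timeFourier T φ) (timeFourier T ψ) 0 t θ := by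
  rw [utmDeriv, ← contourS_solution_radius ha hΦ hΨ (.inl rfl) θ 0 ht,
    ← contourS_solution_radius ha hΦ hΨ (.inr rfl) θ 0 ht, utmSolution, contourS_one, contourS_neg_one]
  simp only [timeDensity, pow_zero, one_mul, densityS_one, densityS_neg_one, ← mul_assoc]
  push_cast
  simp only [neg_mul, one_mul, neg_neg]
  ring

theorem timeDeriv_utmSolution {a : ℝ} (ha : AdmissibleRadius γ δ a) (hT : 0 < T)
    (hΦ : IsTimeTransform σ φ (timeFourier T φ)) (hΨ : IsTimeTransform σ' ψ (timeFourier T ψ))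
    (j : ℕ) {t : ℝ} (ht : t ∈ Icc 0 T) (θ : 𝓓(halfLine, ℂ)) :
    timeDeriv T (utmSolution γ δ a T φ ψ) j t θ =
      utmDeriv γ δ (timeFourier T φ) (timeFourier T ψ) j t θ := by
  rw [timeDeriv, iteratedDerivWithin_congr (fun τ hτ => utmSolution_eq ha hΦ hΨ hτ.1 θ) ht]
  exact iteratedDerivWithin_of_hasDerivWithinAt (uniqueDiffOn_Icc hT)
    (F := fun j τ => utmDeriv γ δ (timeFourier T φ) (timeFourier T ψ) j τ θ)
    (fun j τ hτ => hasDerivWithinAt_utmDeriv hΦ hΨ θ j hτ) j ht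

theorem isReducedSolution {a : ℝ} (ha : AdmissibleRadius γ δ a) (hT : 0 < T)
    (hΦ : IsTimeTransform σ φ (timeFourier T φ)) (hΨ : IsTimeTransform σ' ψ (timeFourier T ψ))
    (hres : ∀ t ∈ Icc 0 T, ∃ F : 𝓢'(ℝ, ℂ),
      RestrictsTo F (utmDeriv γ δ (timeFourier T φ) (timeFourier T ψ) 0 t)) :
    IsReducedSolution γ δ T φ ψ (utmSolution γ δ a T φ ψ) where
  restriction t ht := by
    obtain ⟨F, hF⟩ := hres t ht
    exact ⟨F, fun θ => (hF θ).trans (utmSolution_eq ha hΦ hΨ ht.1 θ).symm⟩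
  smooth θ := ContDiffOn.congr (contDiffOn_of_hasDerivWithinAt (uniqueDiffOn_Icc hT)
    (F := fun j τ => utmDeriv γ δ (timeFourier T φ) (timeFourier T ψ) j τ θ)
    (fun j τ hτ => hasDerivWithinAt_utmDeriv hΦ hΨ θ j hτ))
    fun τ hτ => utmSolution_eq ha hΦ hΨ hτ.1 θ
  equation t ht θ := by
    rw [timeDeriv_utmSolution ha hT hΦ hΨ 2 ht, utmSolution_eq ha hΦ hΨ ht.1,
      utmSolution_eq ha hΦ hΨ ht.1]
    have h1 := contourS_equation (γ := γ) (δ := δ) hΦ hΨ (.inl rfl) θ ht.1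
    have h2 := contourS_equation (γ := γ) (δ := δ) hΦ hΨ (.inr rfl) θ ht.1
    simp only [utmDeriv]
    linear_combination -(1 / (2 * Real.pi) : ℂ) * (h1 + h2)
  initial θ := by rw [utmSolution_eq ha hΦ hΨ le_rfl, utmDeriv_zero hΦ hΨ]
  initial_deriv θ := by
    rw [timeDeriv_utmSolution ha hT hΦ hΨ 1 (left_mem_Icc.mpr hT.le), utmDeriv_zero hΦ hΨ]
  boundary χ := by
    obtain ⟨W, h1, h2, h3⟩ := utmDeriv_boundary (γ := γ) (δ := δ) hΦ hΨ χ
    refine ⟨W, h1, fun θ => (setIntegral_congr_fun measurableSet_Ioo fun t ht => ?_).trans (h2 θ), h3⟩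
    rw [utmSolution_eq ha hΦ hΨ ht.1.le]

/-! ### The half-line estimate. -/

theorem IsTimeTransform.eLpNorm_le (hΦ : IsTimeTransform σ φ Φ) :
    eLpNorm (fun ξ => (weight σ ξ : ℂ) * Φ ((2 * Real.pi * ξ : ℝ) : ℂ)) 2 ≤ sobolevNorm σ φ := by
  rw [hΦ.norm_eq]
  refine le_mul_of_one_le_left' ?_
  rw [ENNReal.one_le_ofReal, Real.one_le_sqrt]
  linarith [Real.pi_gt_three]

/-- The constant is attached to an upper bound N for T, not to T: the disc bounds of the transforms
and the exponentials on the arc are uniform over T ≤ N. -/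
theorem exists_halfBound_utmDeriv (γ δ s : ℝ) (j : ℕ) (N : ℝ) : ∃ M : ℝ, 0 < M ∧
    ∀ T ≤ N, ∀ φ ψ : 𝓢'(ℝ, ℂ), Distribution.dsupport φ ⊆ Ioo 0 T →
      Distribution.dsupport ψ ⊆ Ioo 0 T →
      sobolevNorm ((2 * s - 1) / 4) φ < ⊤ → sobolevNorm ((2 * s - 3) / 4) ψ < ⊤ →
      ∀ t ∈ Icc 0 T, HalfBound (s - 2 * j)
        (utmDeriv γ δ (timeFourier T φ) (timeFourier T ψ) j t)
        (ENNReal.ofReal M * (sobolevNorm ((2 * s - 1) / 4) φ + sobolevNorm ((2 * s - 3) / 4) ψ)) := by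
  obtain ⟨K₁, hK₁, h₁⟩ := exists_norm_timeFourier_le ((2 * s - 1) / 4) (2 * largeRadius γ δ ^ 2) N
  obtain ⟨K₂, hK₂, h₂⟩ := exists_norm_timeFourier_le ((2 * s - 3) / 4) (2 * largeRadius γ δ ^ 2) N
  obtain ⟨M, hM, h⟩ := exists_halfBound_contour γ δ s j N (max K₁ K₂)
  refine ⟨2 * M + 1, by positivity, fun T hT φ ψ hdφ hdψ hφ hψ t ht => ?_⟩
  have hΦ := isTimeTransform hdφ hφ
  have hΨ := isTimeTransform hdψ hψ
  set n := sobolevNorm ((2 * s - 1) / 4) φ + sobolevNorm ((2 * s - 3) / 4) ψ with hn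
  have hntop : n ≠ ⊤ := ENNReal.add_ne_top.mpr ⟨hφ.ne, hψ.ne⟩
  have hbound : ∀ {K : ℝ} {z : ℂ} {b : ℝ≥0∞}, b ≠ ⊤ → 0 ≤ K → K ≤ max K₁ K₂ → b ≤ n →
      ‖z‖ ≤ K * b.toReal → ‖z‖ₑ ≤ ENNReal.ofReal (max K₁ K₂) * n := fun {K z b} hb hK0 hK hbn hz => by
    rw [← ofReal_norm]
    calc _ ≤ _ := ENNReal.ofReal_le_ofReal hz
      _ = ENNReal.ofReal K * b := by rw [ENNReal.ofReal_mul hK0, ENNReal.ofReal_toReal hb]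
      _ ≤ _ := by gcongr
  have hn1 : sobolevNorm ((2 * s - 1) / 4) φ ≤ n := le_self_add
  have hn2 : sobolevNorm ((2 * s - 3) / 4) ψ ≤ n := le_add_self
  have hall := fun ε hε => h ε hε (timeFourier T φ) (timeFourier T ψ)
    hΦ.differentiable.continuous.measurable hΨ.differentiable.continuous.measurable n hntop
    (hΦ.eLpNorm_le.trans hn1) (hΨ.eLpNorm_le.trans hn2)
    (fun w hw => ⟨hbound hφ.ne hK₁ (le_max_left _ _) hn1 (h₁ T hT φ hdφ hφ w hw),
      hbound hψ.ne hK₂ (le_max_right _ _) hn2 (h₂ T hT ψ hdψ hψ w hw)⟩) t ⟨ht.1, ht.2.trans hT⟩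
  have htop : ENNReal.ofReal M * n ≠ ⊤ := ENNReal.mul_ne_top ENNReal.ofReal_ne_top hntop
  refine (((hall 1 (.inl rfl)).add (hall (-1) (.inr rfl)) htop htop).const_mul
    (-(1 / (2 * Real.pi)) : ℂ)).mono ?_
  have hc : ‖(-(1 / (2 * Real.pi)) : ℂ)‖ₑ ≤ 1 := by
    rw [← ofReal_norm, ENNReal.ofReal_le_one, norm_neg, norm_div, norm_one, norm_mul,
      Complex.norm_real, Real.norm_eq_abs, abs_of_pos Real.pi_pos, Complex.norm_ofNat]
    rw [div_le_one (by positivity)]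
    linarith [Real.pi_gt_three]
  calc _ ≤ 1 * (ENNReal.ofReal M * n + ENNReal.ofReal M * n) := by gcongr
    _ = ENNReal.ofReal (2 * M) * n := by
        rw [one_mul, ← add_mul, ← ENNReal.ofReal_add hM hM, two_mul]
    _ ≤ _ := by gcongr; linarith

end Reduced

end GoodBoussinesq

end

theorem theorem2p1 (γ δ : ℝ) :
    (∃ a : ℝ, AdmissibleRadius γ δ a) ∧
    ∃ (c : ℕ → ℝ → ℝ) (C : ℕ → ℝ → ℝ → ℝ),
      (∀ j s, 0 < c j s) ∧ (∀ j s T, 0 < C j s T) ∧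
      (∀ j s, ∃ M : ℝ, ∀ᶠ T in 𝓝[>] (0 : ℝ), C j s T ≤ M) ∧
      ∀ (s T : ℝ), 0 < T → ∀ φ ψ : 𝓢'(ℝ, ℂ),
        Distribution.dsupport φ ⊆ Ioo 0 T → Distribution.dsupport ψ ⊆ Ioo 0 T →
        sobolevNorm ((2 * s - 1) / 4) φ < ⊤ → sobolevNorm ((2 * s - 3) / 4) ψ < ⊤ →
        ∀ a : ℝ, AdmissibleRadius γ δ a →
          IsReducedSolution γ δ T φ ψ (utmSolution γ δ a T φ ψ) ∧
          ∀ t ∈ Icc 0 T, ∀ j : ℕ,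
            sobolevNormHalfLine (s - 2 * j) (timeDeriv T (utmSolution γ δ a T φ ψ) j t) ≤
              ENNReal.ofReal
                (c j s + C j s T * Real.sqrt (T + 1) * (1 - Real.exp (-(T + 1)))⁻¹) *
              (sobolevNorm ((2 * s - 1) / 4) φ + sobolevNorm ((2 * s - 3) / 4) ψ) := by
  refine ⟨⟨_, admissibleRadius_largeRadius γ δ⟩, ?_⟩
  choose M hM h using fun (s : ℝ) (j N : ℕ) => exists_halfBound_utmDeriv γ δ s j N
  -- Rounding T up leaves one constant per natural number. For 0 < T ≤ 1 it is the one for N = 1,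
  -- whence boundedness as T → 0. The factor √(2π) is that of the Sobolev norm, and c = 1 only has
  -- to be positive.
  refine ⟨fun _ _ => 1, fun j s T => Real.sqrt (2 * Real.pi) * M s j ⌈T⌉₊, fun _ _ => one_pos,
    fun j s T => mul_pos (by positivity) (hM _ _ _), fun j s => ⟨Real.sqrt (2 * Real.pi) * M s j 1, ?_⟩,
    fun s T hT φ ψ hdφ hdψ hφ hψ a ha => ?_⟩
  · filter_upwards [Ioc_mem_nhdsGT (zero_lt_one' ℝ)] with T hT
    have : ⌈T⌉₊ = 1 := by
      refine le_antisymm (Nat.ceil_le.mpr (by simpa using hT.2)) (Nat.ceil_pos.mpr hT.1)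
    rw [this]
  have hΦ := isTimeTransform hdφ hφ
  have hΨ := isTimeTransform hdψ hψ
  have hB := fun j => h s j ⌈T⌉₊ T (Nat.le_ceil T) φ ψ hdφ hdψ hφ hψ
  have htop : ∀ j, ENNReal.ofReal (M s j ⌈T⌉₊) *
      (sobolevNorm ((2 * s - 1) / 4) φ + sobolevNorm ((2 * s - 3) / 4) ψ) ≠ ⊤ := fun j =>
    ENNReal.mul_ne_top ENNReal.ofReal_ne_top (ENNReal.add_ne_top.mpr ⟨hφ.ne, hψ.ne⟩)
  refine ⟨isReducedSolution ha hT hΦ hΨ fun t ht => ?_, fun t ht j => ?_⟩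
  · obtain ⟨F, hF, -⟩ := (hB 0 t ht).exists_restriction (htop 0)
    exact ⟨F, hF⟩
  · rw [funext fun θ => timeDeriv_utmSolution ha hT hΦ hΨ j ht θ]
    refine ((hB j t ht).sobolevNormHalfLine_le (htop j)).trans ?_
    rw [← mul_assoc, ← ENNReal.ofReal_mul (by positivity)]
    gcongr
    -- The factors √(T+1) and (1-e^{-(T+1)})^{-1} are at least 1, so the bound already obtained lies
    -- below the required one.
    have h0 := mul_pos (show 0 < Real.sqrt (2 * Real.pi) by positivity) (hM s j ⌈T⌉₊)
    have h1 : 1 ≤ Real.sqrt (T + 1) := Real.one_le_sqrt.mpr (by linarith)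
    have h2 : 0 < 1 - Real.exp (-(T + 1)) := by
      rw [sub_pos, Real.exp_lt_one_iff]
      linarith
    have h3 : 1 ≤ (1 - Real.exp (-(T + 1)))⁻¹ :=
      (one_le_inv₀ h2).mpr (by linarith [Real.exp_pos (-(T + 1))])
    have h4 := one_le_mul_of_one_le_of_one_le h1 h3
    nlinarith [mul_le_mul_of_nonneg_left h4 h0.le]
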